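/- Let $p,q\ge 2$ be integers, $\beta>0$ and $h\ge 0$. The Curie–Weiss Potts measure on $[q]^N$ is $$\mathbb P_{\beta,h,N}(X)=\frac{1}{q^N Z_N(\beta,h)}\exp\Big(\beta N\sum_{r=1}^q \bar X_{\cdot r}^{\,p}+Nh\bar X_{\cdot 1}\Big),\qquad \bar X_{\cdot r}=\frac1N\#\{i\le N: X_i=r\},$$ where $Z_N(\beta,h)$ is the normalizing constant, and $\bar X_N=(\bar X_{\cdot 1},\dots,\bar X_{\cdot q})$. On the set of $q$-dimensional probability vectors put $H_{\beta,h}(t)=\beta\sum_{r} t_r^p+ht_1-\sum_{r} t_r\log t_r$ (with $0\log 0=0$). Assume that $(\beta,h)$ is regular, that is, $H_{\beta,h}$ has a unique global maximizer $m_*$, and the quadratic form $\sum_{r}\big(\beta p(p-1)m_{*,r}^{p-2}-1/m_{*,r}\big)t_r^2$ is negative definite on $\{t\in\mathbb R^q:\sum_r t_r=0\}$. Let $W_N=\sqrt N(\bar X_N-m_*)$ with $X$ distributed according to $\mathbb P_{\beta,h,N}$, let $\Sigma=\Sigma_N=\mathrm{Cov}(W_N)$, let $\Sigma^{1/2}$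 be its positive semidefinite square root, and let $Z$ be a $q$-dimensional standard normal vector. (1) For every thrice differentiable $g:\mathbb R^q\to\mathbb R$ whose derivatives of orders $1,2,3$ are bounded, there is a constant $C>0$, depending only on $\beta,h,p,q$ and $g$, such that for all $N\ge 1$ $$|\mathbb E g(W_N)-\mathbb E g(\Sigma^{1/2}Z)|\le C N^{-1/2}.$$ (2) For all real $M,c$ there is a constant $D>0$, depending only on $\beta,h,p,q,M,c$, such that $$\sup_{g\in\mathcal G}|\mathbb E g(W_N)-\mathbb E g(\Sigma^{1/2}Z)|\le \frac{D\log N}{\sqrt N}\qquad\text{for all } N\ge 2$$ holds for every class $\mathcal G$ of Borel measurable functions $g:\mathbb R^q\to\mathbb R$ with the following properties: (i) $|g|\le M$ for all $g\in\mathcal G$; (ii) for $g\in\mathcal G$, every $q\times q$ matrix $A$ and every $b\in\mathbb R^q$, the function $x\mapsto g(Ax+b)$ is in $\mathcal G$; (iii) for $g\in\mathcal G$ and $\delta>0$, the functions $g_\delta^+(x)=\sup_{|y|\le\delta}g(x+y)$ and $g_\delta^-(x)=\inf_{|y|\le\delta}g(x+y)$ are in $\mathcal G$; (iv) $\int_{\mathbb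 R^q}\big(g_\delta^+(x)-g_\delta^-(x)\big)\phi(x)\,dx\le c\,\delta$ for all $g\in\mathcal G$ and $\delta>0$, where $\phi$ is the $q$-dimensional standard normal density. -/

import Mathlib

open MeasureTheory ProbabilityTheory
open scoped MatrixOrder

namespace CurieWeissPotts

noncomputable section

/-- `X̄_N`: the vector of proportions of the `q` colors in a configuration `X` of `N` sites. -/
def magnetization {q N : ℕ} (X : Fin N → Fin q) (r : Fin q) : ℝ :=
  (∑ i : Fin N, if X i = r then (1 : ℝ) else 0) / N

/-- The exponent `β N ∑_r X̄_r ^ p + N h X̄_1`; the first color is `0 : Fin q`. -/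
def energy (p q : ℕ) [NeZero q] (β h : ℝ) (N : ℕ) (X : Fin N → Fin q) : ℝ :=
  β * N * ∑ r, magnetization X r ^ p + N * h * magnetization X 0

/-- The normalizing constant `Z_N(β, h)`. -/
def partitionFunction (p q : ℕ) [NeZero q] (β h : ℝ) (N : ℕ) : ℝ :=
  ((q : ℝ) ^ N)⁻¹ * ∑ X : Fin N → Fin q, Real.exp (energy p q β h N X)

/-- The probability mass `P_{β,h,N}(X)` of a configuration. -/
def gibbsMass (p q : ℕ) [NeZero q] (β h : ℝ) (N : ℕ) (X : Fin N → Fin q) : ℝ :=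
  1 / ((q : ℝ) ^ N * partitionFunction p q β h N) * Real.exp (energy p q β h N X)

/-- The `p`-tensor Curie-Weiss Potts measure on `[q]^N`. -/
def gibbsMeasure (p q : ℕ) [NeZero q] (β h : ℝ) (N : ℕ) : Measure (Fin N → Fin q) :=
  ∑ X : Fin N → Fin q, ENNReal.ofReal (gibbsMass p q β h N X) • Measure.dirac X

instance (p q : ℕ) [NeZero q] (β h : ℝ) (N : ℕ) :
    IsProbabilityMeasure (gibbsMeasure p q β h N) := by
  have hS : 0 < ∑ X : Fin N → Fin q, Real.exp (energy p q β h N X) :=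
    Finset.sum_pos (fun _ _ => Real.exp_pos _) Finset.univ_nonempty
  have hq : (0 : ℝ) < (q : ℝ) ^ N := by
    have := NeZero.pos q
    positivity
  have hnn : ∀ X, 0 ≤ gibbsMass p q β h N X := fun X => by
    unfold gibbsMass partitionFunction
    positivity
  constructor
  simp only [gibbsMeasure, Measure.finsetSum_apply, Measure.smul_apply, measure_univ,
    smul_eq_mul, mul_one]
  rw [← ENNReal.ofReal_sum_of_nonneg (fun X _ => hnn X), ← ENNReal.ofReal_one]
  congr 1
  simp only [gibbsMass, partitionFunction]
  rw [← Finset.mul_sum]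
  field_simp

/-- The negative free energy `H_{β,h}`. It is used on the probability simplex only, where
`Real.log 0 = 0` gives the usual convention `0 log 0 = 0`. -/
def negFreeEnergy (p : ℕ) {q : ℕ} [NeZero q] (β h : ℝ) (t : Fin q → ℝ) : ℝ :=
  β * ∑ r, t r ^ p + h * t 0 - ∑ r, t r * Real.log (t r)

/-- The quadratic form `Q_{v,β}`. -/
def quadForm (p : ℕ) {q : ℕ} (β : ℝ) (v t : Fin q → ℝ) : ℝ :=
  ∑ r, (β * p * ((p : ℝ) - 1) * v r ^ (p - 2) - 1 / v r) * t r ^ 2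

/-- `m` is the unique global maximizer of `H_{β,h}` over the `q`-dimensional probability vectors. -/
def IsUniqueMaximizer (p : ℕ) {q : ℕ} [NeZero q] (β h : ℝ) (m : Fin q → ℝ) : Prop :=
  m ∈ stdSimplex ℝ (Fin q) ∧
    ∀ t ∈ stdSimplex ℝ (Fin q), t ≠ m → negFreeEnergy p β h t < negFreeEnergy p β h m

/-- `(β, h)` is a regular point of the parameter space `(0, ∞) × [0, ∞)`. -/
def IsRegularPoint (p q : ℕ) [NeZero q] (β h : ℝ) : Prop :=
  0 < β ∧ 0 ≤ h ∧ ∃ m : Fin q → ℝ, IsUniqueMaximizer p β h m ∧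
    ∀ t : Fin q → ℝ, ∑ r, t r = 0 → t ≠ 0 → quadForm p β m t < 0

/-- `W_N = √N (X̄_N - m)`. -/
def W {q N : ℕ} (m : Fin q → ℝ) (X : Fin N → Fin q) : EuclideanSpace ℝ (Fin q) :=
  WithLp.toLp 2 fun r => √(N : ℝ) * (magnetization X r - m r)

/-- `Cov(W_N)` under the Curie-Weiss Potts measure. -/
def covMatrix (p q : ℕ) [NeZero q] (β h : ℝ) (m : Fin q → ℝ) (N : ℕ) :
    Matrix (Fin q) (Fin q) ℝ :=
  Matrix.of fun r s => cov[fun X => W m X r, fun X => W m X s; gibbsMeasure p q β h N]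

/-- `E g(W_N)`. -/
def expectW (p q : ℕ) [NeZero q] (β h : ℝ) (m : Fin q → ℝ) (N : ℕ)
    (g : EuclideanSpace ℝ (Fin q) → ℝ) : ℝ :=
  ∫ X, g (W m X) ∂(gibbsMeasure p q β h N)

/-- `E g(S^{1/2} Z)` for a standard normal vector `Z`, where `S^{1/2}` is the positive semidefinite
square root of the positive semidefinite matrix `S`. -/
def expectGaussian {q : ℕ} (S : Matrix (Fin q) (Fin q) ℝ)
    (g : EuclideanSpace ℝ (Fin q) → ℝ) : ℝ :=
  ∫ z, g (Matrix.toEuclideanCLM (𝕜 := ℝ) (CFC.sqrt S) z)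
    ∂(stdGaussian (EuclideanSpace ℝ (Fin q)))

/-- `g` is three times differentiable and its derivatives of orders 1, 2, 3 are bounded, i.e. the
sup norms `|g|_1, |g|_2, |g|_3` are finite. -/
def IsThriceDiffBounded {q : ℕ} (g : EuclideanSpace ℝ (Fin q) → ℝ) : Prop :=
  (∀ k < 3, Differentiable ℝ (iteratedFDeriv ℝ k g)) ∧
    ∃ K : ℝ, ∀ k : ℕ, 1 ≤ k → k ≤ 3 → ∀ x, ‖iteratedFDeriv ℝ k g x‖ ≤ K

/-- `g_δ⁺(x) = sup {g(x + y) : |y| ≤ δ}`. -/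
def supBall {q : ℕ} (g : EuclideanSpace ℝ (Fin q) → ℝ) (δ : ℝ)
    (x : EuclideanSpace ℝ (Fin q)) : ℝ :=
  sSup ((fun y => g (x + y)) '' Metric.closedBall 0 δ)

/-- `g_δ⁻(x) = inf {g(x + y) : |y| ≤ δ}`. -/
def infBall {q : ℕ} (g : EuclideanSpace ℝ (Fin q) → ℝ) (δ : ℝ)
    (x : EuclideanSpace ℝ (Fin q)) : ℝ :=
  sInf ((fun y => g (x + y)) '' Metric.closedBall 0 δ)

/-- The defining properties of the function class `𝒢` on `ℝ^q`, with uniform bound `M` and constant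
`c` in the Gaussian oscillation estimate. -/
structure IsTestClass {q : ℕ} (M c : ℝ) (𝒢 : Set (EuclideanSpace ℝ (Fin q) → ℝ)) : Prop where
  measurable : ∀ g ∈ 𝒢, Measurable g
  bounded : ∀ g ∈ 𝒢, ∀ x, |g x| ≤ M
  affine : ∀ g ∈ 𝒢, ∀ (A : Matrix (Fin q) (Fin q) ℝ) (b : EuclideanSpace ℝ (Fin q)),
    (fun x => g (Matrix.toEuclideanCLM (𝕜 := ℝ) A x + b)) ∈ 𝒢
  supBall_mem : ∀ g ∈ 𝒢, ∀ δ : ℝ, 0 < δ → supBall g δ ∈ 𝒢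
  infBall_mem : ∀ g ∈ 𝒢, ∀ δ : ℝ, 0 < δ → infBall g δ ∈ 𝒢
  oscillation : ∀ g ∈ 𝒢, ∀ δ : ℝ, 0 < δ →
    ∫ x, (supBall g δ x - infBall g δ x) ∂(stdGaussian (EuclideanSpace ℝ (Fin q))) ≤ c * δ

end

end CurieWeissPotts

open CurieWeissPotts

namespace CurieWeissPotts

open Filter Topology

/-! ### Taylor expansion on the line -/

/-! The law of `W_N` is carried by the vector k of color counts, whose weight is a multinomial
coefficient times an explicit exponential. Stirling's formula turns this weight into exp(N (H(k/N) -
H(m))) up to a common factor, where H is the negative free energy and m its maximizer. The entropy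
keeps m in the interior of the simplex, so the linear term of H at m vanishes along the simplex;
regularity makes the Hessian negative definite there. With y = √N (k/N - m) the normalized weight
near m is therefore a Gaussian in y, with an error of order (1 + |y|)³ / √N in the exponent, and
uniqueness of the maximizer makes the remaining weights exponentially small.

The coordinates of y sum to zero, so the limit is degenerate in ℝ^q. A linear chart of the
hyperplane, of dimension d = q - 1, turns the Hessian form into the squared norm. Spreading each
weight over a lattice cell produces a density, and the local limit theorem
`exists_smearedWeight_sub_gaussian_le` places it within O(N^{-1/2}) exp(-c |z|²) of the Gaussian
profile. Hence (`exists_abs_expectW_sub_gaussian_le`) expectations of functions of at most quadratic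
growth are Gaussian expectations up to O(N^{-1/2}) plus the mean oscillation of the function at
scale N^{-1/2}.

Applied to coordinates and their products, this shows that the covariance in the chart is I +
O(N^{-1/2}). A second comparison of densities (`exists_abs_expectGaussian_sub_le`) then moves the
Gaussian law with the exact covariance to the standard one, and
`exists_abs_expectW_sub_expectGaussian_le` combines the two. Only the oscillation is left: in (1) it
is O(N^{-1/2}) because g is Lipschitz, and in (2) it is controlled by property (iv), applied to g
composed with the chart. Both parts come out with the rate N^{-1/2}; the factor log N in (2) is a
relaxation. Finitely many small N are absorbed in the constants. -/

theorem abs_le_pow_succ_of_hasDerivAt {R r : ℝ → ℝ} {a ε C : ℝ} {n : ℕ}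
    (hR : ∀ x, |x - a| ≤ ε → HasDerivAt R (r x) x) (hr : ∀ x, |x - a| ≤ ε → |r x| ≤ C * |x - a| ^ n)
    (hC : 0 ≤ C) (h0 : R a = 0) (x : ℝ) (hx : |x - a| ≤ ε) : |R x| ≤ C * |x - a| ^ (n + 1) := by
  have hsub : ∀ y ∈ Metric.closedBall a |x - a|, |y - a| ≤ |x - a| := fun y hy => by
    simpa [Real.dist_eq] using hy
  have := (convex_closedBall a |x - a|).norm_image_sub_le_of_norm_hasDerivWithin_le
    (f := R) (f' := r) (C := C * |x - a| ^ n)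
    (fun y hy => (hR y ((hsub y hy).trans hx)).hasDerivWithinAt)
    (fun y hy => by
      refine (hr y ((hsub y hy).trans hx)).trans ?_
      have := hsub y hy
      gcongr)
    (Metric.mem_closedBall_self (abs_nonneg _))
    (show x ∈ _ by simp [Real.dist_eq])
  rw [h0, sub_zero, Real.norm_eq_abs, Real.norm_eq_abs] at this
  rw [pow_succ, ← mul_assoc]
  exact this

/-- The remainder is integrated three times with `abs_le_pow_succ_of_hasDerivAt`. The mean value
inequality gains a power but no factorial, hence C in place of C/6. -/
theorem abs_sub_taylor_two_le {f f₁ f₂ f₃ : ℝ → ℝ} {a ε C : ℝ}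
    (h₁ : ∀ x, |x - a| ≤ ε → HasDerivAt f (f₁ x) x) (h₂ : ∀ x, |x - a| ≤ ε → HasDerivAt f₁ (f₂ x) x)
    (h₃ : ∀ x, |x - a| ≤ ε → HasDerivAt f₂ (f₃ x) x) (hC : 0 ≤ C)
    (hb : ∀ x, |x - a| ≤ ε → |f₃ x| ≤ C) (x : ℝ) (hx : |x - a| ≤ ε) :
    |f x - f a - f₁ a * (x - a) - f₂ a / 2 * (x - a) ^ 2| ≤ C * |x - a| ^ 3 := by
  have b₂ : ∀ x, |x - a| ≤ ε → |f₂ x - f₂ a| ≤ C * |x - a| ^ (0 + 1) :=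
    abs_le_pow_succ_of_hasDerivAt (R := fun x => f₂ x - f₂ a) (fun x hx => (h₃ x hx).sub_const _)
      (fun x hx => by simpa using hb x hx) hC (by simp)
  have b₁ : ∀ x, |x - a| ≤ ε → |f₁ x - f₁ a - f₂ a * (x - a)| ≤ C * |x - a| ^ (0 + 1 + 1) :=
    abs_le_pow_succ_of_hasDerivAt (R := fun x => f₁ x - f₁ a - f₂ a * (x - a))
      (r := fun x => f₂ x - f₂ a)
      (fun x hx => by
        have := ((h₂ x hx).sub_const (f₁ a)).sub (((hasDerivAt_id x).sub_const a).const_mul (f₂ a))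
        exact this.congr_deriv (by simp)) b₂ hC (by simp)
  refine abs_le_pow_succ_of_hasDerivAt
    (R := fun x => f x - f a - f₁ a * (x - a) - f₂ a / 2 * (x - a) ^ 2)
    (r := fun x => f₁ x - f₁ a - f₂ a * (x - a)) (n := 2)
    (C := C) (fun x hx => ?_) b₁ hC (by simp) x hx
  have := (((h₁ x hx).sub_const (f a)).sub (((hasDerivAt_id x).sub_const a).const_mul (f₁ a))).sub
    ((((hasDerivAt_id x).sub_const a).pow 2).const_mul (f₂ a / 2))
  refine (this.congr_deriv ?_)
  simp
  ring

/-! ### The contribution of one color to the free energy -/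

/-- The contribution of the color `r` to the negative free energy. -/
noncomputable def colorEnergy (p : ℕ) {q : ℕ} [NeZero q] (β h : ℝ) (r : Fin q) (x : ℝ) : ℝ :=
  β * x ^ p + (if r = 0 then h else 0) * x - x * Real.log x

/-- The derivative of `colorEnergy` on the positive half-line. -/
noncomputable def colorEnergyDeriv (p : ℕ) {q : ℕ} [NeZero q] (β h : ℝ) (r : Fin q) (x : ℝ) : ℝ :=
  β * (p * x ^ (p - 1)) + (if r = 0 then h else 0) - (Real.log x + 1)

/-- The second derivative of `colorEnergy` on the positive half-line. -/
noncomputable def colorEnergyDeriv₂ (p : ℕ) (β : ℝ) (x : ℝ) : ℝ :=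
  β * p * ((p : ℝ) - 1) * x ^ (p - 2) - 1 / x

theorem quadForm_eq_sum {p q : ℕ} {β : ℝ} (v t : Fin q → ℝ) :
    quadForm p β v t = ∑ r, colorEnergyDeriv₂ p β (v r) * t r ^ 2 := rfl

section

variable {p q : ℕ} [NeZero q] {β h : ℝ}

theorem negFreeEnergy_eq_sum (t : Fin q → ℝ) :
    negFreeEnergy p β h t = ∑ r, colorEnergy p β h r (t r) := by
  simp [negFreeEnergy, colorEnergy, Finset.sum_add_distrib, Finset.mul_sum]

theorem hasDerivAt_colorEnergy (r : Fin q) {x : ℝ} (hx : 0 < x) :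
    HasDerivAt (colorEnergy p β h r) (colorEnergyDeriv p β h r x) x := by
  have := (((hasDerivAt_pow p x).const_mul β).add
    ((hasDerivAt_id x).const_mul (if r = 0 then h else 0))).sub (Real.hasDerivAt_mul_log hx.ne')
  exact this.congr_deriv (by simp [colorEnergyDeriv])

theorem hasDerivAt_colorEnergyDeriv (hp : 2 ≤ p) (r : Fin q) {x : ℝ} (hx : 0 < x) :
    HasDerivAt (colorEnergyDeriv p β h r) (colorEnergyDeriv₂ p β x) x := by
  obtain ⟨k, rfl⟩ : ∃ k, p = k + 2 := ⟨p - 2, by omega⟩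
  have := ((((hasDerivAt_pow (k + 1) x).const_mul ((k + 2 : ℕ) : ℝ)).const_mul β).add_const
    (if r = 0 then h else 0)).sub ((Real.hasDerivAt_log hx.ne').add_const 1)
  refine this.congr_deriv ?_
  simp [colorEnergyDeriv₂]
  ring

theorem continuous_colorEnergy (r : Fin q) : Continuous (colorEnergy p β h r) := by
  have := Real.continuous_mul_log
  unfold colorEnergy
  fun_prop

theorem continuous_negFreeEnergy : Continuous (negFreeEnergy p (q := q) β h) := by
  have : negFreeEnergy p (q := q) β h = fun t => ∑ r, colorEnergy p β h r (t r) :=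
    funext negFreeEnergy_eq_sum
  rw [this]
  exact continuous_finsetSum _ fun r _ => (continuous_colorEnergy r).comp (continuous_apply r)

theorem exists_colorEnergy_taylor (hp : 2 ≤ p) (r : Fin q) {a : ℝ} (ha : 0 < a) :
    ∃ C ε : ℝ, 0 ≤ C ∧ 0 < ε ∧ ∀ x, |x - a| ≤ ε →
      |colorEnergy p β h r x - colorEnergy p β h r a - colorEnergyDeriv p β h r a * (x - a)
        - colorEnergyDeriv₂ p β a / 2 * (x - a) ^ 2| ≤ C * |x - a| ^ 3 := by
  -- The third derivative. For p = 2 the factor p - 2 vanishes, so the truncated exponent p - 2 - 1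
  -- does no harm.
  let f₃ : ℝ → ℝ := fun x => β * p * ((p : ℝ) - 1) * (((p - 2 : ℕ) : ℝ) * x ^ (p - 2 - 1))
    + 1 / x ^ 2
  have hpos : ∀ x, |x - a| ≤ a / 2 → 0 < x := fun x hx => by
    have := (abs_le.1 hx).1
    linarith
  have hc : ContinuousOn f₃ (Metric.closedBall a (a / 2)) := by
    refine ContinuousOn.add (by fun_prop) (continuousOn_const.div (by fun_prop) fun x hx => ?_)
    have := hpos x (by simpa [Real.dist_eq] using hx)
    positivity
  obtain ⟨C, hC⟩ := (isCompact_closedBall a (a / 2)).exists_bound_of_continuousOn hc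
  have hC0 : 0 ≤ C := (norm_nonneg _).trans (hC a (Metric.mem_closedBall_self (by positivity)))
  refine ⟨C, a / 2, hC0, by positivity, abs_sub_taylor_two_le (f₃ := f₃)
    (fun x hx => hasDerivAt_colorEnergy r (hpos x hx))
    (fun x hx => hasDerivAt_colorEnergyDeriv hp r (hpos x hx)) (fun x hx => ?_) hC0
    (fun x hx => hC x (by simpa [Real.dist_eq] using hx))⟩
  have hx := hpos x hx
  have := ((hasDerivAt_pow (p - 2) x).const_mul (β * p * ((p : ℝ) - 1))).sub
    (hasDerivAt_inv hx.ne')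
  simp only [← one_div] at this
  refine this.congr_deriv ?_
  simp only [f₃]
  ring

end

/-! ### First-order conditions at the maximizer -/

section

variable {p q : ℕ} [NeZero q] {β h : ℝ} {m : Fin q → ℝ}

/-- Moving mass x from color s to color r stays on the simplex and changes only two terms of H.
These perturbations suffice for all first-order information about the maximizer. -/
theorem IsUniqueMaximizer.transfer_le (hm : IsUniqueMaximizer p β h m) {r s : Fin q} (hrs : r ≠ s)
    {x : ℝ} (hr : 0 ≤ m r + x) (hs : 0 ≤ m s - x) :
    colorEnergy p β h r (m r + x) + colorEnergy p β h s (m s - x)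
      ≤ colorEnergy p β h r (m r) + colorEnergy p β h s (m s) := by
  set t : Fin q → ℝ := Function.update (Function.update m r (m r + x)) s (m s - x) with ht
  have hsum : ∀ F : Fin q → ℝ → ℝ, ∑ i, F i (t i) - ∑ i, F i (m i)
      = F r (m r + x) + F s (m s - x) - F r (m r) - F s (m s) := by
    intro F
    rw [← Finset.sum_sub_distrib, ← Finset.sum_subset (Finset.subset_univ {r, s}),
      Finset.sum_pair hrs]
    · simp [ht, hrs]
      ring
    · intro i _ hi
      simp only [Finset.mem_insert, Finset.mem_singleton, not_or] at hi
      simp [ht, hi.1, hi.2]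
  have hmem : t ∈ stdSimplex ℝ (Fin q) := by
    constructor
    · intro i
      by_cases his : i = s
      · subst his; simpa [ht] using hs
      by_cases hir : i = r
      · subst hir; simpa [ht, his] using hr
      · simpa [ht, his, hir] using hm.1.1 i
    · have := hsum (fun _ x => x)
      rw [hm.1.2] at this
      linarith
  have hle : negFreeEnergy p β h t ≤ negFreeEnergy p β h m := by
    by_cases htm : t = m
    · rw [htm]
    · exact (hm.2 t hmem htm).le
  have := hsum (colorEnergy p β h)
  rw [← negFreeEnergy_eq_sum, ← negFreeEnergy_eq_sum] at this
  linarith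

/-- The entropy has infinite slope at 0. If `m r` were 0, taking a small mass x from a charged color
s would gain at least -x log x and cost only O(x), contradicting maximality. -/
theorem IsUniqueMaximizer.pos (hβ : 0 ≤ β) (hh : 0 ≤ h) (hm : IsUniqueMaximizer p β h m)
    (hp : p ≠ 0) (r : Fin q) : 0 < m r := by
  refine (hm.1.1 r).lt_of_ne' fun h0 => ?_
  obtain ⟨s, hs⟩ : ∃ s, 0 < m s := by
    by_contra! hcon
    have := Finset.sum_nonpos (s := Finset.univ) fun i _ => hcon i
    rw [hm.1.2] at this
    linarith
  have hrs : r ≠ s := by rintro rfl; linarith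
  obtain ⟨C, hC⟩ := (hasDerivAt_colorEnergy (p := p) (β := β) (h := h) s hs).isBigO_sub.bound
  have hlim : Tendsto (fun x : ℝ => m s - x) (𝓝[>] 0) (𝓝 (m s)) := by
    have : Tendsto (fun x : ℝ => m s - x) (𝓝 0) (𝓝 (m s - 0)) := by
      exact (continuous_const.sub continuous_id).tendsto 0
    rw [sub_zero] at this
    exact this.mono_left nhdsWithin_le_nhds
  -- For such x the gain -x log x exceeds C x, the bound on the loss at s.
  have hlog := Real.tendsto_log_nhdsGT_zero.eventually_lt_atBot (-C)
  have hev := (hlim.eventually hC).and (hlog.and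
    ((hlim.eventually_const_lt hs).and self_mem_nhdsWithin))
  obtain ⟨x, h1, h2, h3, h4⟩ := hev.exists
  have h4 : 0 < x := h4
  have := hm.transfer_le hrs (x := x) (by linarith [h0]) h3.le
  simp only [h0, zero_add] at this
  have hr0 : colorEnergy p β h r 0 = 0 := by simp [colorEnergy, hp]
  have hrx : -(x * Real.log x) ≤ colorEnergy p β h r x := by
    have : 0 ≤ (if r = 0 then h else 0) := by split_ifs <;> linarith
    have h5 : 0 ≤ β * x ^ p + (if r = 0 then h else 0) * x := by positivity
    unfold colorEnergy
    linarith
  rw [Real.norm_eq_abs, Real.norm_eq_abs, sub_sub_cancel_left, abs_neg, abs_of_pos h4] at h1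
  have h6 := (abs_le.1 h1).1
  nlinarith

/-- The Lagrange condition. Since m is interior, mass can be moved in both directions between r and
s, so the one-variable function of the transferred mass has an interior maximum at 0. -/
theorem IsUniqueMaximizer.colorEnergyDeriv_eq (hm : IsUniqueMaximizer p β h m)
    (hpos : ∀ r, 0 < m r) (r s : Fin q) :
    colorEnergyDeriv p β h r (m r) = colorEnergyDeriv p β h s (m s) := by
  by_cases hrs : r = s
  · rw [hrs]
  let G : ℝ → ℝ := fun x => colorEnergy p β h r (m r + x) + colorEnergy p β h s (m s - x)
  have hmax : IsLocalMax G 0 := by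
    have h1 : ∀ᶠ x : ℝ in 𝓝 0, 0 < m r + x :=
      (continuous_const.add continuous_id).tendsto 0 |>.eventually_const_lt (by simpa using hpos r)
    have h2 : ∀ᶠ x : ℝ in 𝓝 0, 0 < m s - x :=
      (continuous_const.sub continuous_id).tendsto 0 |>.eventually_const_lt (by simpa using hpos s)
    filter_upwards [h1, h2] with x hx hx'
    simpa [G] using hm.transfer_le hrs hx.le hx'.le
  have hd : HasDerivAt G
      (colorEnergyDeriv p β h r (m r) * 1 + colorEnergyDeriv p β h s (m s) * (-1)) 0 := by
    refine HasDerivAt.add ?_ ?_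
    · refine HasDerivAt.comp (0 : ℝ) (h₂ := colorEnergy p β h r) (h := fun x => m r + x) ?_
        ((hasDerivAt_id _).const_add _)
      simpa using hasDerivAt_colorEnergy r (hpos r)
    · refine HasDerivAt.comp (0 : ℝ) (h₂ := colorEnergy p β h s) (h := fun x => m s - x) ?_
        ((hasDerivAt_id _).const_sub _)
      simpa using hasDerivAt_colorEnergy s (hpos s)
  have := hmax.hasDerivAt_eq_zero hd
  linarith

/-- Second-order Taylor expansion of the negative free energy at its maximizer. -/
theorem IsUniqueMaximizer.taylor (hp : 2 ≤ p) (hm : IsUniqueMaximizer p β h m)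
    (hpos : ∀ r, 0 < m r) :
    ∃ C ε : ℝ, 0 ≤ C ∧ 0 < ε ∧ ∀ t : Fin q → ℝ, ∑ r, t r = 1 → (∀ r, |t r - m r| ≤ ε) →
      |negFreeEnergy p β h t - negFreeEnergy p β h m - quadForm p β m (t - m) / 2|
        ≤ C * ∑ r, |t r - m r| ^ 3 := by
  choose C ε hC hε H using fun r : Fin q =>
    exists_colorEnergy_taylor (p := p) (β := β) (h := h) hp r (hpos r)
  have hne : (Finset.univ : Finset (Fin q)).Nonempty := Finset.univ_nonempty
  refine ⟨∑ r, C r, Finset.univ.inf' hne ε, Finset.sum_nonneg fun r _ => hC r,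
    (Finset.lt_inf'_iff hne).2 fun r _ => hε r, fun t ht hd => ?_⟩
  -- The derivatives share one value and the increments sum to zero, so the linear term drops out.
  have hlin : ∑ r, colorEnergyDeriv p β h r (m r) * (t r - m r) = 0 := by
    simp_rw [fun r => hm.colorEnergyDeriv_eq hpos r 0]
    rw [← Finset.mul_sum, Finset.sum_sub_distrib, ht, hm.1.2, sub_self, mul_zero]
  have heq : negFreeEnergy p β h t - negFreeEnergy p β h m - quadForm p β m (t - m) / 2
      = ∑ r, (colorEnergy p β h r (t r) - colorEnergy p β h r (m r)
        - colorEnergyDeriv p β h r (m r) * (t r - m r)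
        - colorEnergyDeriv₂ p β (m r) / 2 * (t r - m r) ^ 2) := by
    rw [Finset.sum_sub_distrib, Finset.sum_sub_distrib, Finset.sum_sub_distrib, hlin,
      negFreeEnergy_eq_sum, negFreeEnergy_eq_sum, quadForm_eq_sum, Finset.sum_div, sub_zero]
    congr 1
    exact Finset.sum_congr rfl fun r _ => by simp only [Pi.sub_apply]; ring
  rw [heq, Finset.mul_sum]
  refine (Finset.abs_sum_le_sum_abs _ _).trans (Finset.sum_le_sum fun r _ => ?_)
  refine (H r (t r) ((hd r).trans (Finset.inf'_le _ (Finset.mem_univ r)))).trans ?_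
  gcongr
  exact Finset.single_le_sum (fun r _ => hC r) (Finset.mem_univ r)

end

/-! ### Two-sided Stirling bounds -/

open Filter Topology in
-- The bound 1/(12 n (n+1)) on successive differences telescopes as 1/(12 n) - 1/(12 (n+1)). Hence
-- log `stirlingSeq` n - 1/(12 n) increases to its limit log √π and stays below it.
theorem log_stirlingSeq_le {n : ℕ} (hn : n ≠ 0) :
    Real.log (Stirling.stirlingSeq n) ≤ Real.log (√Real.pi) + 1 / (12 * n) := by
  let u : ℕ → ℝ := fun k => Real.log (Stirling.stirlingSeq (k + 1)) - 1 / (12 * ((k : ℝ) + 1))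
  have hmono : Monotone u := monotone_nat_of_le_succ fun k => by
    have := Stirling.log_stirlingSeq_sdiff_le (k + 1)
    have h2 : 1 / (12 * ((k + 1 : ℕ) : ℝ) * (((k + 1 : ℕ) : ℝ) + 1))
        = 1 / (12 * ((k : ℝ) + 1)) - 1 / (12 * (((k + 1 : ℕ) : ℝ) + 1)) := by
      push_cast
      field_simp
      ring
    simp only [u]
    linarith
  have hlim : Tendsto u atTop (𝓝 (Real.log (√Real.pi) - 0)) := by
    refine Tendsto.sub ?_ ?_
    · exact ((Real.continuousAt_log (by positivity)).tendsto.comp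
        (Stirling.tendsto_stirlingSeq_sqrt_pi.comp (tendsto_add_atTop_nat 1)))
    · have := (tendsto_one_div_add_atTop_nhds_zero_nat (𝕜 := ℝ)).const_mul (1 / 12)
      rw [mul_zero] at this
      refine this.congr fun k => ?_
      field_simp
  obtain ⟨k, rfl⟩ := Nat.exists_eq_succ_of_ne_zero hn
  have := hmono.ge_of_tendsto hlim k
  simp only [u] at this
  push_cast
  linarith

theorem log_factorial_le {n : ℕ} (hn : n ≠ 0) :
    Real.log (n.factorial) ≤
      n * Real.log n - n + Real.log (2 * Real.pi * n) / 2 + 1 / (12 * n) := by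
  have h1 := Stirling.log_stirlingSeq_formula n
  have h2 := log_stirlingSeq_le hn
  have hn' : (n : ℝ) ≠ 0 := by exact_mod_cast hn
  rw [Real.log_sqrt Real.pi_pos.le] at h2
  rw [Real.log_div hn' (Real.exp_ne_zero 1), Real.log_exp, Real.log_mul two_ne_zero hn'] at h1
  rw [Real.log_mul (by positivity) hn', Real.log_mul two_ne_zero Real.pi_ne_zero]
  linarith

theorem le_log_factorial {n : ℕ} (hn : n ≠ 0) :
    n * Real.log n - n + Real.log (2 * Real.pi * n) / 2 ≤ Real.log (n.factorial) := by
  have hn' : (n : ℝ) ≠ 0 := by exact_mod_cast hn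
  have := Stirling.le_log_factorial_stirling hn
  rw [Real.log_mul (by positivity) hn']
  linarith

/-- Weaker than Stirling but valid at n = 0 as well, as needed far from m, where some color may be
absent. -/
theorem mul_log_sub_le_log_factorial (n : ℕ) :
    n * Real.log n - n ≤ Real.log (n.factorial) := by
  rcases eq_or_ne n 0 with rfl | hn
  · simp
  refine le_trans ?_ (le_log_factorial hn)
  have h1 : (1 : ℝ) ≤ n := by exact_mod_cast Nat.one_le_iff_ne_zero.2 hn
  have : 0 ≤ Real.log (2 * Real.pi * n) := Real.log_nonneg (by nlinarith [Real.pi_gt_three])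
  linarith

/-! ### Standard coordinates on the hyperplane -/

/-- The matrix, in the last `d` coordinates, of a diagonal quadratic form restricted to the
hyperplane of vectors with coordinate sum zero. -/
def hyperplaneMatrix {d : ℕ} (a : Fin (d + 1) → ℝ) : Matrix (Fin d) (Fin d) ℝ :=
  Matrix.of fun i j => a 0 + if i = j then a i.succ else 0

theorem dotProduct_hyperplaneMatrix {d : ℕ} (a : Fin (d + 1) → ℝ) (u : Fin d → ℝ) :
    u ⬝ᵥ (hyperplaneMatrix a).mulVec u
      = ∑ r, a r * (Fin.cons (-∑ i, u i) u : Fin (d + 1) → ℝ) r ^ 2 := by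
  simp only [dotProduct, Matrix.mulVec, hyperplaneMatrix, Matrix.of_apply, add_mul,
    Finset.sum_add_distrib, ite_mul, zero_mul, Finset.sum_ite_eq, Finset.mem_univ, if_true,
    mul_add, Fin.sum_univ_succ, Fin.cons_zero, Fin.cons_succ, ← Finset.mul_sum, ← Finset.sum_mul]
  have : ∑ i, u i * (a i.succ * u i) = ∑ i, a i.succ * u i ^ 2 :=
    Finset.sum_congr rfl fun i _ => by ring
  rw [this]
  ring

/-- The last d coordinates parametrize the hyperplane, the first being minus their sum, and the form
becomes a positive definite matrix M. With B = √M, the map L is B⁻¹ followed by this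
parametrization, and R forgets the first coordinate and applies B. -/
theorem exists_standard_coordinates {d : ℕ} (a : Fin (d + 1) → ℝ)
    (ha : ∀ t : Fin (d + 1) → ℝ, ∑ r, t r = 0 → t ≠ 0 → 0 < ∑ r, a r * t r ^ 2) :
    ∃ (L : EuclideanSpace ℝ (Fin d) →L[ℝ] EuclideanSpace ℝ (Fin (d + 1)))
      (R : EuclideanSpace ℝ (Fin (d + 1)) →L[ℝ] EuclideanSpace ℝ (Fin d)),
      (∀ z, ∑ r, L z r = 0) ∧ (∀ z, R (L z) = z) ∧ (∀ w, ∑ r, w r = 0 → L (R w) = w) ∧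
        ∀ z, ∑ r, a r * L z r ^ 2 = ‖z‖ ^ 2 := by
  set M := hyperplaneMatrix a with hM
  have hpd : M.PosDef := by
    refine Matrix.PosDef.of_dotProduct_mulVec_pos ?_ fun u hu => ?_
    · ext i j
      by_cases hij : i = j
      · simp [hij]
      · simp [hM, hyperplaneMatrix, Matrix.conjTranspose_apply, hij, Ne.symm hij]
    · rw [star_trivial, dotProduct_hyperplaneMatrix]
      refine ha _ (by simp [Fin.sum_univ_succ]) fun h0 => hu ?_
      ext i
      simpa using congrFun h0 i.succ
  set B := CFC.sqrt M with hB
  have hBB : B * B = M := CFC.sqrt_mul_sqrt_self M hpd.posSemidef.nonneg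
  have hBt : B.transpose = B := by
    have := (Matrix.nonneg_iff_posSemidef.1 (CFC.sqrt_nonneg M)).isHermitian
    simpa [Matrix.IsHermitian, Matrix.conjTranspose_eq_transpose_of_trivial] using this
  have hdet : IsUnit B.det := by
    have h1 : IsUnit (B * B).det := by rw [hBB]; exact hpd.det_pos.ne'.isUnit
    rw [Matrix.det_mul] at h1
    exact isUnit_of_mul_isUnit_left h1
  let L₀ : EuclideanSpace ℝ (Fin d) →ₗ[ℝ] EuclideanSpace ℝ (Fin (d + 1)) :=
    { toFun := fun z => WithLp.toLp 2
        (Fin.cons (-∑ i, (B⁻¹.mulVec z.ofLp) i) (B⁻¹.mulVec z.ofLp) : Fin (d + 1) → ℝ)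
      map_add' := fun x y => by
        ext r
        refine Fin.cases ?_ (fun i => ?_) r
        · simp [Matrix.mulVec_add, Finset.sum_add_distrib]; ring
        · simp [Matrix.mulVec_add]
      map_smul' := fun c y => by
        ext r
        refine Fin.cases ?_ (fun i => ?_) r
        · simp [Matrix.mulVec_smul, Finset.mul_sum]
        · simp [Matrix.mulVec_smul] }
  let R₀ : EuclideanSpace ℝ (Fin (d + 1)) →ₗ[ℝ] EuclideanSpace ℝ (Fin d) :=
    { toFun := fun w => WithLp.toLp 2 (B.mulVec fun i => w i.succ)
      map_add' := fun x y => by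
        ext r
        have : (fun i : Fin d => (x + y) i.succ) = (fun i => x i.succ) + fun i => y i.succ := rfl
        rw [this, Matrix.mulVec_add]; simp
      map_smul' := fun c y => by
        ext r
        have : (fun i : Fin d => (c • y) i.succ) = c • fun i => y i.succ := rfl
        rw [this, Matrix.mulVec_smul]; simp }
  refine ⟨L₀.toContinuousLinearMap, R₀.toContinuousLinearMap, fun z => ?_, fun z => ?_,
    fun w hw => ?_, fun z => ?_⟩
  · simp [L₀, Fin.sum_univ_succ]
  · ext i
    simp [L₀, R₀, Matrix.mulVec_mulVec, Matrix.mul_nonsing_inv _ hdet]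
  · ext r
    refine Fin.cases ?_ (fun i => ?_) r
    · rw [Fin.sum_univ_succ] at hw
      simp [L₀, R₀, Matrix.mulVec_mulVec, Matrix.nonsing_inv_mul _ hdet]
      linarith
    · simp [L₀, R₀, Matrix.mulVec_mulVec, Matrix.nonsing_inv_mul _ hdet]
  · have h1 : ∑ r, a r * L₀ z r ^ 2 = (B⁻¹.mulVec z.ofLp) ⬝ᵥ M.mulVec (B⁻¹.mulVec z.ofLp) := by
      rw [hM, dotProduct_hyperplaneMatrix]
      rfl
    refine h1.trans ?_
    rw [← hBB, ← Matrix.mulVec_mulVec, Matrix.mulVec_mulVec _ B B⁻¹, Matrix.mul_nonsing_inv _ hdet,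
      Matrix.one_mulVec, Matrix.dotProduct_mulVec, ← Matrix.mulVec_transpose, hBt,
      Matrix.mulVec_mulVec, Matrix.mul_nonsing_inv _ hdet, Matrix.one_mulVec,
      EuclideanSpace.real_norm_sq_eq]
    simp [dotProduct, sq]

/-- `L` identifies Euclidean space with the hyperplane of vectors with coordinate sum zero, with
inverse `R`, and turns the Hessian form of `-H` at `m` into the squared norm. -/
structure IsStandardChart (p : ℕ) {d : ℕ} (β : ℝ) (m : Fin (d + 1) → ℝ)
    (L : EuclideanSpace ℝ (Fin d) →L[ℝ] EuclideanSpace ℝ (Fin (d + 1)))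
    (R : EuclideanSpace ℝ (Fin (d + 1)) →L[ℝ] EuclideanSpace ℝ (Fin d)) : Prop where
  sum_eq_zero : ∀ z, ∑ r, L z r = 0
  left_inv : ∀ z, R (L z) = z
  right_inv : ∀ w, ∑ r, w r = 0 → L (R w) = w
  quadForm_eq : ∀ z, quadForm p β m (L z) = -‖z‖ ^ 2

theorem exists_isStandardChart {p d : ℕ} {β : ℝ} {m : Fin (d + 1) → ℝ}
    (hneg : ∀ t : Fin (d + 1) → ℝ, ∑ r, t r = 0 → t ≠ 0 → quadForm p β m t < 0) :
    ∃ L R, IsStandardChart p β m L R := by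
  obtain ⟨L, R, h1, h2, h3, h4⟩ := exists_standard_coordinates
    (fun r => -colorEnergyDeriv₂ p β (m r)) fun t ht ht0 => by
      have := hneg t ht ht0
      rw [quadForm_eq_sum] at this
      simpa using this
  refine ⟨L, R, h1, h2, h3, fun z => ?_⟩
  rw [quadForm_eq_sum, ← h4 z]
  simp

theorem quadForm_smul {p q : ℕ} {β : ℝ} (m t : Fin q → ℝ) (c : ℝ) :
    quadForm p β m (c • t) = c ^ 2 * quadForm p β m t := by
  simp only [quadForm, Finset.mul_sum, Pi.smul_apply, smul_eq_mul]
  exact Finset.sum_congr rfl fun r _ => by ring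

theorem abs_apply_le_norm {ι : Type*} [Fintype ι] (y : EuclideanSpace ℝ ι) (r : ι) :
    |y r| ≤ ‖y‖ := by
  simpa using PiLp.norm_apply_le y r

section

variable {p d : ℕ} {β h : ℝ} {m : Fin (d + 1) → ℝ}
  {L : EuclideanSpace ℝ (Fin d) →L[ℝ] EuclideanSpace ℝ (Fin (d + 1))}
  {R : EuclideanSpace ℝ (Fin (d + 1)) →L[ℝ] EuclideanSpace ℝ (Fin d)}

theorem IsStandardChart.norm_le (hLR : IsStandardChart p β m L R)
    (w : EuclideanSpace ℝ (Fin (d + 1))) (hw : ∑ r, w r = 0) : ‖w‖ ≤ ‖L‖ * ‖R w‖ := by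
  conv_lhs => rw [← hLR.right_inv w hw]
  exact L.le_opNorm _

theorem IsStandardChart.exists_quadForm_le (hLR : IsStandardChart p β m L R) :
    ∃ c : ℝ, 0 < c ∧ ∀ t : Fin (d + 1) → ℝ, ∑ r, t r = 0 →
      quadForm p β m t ≤ -(c * ∑ r, t r ^ 2) := by
  -- On the hyperplane the form is -‖R t‖² and ‖t‖ ≤ ‖L‖ ‖R t‖. The extra 1 avoids a division by
  -- zero when d = 0.
  refine ⟨1 / (‖L‖ + 1) ^ 2, by positivity, fun t ht => ?_⟩
  have h1 := hLR.norm_le (WithLp.toLp 2 t) ht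
  have h2 := hLR.quadForm_eq (R (WithLp.toLp 2 t))
  rw [hLR.right_inv (WithLp.toLp 2 t) ht] at h2
  have h3 := EuclideanSpace.real_norm_sq_eq (WithLp.toLp 2 t)
  simp only at h2 h3
  rw [h2, ← h3, neg_le_neg_iff, one_div, inv_mul_le_iff₀ (by positivity), ← mul_pow]
  refine pow_le_pow_left₀ (norm_nonneg _) (h1.trans ?_) 2
  gcongr
  linarith

/-- Global quadratic decay of the negative free energy away from its unique maximizer. -/
theorem IsUniqueMaximizer.exists_le_sub (hp : 2 ≤ p) (hm : IsUniqueMaximizer p β h m)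
    (hpos : ∀ r, 0 < m r) (hLR : IsStandardChart p β m L R) :
    ∃ c : ℝ, 0 < c ∧ ∀ t ∈ stdSimplex ℝ (Fin (d + 1)),
      negFreeEnergy p β h t ≤ negFreeEnergy p β h m - c * ∑ r, (t r - m r) ^ 2 := by
  obtain ⟨c₀, hc₀, hq⟩ := hLR.exists_quadForm_le
  obtain ⟨C, ε, hC, hε, hT⟩ := hm.taylor hp hpos
  -- On this scale the cubic remainder is at most (c₀/4) ∑ (t - m)², half of the quadratic gain
  -- (c₀/2) ∑ (t - m)².
  set ε' := min ε (c₀ / (4 * (C + 1))) with hε'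
  have hε'0 : 0 < ε' := lt_min hε (by positivity)
  have hCε : C * ε' ≤ c₀ / 4 := by
    have h1 : ε' ≤ c₀ / (4 * (C + 1)) := min_le_right _ _
    rw [le_div_iff₀ (by positivity)] at h1
    nlinarith
  have hnear : ∀ t ∈ stdSimplex ℝ (Fin (d + 1)), (∀ r, |t r - m r| ≤ ε') →
      negFreeEnergy p β h t ≤ negFreeEnergy p β h m - c₀ / 4 * ∑ r, (t r - m r) ^ 2 := by
    intro t ht hd
    have h1 := (abs_le.1 (hT t ht.2 fun r => (hd r).trans (min_le_left _ _))).2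
    have h2 := hq (t - m) (by simp [ht.2, hm.1.2])
    simp only [Pi.sub_apply] at h2
    have h3 : C * ∑ r, |t r - m r| ^ 3 ≤ c₀ / 4 * ∑ r, (t r - m r) ^ 2 := by
      rw [Finset.mul_sum, Finset.mul_sum]
      refine Finset.sum_le_sum fun r _ => ?_
      rw [← sq_abs (t r - m r)]
      have h4 := hd r
      have h5 : 0 ≤ |t r - m r| ^ 2 := by positivity
      calc C * |t r - m r| ^ 3 = (C * |t r - m r|) * |t r - m r| ^ 2 := by ring
        _ ≤ (C * ε') * |t r - m r| ^ 2 := by gcongr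
        _ ≤ c₀ / 4 * |t r - m r| ^ 2 := by gcongr
    linarith
  -- Away from m, compactness and uniqueness give a fixed gap η. On the simplex ∑ (t - m)² ≤ d + 1,
  -- so this gap also dominates a small multiple of the quadratic term.
  set K := stdSimplex ℝ (Fin (d + 1)) ∩ {t | ε' ≤ dist t m} with hK
  have hKc : IsCompact K := (isCompact_stdSimplex ℝ (Fin (d + 1))).inter_right
    (isClosed_le continuous_const (by fun_prop))
  obtain ⟨η, hη, hfar⟩ : ∃ η : ℝ, 0 < η ∧ ∀ t ∈ K,
      negFreeEnergy p β h t ≤ negFreeEnergy p β h m - η := by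
    rcases K.eq_empty_or_nonempty with he | hne
    · exact ⟨1, one_pos, by simp [he]⟩
    obtain ⟨t₀, ht₀, hmax⟩ := hKc.exists_isMaxOn hne continuous_negFreeEnergy.continuousOn
    refine ⟨negFreeEnergy p β h m - negFreeEnergy p β h t₀, sub_pos.2 (hm.2 t₀ ht₀.1 ?_),
      fun t ht => by have := hmax ht; simpa using this⟩
    rintro rfl
    have := ht₀.2
    simp only [Set.mem_ofPred_eq, dist_self] at this
    linarith
  refine ⟨min (c₀ / 4) (η / (d + 1)), by positivity, fun t ht => ?_⟩
  have hS : 0 ≤ ∑ r, (t r - m r) ^ 2 := Finset.sum_nonneg fun r _ => sq_nonneg _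
  by_cases hd : ∀ r, |t r - m r| ≤ ε'
  · refine (hnear t ht hd).trans ?_
    gcongr
    exact min_le_left _ _
  · have htK : t ∈ K := by
      refine ⟨ht, ?_⟩
      push Not at hd
      obtain ⟨r, hr⟩ := hd
      exact hr.le.trans (by simpa [Real.dist_eq] using dist_le_pi_dist t m r)
    refine (hfar t htK).trans ?_
    have hS1 : ∑ r, (t r - m r) ^ 2 ≤ d + 1 := by
      have : ∀ r, (t r - m r) ^ 2 ≤ 1 := fun r => by
        have h1 := (mem_Icc_of_mem_stdSimplex ht r)
        have h2 := (mem_Icc_of_mem_stdSimplex hm.1 r)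
        rw [sq_le_one_iff_abs_le_one, abs_le]
        constructor <;> linarith [h1.1, h1.2, h2.1, h2.2]
      simpa using Finset.sum_le_sum fun r (_ : r ∈ Finset.univ) => this r
    have : min (c₀ / 4) (η / (d + 1)) * ∑ r, (t r - m r) ^ 2 ≤ η / (d + 1) * (d + 1) := by
      gcongr
      exact min_le_right _ _
    rw [div_mul_cancel₀ _ (by positivity)] at this
    linarith

end

/-! ### Weights of the count vectors -/

/-- The rescaled deviation `√N (k / N - m)` of a vector of color counts. -/
noncomputable def deviation {q : ℕ} (m : Fin q → ℝ) (N : ℕ) (k : Fin q → ℕ) :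
    EuclideanSpace ℝ (Fin q) :=
  WithLp.toLp 2 fun r => √(N : ℝ) * ((k r : ℝ) / N - m r)

/-- The total weight of the configurations with a given vector of color counts. -/
noncomputable def countWeight (p q : ℕ) [NeZero q] (β h : ℝ) (N : ℕ) (k : Fin q → ℕ) : ℝ :=
  Nat.multinomial Finset.univ k *
    Real.exp (β * N * ∑ r, ((k r : ℝ) / N) ^ p + N * h * ((k 0 : ℝ) / N))

/-- The order of magnitude of the largest `countWeight`. -/
noncomputable def weightScale (p : ℕ) {q : ℕ} [NeZero q] (β h : ℝ) (m : Fin q → ℝ) (N : ℕ) : ℝ :=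
  Real.exp (Real.log N.factorial - N * Real.log N + N - q / 2 * Real.log (2 * Real.pi * N)
    - (∑ r, Real.log (m r)) / 2 + N * negFreeEnergy p β h m)

section

variable {q : ℕ} {m : Fin q → ℝ} {N : ℕ} {k : Fin q → ℕ}

theorem log_multinomial (hk : ∑ r, k r = N) :
    Real.log (Nat.multinomial Finset.univ k)
      = Real.log N.factorial - ∑ r, Real.log (k r).factorial := by
  have h1 := Nat.multinomial_spec Finset.univ k
  rw [hk] at h1
  have h2 : (∏ r, ((k r).factorial : ℝ)) * Nat.multinomial Finset.univ k = N.factorial := by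
    exact_mod_cast h1
  have h3 : (Nat.multinomial Finset.univ k : ℝ) ≠ 0 := by
    exact_mod_cast (Nat.multinomial_pos _ _).ne'
  have h4 : ∀ r ∈ Finset.univ, ((k r).factorial : ℝ) ≠ 0 := fun r _ => by
    exact_mod_cast (k r).factorial_ne_zero
  rw [← h2, Real.log_mul (Finset.prod_ne_zero_iff.2 h4) h3, Real.log_prod h4]
  ring

theorem count_mem_stdSimplex (hN : N ≠ 0) (hk : ∑ r, k r = N) :
    (fun r => (k r : ℝ) / N) ∈ stdSimplex ℝ (Fin q) := by
  refine ⟨fun r => by positivity, ?_⟩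
  rw [← Finset.sum_div, div_eq_one_iff_eq (by exact_mod_cast hN)]
  exact_mod_cast hk

theorem norm_deviation_sq :
    ‖deviation m N k‖ ^ 2 = N * ∑ r, ((k r : ℝ) / N - m r) ^ 2 := by
  rw [EuclideanSpace.real_norm_sq_eq, Finset.mul_sum]
  refine Finset.sum_congr rfl fun r _ => ?_
  simp [deviation, mul_pow]

theorem sum_deviation (hN : N ≠ 0) (hk : ∑ r, k r = N) (hm : ∑ r, m r = 1) :
    ∑ r, deviation m N k r = 0 := by
  simp only [deviation]
  rw [← Finset.mul_sum, Finset.sum_sub_distrib, (count_mem_stdSimplex hN hk).2, hm]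
  simp

theorem abs_sub_eq_abs_deviation_div (hN : N ≠ 0) (r : Fin q) :
    |(k r : ℝ) / N - m r| = |deviation m N k r| / √(N : ℝ) := by
  have : 0 < √(N : ℝ) := by positivity
  simp [deviation, abs_mul, abs_of_pos this]
  field_simp

end

section

variable {p q : ℕ} [NeZero q] {β h : ℝ} {m : Fin q → ℝ} {N : ℕ} {k : Fin q → ℕ}

theorem countWeight_pos : 0 < countWeight p q β h N k :=
  mul_pos (by exact_mod_cast Nat.multinomial_pos _ _) (Real.exp_pos _)

theorem weightScale_pos : 0 < weightScale p β h m N := Real.exp_pos _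

/-- Exact identity behind both Stirling estimates: replacing each log k! by k log k - k yields the
entropy. What is left is the Stirling defect, close to -½ ∑ log(2π k_r), which the last two terms
cancel when k/N is close to m. -/
theorem log_countWeight_div (hN : N ≠ 0) (hk : ∑ r, k r = N) :
    Real.log (countWeight p q β h N k / weightScale p β h m N)
      = N * (negFreeEnergy p β h (fun r => (k r : ℝ) / N) - negFreeEnergy p β h m)
        + ∑ r, (k r * Real.log (k r) - k r - Real.log (k r).factorial)
        + q / 2 * Real.log (2 * Real.pi * N) + (∑ r, Real.log (m r)) / 2 := by
  have hN' : (N : ℝ) ≠ 0 := by exact_mod_cast hN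
  have hkN : ∑ r, (k r : ℝ) = N := by exact_mod_cast hk
  have h1 : (Nat.multinomial Finset.univ k : ℝ) ≠ 0 := by
    exact_mod_cast (Nat.multinomial_pos _ _).ne'
  rw [Real.log_div countWeight_pos.ne' weightScale_pos.ne', countWeight, weightScale,
    Real.log_mul h1 (Real.exp_ne_zero _), Real.log_exp, Real.log_exp, log_multinomial hk]
  have h2 : N * ∑ r, (k r : ℝ) / N * Real.log ((k r : ℝ) / N)
      = ∑ r, k r * Real.log (k r) - N * Real.log N := by
    have h4 : (N : ℝ) * Real.log N = ∑ r, (k r : ℝ) * Real.log N := by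
      rw [← Finset.sum_mul, hkN]
    rw [h4, Finset.mul_sum, ← Finset.sum_sub_distrib]
    refine Finset.sum_congr rfl fun r _ => ?_
    rcases eq_or_ne (k r) 0 with h0 | h0
    · simp [h0]
    · rw [Real.log_div (by exact_mod_cast h0) hN']
      field_simp
  rw [Finset.sum_sub_distrib, Finset.sum_sub_distrib, hkN]
  have h3 : N * negFreeEnergy p β h (fun r => (k r : ℝ) / N)
      = β * N * ∑ r, ((k r : ℝ) / N) ^ p + N * h * ((k 0 : ℝ) / N)
        - N * ∑ r, (k r : ℝ) / N * Real.log ((k r : ℝ) / N) := by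
    simp only [negFreeEnergy]
    ring
  rw [mul_sub, h3, h2]
  ring

end

section

variable {p d : ℕ} {β h : ℝ} {m : Fin (d + 1) → ℝ}
  {L : EuclideanSpace ℝ (Fin d) →L[ℝ] EuclideanSpace ℝ (Fin (d + 1))}
  {R : EuclideanSpace ℝ (Fin (d + 1)) →L[ℝ] EuclideanSpace ℝ (Fin d)}

/-- A crude bound for every k: the Stirling defect and ∑ log m are discarded as nonpositive. The
price is a power of N, affordable only where ‖y‖ is of order √N. -/
theorem exists_countWeight_le (hp : 2 ≤ p) (hm : IsUniqueMaximizer p β h m)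
    (hpos : ∀ r, 0 < m r) (hLR : IsStandardChart p β m L R) :
    ∃ c : ℝ, 0 < c ∧ ∀ (N : ℕ) (k : Fin (d + 1) → ℕ), N ≠ 0 → ∑ r, k r = N →
      Real.log (countWeight p (d + 1) β h N k / weightScale p β h m N)
        ≤ (d + 1 : ℕ) / 2 * Real.log (2 * Real.pi * N) - c * ‖deviation m N k‖ ^ 2 := by
  obtain ⟨c, hc, hH⟩ := hm.exists_le_sub hp hpos hLR
  refine ⟨c, hc, fun N k hN hk => ?_⟩
  rw [log_countWeight_div hN hk, norm_deviation_sq]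
  have h1 := hH _ (count_mem_stdSimplex hN hk)
  have h2 : ∑ r, (k r * Real.log (k r) - k r - Real.log (k r).factorial) ≤ 0 :=
    Finset.sum_nonpos fun r _ => by linarith [mul_log_sub_le_log_factorial (k r)]
  have h3 : ∑ r, Real.log (m r) ≤ 0 :=
    Finset.sum_nonpos fun r _ => Real.log_nonpos (hpos r).le (mem_Icc_of_mem_stdSimplex hm.1 r).2
  have h4 : (N : ℝ) * (negFreeEnergy p β h (fun r => (k r : ℝ) / N) - negFreeEnergy p β h m)
      ≤ N * -(c * ∑ r, ((k r : ℝ) / N - m r) ^ 2) := by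
    gcongr
    linarith
  linarith

theorem abs_log_sub_log_le {a x : ℝ} (ha : 0 < a) (hx : a / 2 ≤ x) :
    |Real.log x - Real.log a| ≤ 2 / a * |x - a| := by
  have hx0 : 0 < x := by linarith
  rw [abs_le]
  have hlow : ∀ u v : ℝ, 0 < u → a / 2 ≤ v → Real.log u - Real.log v ≤ 2 / a * |u - v| := by
    intro u v hu hv
    have hv0 : 0 < v := by linarith
    have h1 := Real.log_le_sub_one_of_pos (div_pos hu hv0)
    rw [Real.log_div hu.ne' hv0.ne'] at h1
    have h2 : u / v - 1 = 1 / v * (u - v) := by field_simp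
    have h3 : 1 / v ≤ 2 / a := by
      rw [div_le_div_iff₀ hv0 ha]
      linarith
    calc _ ≤ 1 / v * (u - v) := by rw [← h2]; exact h1
      _ ≤ 1 / v * |u - v| := by gcongr; exact le_abs_self _
      _ ≤ 2 / a * |u - v| := by gcongr
  have h1 := hlow x a hx0 (by linarith)
  have h2 := hlow a x ha hx
  rw [abs_sub_comm] at h2
  constructor <;> linarith

/-- As long as k_r ≥ N m_r / 2, the two-sided Stirling bound costs 1/(12 k_r) = O(1/N). Replacing
log(k_r/N) by log m_r costs O(|k_r/N - m_r|), which is O(‖y‖/√N). -/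
theorem exists_abs_log_countWeight_sub_le (hpos : ∀ r, 0 < m r) :
    ∃ C ε : ℝ, 0 ≤ C ∧ 0 < ε ∧ ∀ (N : ℕ) (k : Fin (d + 1) → ℕ), N ≠ 0 → ∑ r, k r = N →
      (∀ r, |(k r : ℝ) / N - m r| ≤ ε) →
      |Real.log (countWeight p (d + 1) β h N k / weightScale p β h m N)
        - N * (negFreeEnergy p β h (fun r => (k r : ℝ) / N) - negFreeEnergy p β h m)|
        ≤ C * (1 + ‖deviation m N k‖) / √(N : ℝ) := by
  refine ⟨∑ r, 2 / m r, Finset.univ.inf' Finset.univ_nonempty (fun r => m r / 2),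
    Finset.sum_nonneg fun r _ => (div_pos two_pos (hpos r)).le,
    (Finset.lt_inf'_iff _).2 fun r _ => half_pos (hpos r), fun N k hN hk hd => ?_⟩
  have hN0 : (0 : ℝ) < N := by positivity
  have hs : 0 < √(N : ℝ) := by positivity
  have hss : √(N : ℝ) * √(N : ℝ) = N := Real.mul_self_sqrt hN0.le
  have hs1 : 1 ≤ √(N : ℝ) := by
    rw [Real.one_le_sqrt]; exact_mod_cast Nat.one_le_iff_ne_zero.2 hN
  have heq : Real.log (countWeight p (d + 1) β h N k / weightScale p β h m N)
        - N * (negFreeEnergy p β h (fun r => (k r : ℝ) / N) - negFreeEnergy p β h m)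
      = ∑ r, (k r * Real.log (k r) - k r - Real.log (k r).factorial
        + Real.log (2 * Real.pi * N) / 2 + Real.log (m r) / 2) := by
    rw [log_countWeight_div hN hk, Finset.sum_add_distrib, Finset.sum_add_distrib,
      Finset.sum_div]
    simp
    ring
  rw [heq, mul_div_assoc, Finset.sum_mul]
  refine (Finset.abs_sum_le_sum_abs _ _).trans (Finset.sum_le_sum fun r _ => ?_)
  have hdr : |(k r : ℝ) / N - m r| ≤ m r / 2 :=
    (hd r).trans (Finset.inf'_le (fun r => m r / 2) (Finset.mem_univ r))
  have hmr := hpos r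
  have hlow : m r / 2 ≤ (k r : ℝ) / N := by linarith [(abs_le.1 hdr).1]
  have hkr : (0 : ℝ) < k r := by
    have : 0 < (k r : ℝ) / N := by linarith
    by_contra! hcon
    exact absurd this (not_lt.2 (div_nonpos_of_nonpos_of_nonneg hcon hN0.le))
  have hkr0 : k r ≠ 0 := by exact_mod_cast hkr.ne'
  have b1 := log_factorial_le hkr0
  have b2 := le_log_factorial hkr0
  have b3 := abs_log_sub_log_le hmr hlow
  have e1 : Real.log (2 * Real.pi * k r)
      = Real.log (2 * Real.pi * N) + Real.log ((k r : ℝ) / N) := by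
    rw [← Real.log_mul (by positivity) (by positivity)]
    congr 1
    field_simp
  rw [e1] at b1 b2
  have b4 : 1 / (12 * (k r : ℝ)) ≤ 1 / m r / √(N : ℝ) := by
    rw [div_div, div_le_div_iff₀ (by positivity) (by positivity)]
    have h1 : m r / 2 * N ≤ k r := by rwa [le_div_iff₀ hN0] at hlow
    have h2 : m r * √(N : ℝ) ≤ m r * N := by
      gcongr
      nlinarith
    nlinarith
  have b5 : |(k r : ℝ) / N - m r| ≤ ‖deviation m N k‖ / √(N : ℝ) := by
    rw [abs_sub_eq_abs_deviation_div hN]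
    gcongr
    exact abs_apply_le_norm _ _
  have b6 : |Real.log ((k r : ℝ) / N) - Real.log (m r)| ≤
      2 / m r * (‖deviation m N k‖ / √(N : ℝ)) := b3.trans (by gcongr)
  have e2 : 2 / m r * ((1 + ‖deviation m N k‖) / √(N : ℝ))
      = 2 * (1 / m r / √(N : ℝ)) + 2 / m r * (‖deviation m N k‖ / √(N : ℝ)) := by ring
  have b7 : 0 ≤ 1 / m r / √(N : ℝ) := by positivity
  rw [e2, abs_le]
  constructor <;> linarith [(abs_le.1 b6).1, (abs_le.1 b6).2, abs_nonneg
    (Real.log ((k r : ℝ) / N) - Real.log (m r))]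

/-- Under y = √N (k/N - m) the quadratic Taylor term times N is exactly -‖R y‖²/2, and the cubic
remainder becomes ‖y‖³/√N. The Stirling error is of smaller degree in y. -/
theorem exists_abs_log_countWeight_add_le (hp : 2 ≤ p) (hm : IsUniqueMaximizer p β h m)
    (hpos : ∀ r, 0 < m r) (hLR : IsStandardChart p β m L R) :
    ∃ C ε : ℝ, 0 ≤ C ∧ 0 < ε ∧ ∀ (N : ℕ) (k : Fin (d + 1) → ℕ), N ≠ 0 → ∑ r, k r = N →
      (∀ r, |(k r : ℝ) / N - m r| ≤ ε) →
      |Real.log (countWeight p (d + 1) β h N k / weightScale p β h m N)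
        + ‖R (deviation m N k)‖ ^ 2 / 2| ≤ C * (1 + ‖deviation m N k‖) ^ 3 / √(N : ℝ) := by
  obtain ⟨C₁, ε₁, hC₁, hε₁, H₁⟩ := exists_abs_log_countWeight_sub_le (p := p) (β := β) (h := h)
    hpos
  obtain ⟨C₂, ε₂, hC₂, hε₂, H₂⟩ := hm.taylor hp hpos
  refine ⟨C₁ + C₂ * (d + 1 : ℕ), min ε₁ ε₂, by positivity, lt_min hε₁ hε₂, fun N k hN hk hd => ?_⟩
  have hN0 : (0 : ℝ) < N := by positivity
  have hs : 0 < √(N : ℝ) := by positivity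
  have hss : √(N : ℝ) ^ 2 = N := Real.sq_sqrt hN0.le
  have b1 := H₁ N k hN hk fun r => (hd r).trans (min_le_left _ _)
  have b2 := H₂ _ (count_mem_stdSimplex hN hk).2 fun r => (hd r).trans (min_le_right _ _)
  set y := deviation m N k with hy
  have hq : N * quadForm p β m ((fun r => (k r : ℝ) / N) - m) = -‖R y‖ ^ 2 := by
    have h1 := quadForm_smul (p := p) (β := β) m ((fun r => (k r : ℝ) / N) - m) √(N : ℝ)
    rw [hss] at h1
    rw [← hLR.quadForm_eq, hLR.right_inv y (sum_deviation hN hk hm.1.2), ← h1]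
    rfl
  have b3 : N * ∑ r, |(k r : ℝ) / N - m r| ^ 3 ≤ (d + 1 : ℕ) * (‖y‖ ^ 3 / √(N : ℝ)) := by
    have : ∀ r ∈ Finset.univ, N * |(k r : ℝ) / N - m r| ^ 3 ≤ ‖y‖ ^ 3 / √(N : ℝ) := fun r _ => by
      have : √(N : ℝ) ^ 2 * (|y r| ^ 3 / √(N : ℝ) ^ 3) = |y r| ^ 3 / √(N : ℝ) := by field_simp
      rw [hss] at this
      rw [abs_sub_eq_abs_deviation_div hN, div_pow, ← hy, this]
      gcongr
      exact abs_apply_le_norm _ _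
    rw [Finset.mul_sum]
    simpa using Finset.sum_le_sum this
  have b4 : |N * (negFreeEnergy p β h (fun r => (k r : ℝ) / N) - negFreeEnergy p β h m)
      + ‖R y‖ ^ 2 / 2| ≤ C₂ * (d + 1 : ℕ) * (‖y‖ ^ 3 / √(N : ℝ)) := by
    have e1 : N * (negFreeEnergy p β h (fun r => (k r : ℝ) / N) - negFreeEnergy p β h m)
      + ‖R y‖ ^ 2 / 2 = N * (negFreeEnergy p β h (fun r => (k r : ℝ) / N) - negFreeEnergy p β h m
      - quadForm p β m ((fun r => (k r : ℝ) / N) - m) / 2) := by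
      linear_combination (1 / 2) * hq
    rw [e1, abs_mul, abs_of_pos hN0, mul_assoc]
    calc _ ≤ N * (C₂ * ∑ r, |(k r : ℝ) / N - m r| ^ 3) := by gcongr
      _ = C₂ * (N * ∑ r, |(k r : ℝ) / N - m r| ^ 3) := by ring
      _ ≤ _ := by gcongr
  have hy0 : 0 ≤ ‖y‖ := norm_nonneg _
  have c1 : C₁ * (1 + ‖y‖) / √(N : ℝ) ≤ C₁ * (1 + ‖y‖) ^ 3 / √(N : ℝ) := by
    gcongr
    exact le_self_pow₀ (by linarith) (by norm_num)
  have c2 : C₂ * (d + 1 : ℕ) * (‖y‖ ^ 3 / √(N : ℝ))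
      ≤ C₂ * (d + 1 : ℕ) * ((1 + ‖y‖) ^ 3 / √(N : ℝ)) := by
    gcongr
    linarith
  have e2 : (C₁ + C₂ * (d + 1 : ℕ)) * (1 + ‖y‖) ^ 3 / √(N : ℝ)
      = C₁ * (1 + ‖y‖) ^ 3 / √(N : ℝ) + C₂ * (d + 1 : ℕ) * ((1 + ‖y‖) ^ 3 / √(N : ℝ)) := by ring
  rw [e2]
  have := abs_add_le (Real.log (countWeight p (d + 1) β h N k / weightScale p β h m N)
        - N * (negFreeEnergy p β h (fun r => (k r : ℝ) / N) - negFreeEnergy p β h m))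
    (N * (negFreeEnergy p β h (fun r => (k r : ℝ) / N) - negFreeEnergy p β h m) + ‖R y‖ ^ 2 / 2)
  rw [← add_assoc, sub_add_cancel] at this
  linarith

/-- Near the maximizer the normalized weights decay like a Gaussian. -/
theorem exists_log_countWeight_le_of_near (hp : 2 ≤ p) (hm : IsUniqueMaximizer p β h m)
    (hpos : ∀ r, 0 < m r) (hLR : IsStandardChart p β m L R) :
    ∃ C c ε : ℝ, 0 < c ∧ 0 < ε ∧ ∀ (N : ℕ) (k : Fin (d + 1) → ℕ), N ≠ 0 →
      ∑ r, k r = N → (∀ r, |(k r : ℝ) / N - m r| ≤ ε) →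
      Real.log (countWeight p (d + 1) β h N k / weightScale p β h m N)
        ≤ C - c * ‖deviation m N k‖ ^ 2 := by
  obtain ⟨C, ε, hC, hε, H⟩ := exists_abs_log_countWeight_sub_le (p := p) (β := β) (h := h)
    hpos
  obtain ⟨c, hc, hH⟩ := hm.exists_le_sub hp hpos hLR
  refine ⟨C + C ^ 2 / c, c / 2, ε, by positivity, hε, fun N k hN hk hd => ?_⟩
  have hN0 : (0 : ℝ) < N := by positivity
  have hs1 : 1 ≤ √(N : ℝ) := by
    rw [Real.one_le_sqrt]; exact_mod_cast Nat.one_le_iff_ne_zero.2 hN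
  have b1 := (abs_le.1 (H N k hN hk hd)).2
  have b2 : C * (1 + ‖deviation m N k‖) / √(N : ℝ) ≤ C * (1 + ‖deviation m N k‖) :=
    div_le_self (by positivity) hs1
  have b3 : (N : ℝ) * (negFreeEnergy p β h (fun r => (k r : ℝ) / N) - negFreeEnergy p β h m)
      ≤ -(c * ‖deviation m N k‖ ^ 2) := by
    have h1 := hH _ (count_mem_stdSimplex hN hk)
    rw [norm_deviation_sq]
    calc _ ≤ (N : ℝ) * -(c * ∑ r, ((k r : ℝ) / N - m r) ^ 2) := by gcongr; linarith
      _ = _ := by ring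
  -- Half of the quadratic decay absorbs the linear Stirling error.
  have b4 : C * ‖deviation m N k‖ ≤ C ^ 2 / c + c / 2 * ‖deviation m N k‖ ^ 2 := by
    rw [← sub_nonneg]
    have : C ^ 2 / c + c / 2 * ‖deviation m N k‖ ^ 2 - C * ‖deviation m N k‖
      = ((C - c * ‖deviation m N k‖ / 2) ^ 2 + (c * ‖deviation m N k‖ / 2) ^ 2) / c := by
      field_simp
      ring
    rw [this]
    positivity
  nlinarith

end

/-! ### Elementary inequalities -/

/-- Polynomial factors are paid for with a fraction of a Gaussian exponent. The bound is u^n / n! ≤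
exp u at u = a (1 + x), together with 1 + x ≤ 2 + x². -/
theorem exists_pow_le_mul_exp (n : ℕ) {a : ℝ} (ha : 0 < a) :
    ∃ C : ℝ, 0 < C ∧ ∀ x : ℝ, 0 ≤ x → (1 + x) ^ n ≤ C * Real.exp (a * x ^ 2) := by
  refine ⟨n.factorial / a ^ n * Real.exp (2 * a), by positivity, fun x hx => ?_⟩
  have h1 := Real.pow_div_factorial_le_exp (a * (1 + x)) (by positivity) n
  rw [div_le_iff₀ (by positivity), mul_pow] at h1
  have h2 : Real.exp (a * (1 + x)) ≤ Real.exp (2 * a) * Real.exp (a * x ^ 2) := by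
    rw [← Real.exp_add, Real.exp_le_exp]
    nlinarith [mul_nonneg ha.le (sq_nonneg (x - 1)), mul_nonneg ha.le (sq_nonneg x)]
  have h3 : (1 + x) ^ n = a ^ n * (1 + x) ^ n / a ^ n := by field_simp
  rw [h3, div_le_iff₀ (by positivity)]
  have h4 : n.factorial / a ^ n * Real.exp (2 * a) * Real.exp (a * x ^ 2) * a ^ n
      = Real.exp (2 * a) * Real.exp (a * x ^ 2) * n.factorial := by
    field_simp
  rw [h4]
  exact h1.trans (by gcongr)

theorem abs_exp_sub_exp_le {a b M : ℝ} (ha : a ≤ M) (hb : b ≤ M) :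
    |Real.exp a - Real.exp b| ≤ |a - b| * Real.exp M := by
  have key : ∀ u v : ℝ, u ≤ M → v ≤ u →
      |Real.exp u - Real.exp v| ≤ |u - v| * Real.exp M := by
    intro u v hu hvu
    rw [abs_of_nonneg (sub_nonneg.2 (Real.exp_le_exp.2 hvu)), abs_of_nonneg (sub_nonneg.2 hvu)]
    have h1 := Real.add_one_le_exp (v - u)
    have h2 : Real.exp v = Real.exp u * Real.exp (v - u) := by rw [← Real.exp_add]; ring_nf
    have h3 : Real.exp u ≤ Real.exp M := Real.exp_le_exp.2 hu
    have h4 := Real.exp_pos u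
    rw [h2]
    nlinarith [mul_nonneg (sub_nonneg.2 hvu) (sub_nonneg.2 h3)]
  rcases le_total a b with h | h
  · rw [abs_sub_comm, abs_sub_comm a b]
    exact key b a hb h
  · exact key a b ha h

section

variable {p d : ℕ} {β h : ℝ} {m : Fin (d + 1) → ℝ}
  {L : EuclideanSpace ℝ (Fin d) →L[ℝ] EuclideanSpace ℝ (Fin (d + 1))}
  {R : EuclideanSpace ℝ (Fin (d + 1)) →L[ℝ] EuclideanSpace ℝ (Fin d)}

/-! ### Lattice cells -/

/-- The cell, in standard coordinates, of the lattice of rescaled deviations of `N` sites. -/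
def cell (L : EuclideanSpace ℝ (Fin d) →L[ℝ] EuclideanSpace ℝ (Fin (d + 1))) (N : ℕ) :
    Set (EuclideanSpace ℝ (Fin d)) :=
  {v | ∀ i : Fin d, √(N : ℝ) * L v i.succ ∈ Set.Ico (0 : ℝ) 1}

theorem measurableSet_cell (N : ℕ) : MeasurableSet (cell L N) := by
  have : cell L N = ⋂ i : Fin d, (fun v => √(N : ℝ) * L v i.succ) ⁻¹' Set.Ico (0 : ℝ) 1 := by
    ext v
    simp [cell]
  rw [this]
  refine MeasurableSet.iInter fun i => measurableSet_Ico.preimage ?_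
  fun_prop

theorem IsStandardChart.norm_le_of_mem_cell (hLR : IsStandardChart p β m L R) {N : ℕ} (hN : N ≠ 0)
    {v : EuclideanSpace ℝ (Fin d)} (hv : v ∈ cell L N) : ‖v‖ ≤ ‖R‖ * (2 * d) / √(N : ℝ) := by
  have hs : 0 < √(N : ℝ) := by positivity
  have h1 : ∀ i : Fin d, |L v i.succ| ≤ 1 / √(N : ℝ) := fun i => by
    have := hv i
    rw [le_div_iff₀ hs, abs_of_nonneg (nonneg_of_mul_nonneg_right this.1 hs), mul_comm]
    exact this.2.le
  have h2 : ∑ i : Fin d, |L v i.succ| ≤ d * (1 / √(N : ℝ)) := by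
    simpa using Finset.sum_le_sum fun i (_ : i ∈ Finset.univ) => h1 i
  -- The cell constrains only the last d coordinates. The zero sum bounds the first one by their
  -- total, which accounts for the factor 2d.
  have h3 : |L v 0| ≤ ∑ i : Fin d, |L v i.succ| := by
    have := hLR.sum_eq_zero v
    rw [Fin.sum_univ_succ] at this
    rw [eq_neg_of_add_eq_zero_left this, abs_neg]
    exact Finset.abs_sum_le_sum_abs _ _
  have h4 : ‖L v‖ ≤ ∑ r, |L v r| := by
    refine abs_le_of_sq_le_sq' ?_ (Finset.sum_nonneg fun r _ => abs_nonneg _) |>.2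
    rw [EuclideanSpace.real_norm_sq_eq]
    simp_rw [← sq_abs (L v _)]
    exact Finset.sum_sq_le_sq_sum_of_nonneg fun r _ => abs_nonneg _
  rw [Fin.sum_univ_succ] at h4
  conv_lhs => rw [← hLR.left_inv v]
  refine (R.le_opNorm _).trans ?_
  rw [mul_div_assoc]
  gcongr
  calc _ ≤ d * (1 / √(N : ℝ)) + d * (1 / √(N : ℝ)) := by linarith
    _ = _ := by ring

theorem IsStandardChart.volume_cell_pos (hLR : IsStandardChart p β m L R) {N : ℕ} (hN : N ≠ 0) :
    0 < volume (cell L N) := by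
  have hs : 0 < √(N : ℝ) := by positivity
  let U : Set (EuclideanSpace ℝ (Fin d)) :=
    ⋂ i : Fin d, (fun v => √(N : ℝ) * L v i.succ) ⁻¹' Set.Ioo (0 : ℝ) 1
  have hU : IsOpen U := isOpen_iInter_of_finite fun i => isOpen_Ioo.preimage (by fun_prop)
  have hne : U.Nonempty := by
    let w : EuclideanSpace ℝ (Fin (d + 1)) := WithLp.toLp 2
      (Fin.cons (-(d * (1 / (2 * √(N : ℝ))))) fun _ => 1 / (2 * √(N : ℝ)) : Fin (d + 1) → ℝ)
    have hw : L (R w) = w := hLR.right_inv w (by simp [w, Fin.sum_univ_succ])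
    refine ⟨R w, Set.mem_iInter.2 fun i => ?_⟩
    have : √(N : ℝ) * (1 / (2 * √(N : ℝ))) = 1 / 2 := by field_simp
    simp only [Set.mem_preimage, hw]
    simp only [w, Fin.cons_succ, this]
    norm_num
  refine (hU.measure_pos volume hne).trans_le (measure_mono fun v hv i => ?_)
  exact Set.Ioo_subset_Ico_self (Set.mem_iInter.1 hv i)

theorem IsStandardChart.volume_cell_lt_top (hLR : IsStandardChart p β m L R) {N : ℕ}
    (hN : N ≠ 0) : volume (cell L N) < ⊤ := by
  refine (measure_mono (t := Metric.closedBall 0 (‖R‖ * (2 * d) / √(N : ℝ))) fun v hv => ?_).trans_lt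
    measure_closedBall_lt_top
  simpa using hLR.norm_le_of_mem_cell hN hv

/-- A deviation in standard coordinates. -/
noncomputable def latticePoint (m : Fin (d + 1) → ℝ)
    (R : EuclideanSpace ℝ (Fin (d + 1)) →L[ℝ] EuclideanSpace ℝ (Fin d)) (N : ℕ)
    (k : Fin (d + 1) → ℕ) : EuclideanSpace ℝ (Fin d) :=
  R (deviation m N k)

theorem IsStandardChart.map_latticePoint (hLR : IsStandardChart p β m L R) (hm : ∑ r, m r = 1)
    {N : ℕ} (hN : N ≠ 0) {k : Fin (d + 1) → ℕ} (hk : ∑ r, k r = N) :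
    L (latticePoint m R N k) = deviation m N k :=
  hLR.right_inv _ (sum_deviation hN hk hm)

/-- In unscaled coordinates the cell at k is the half-open unit box with lower corner (k_1, ...,
k_d), so belonging to it means that k_i is the integer part of a coordinate. Disjointness and
covering both follow from this. -/
theorem IsStandardChart.mem_cell_iff (hLR : IsStandardChart p β m L R) (hm : ∑ r, m r = 1)
    {N : ℕ} (hN : N ≠ 0) {k : Fin (d + 1) → ℕ} (hk : ∑ r, k r = N)
    {z : EuclideanSpace ℝ (Fin d)} :
    z - latticePoint m R N k ∈ cell L N ↔
      ∀ i : Fin d, N * m i.succ + √(N : ℝ) * L z i.succ - k i.succ ∈ Set.Ico (0 : ℝ) 1 := by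
  have hN0 : (0 : ℝ) < N := by positivity
  refine forall_congr' fun i => ?_
  rw [map_sub, hLR.map_latticePoint hm hN hk]
  have : √(N : ℝ) * (L z - deviation m N k) i.succ
      = N * m i.succ + √(N : ℝ) * L z i.succ - k i.succ := by
    have h1 : √(N : ℝ) * (√(N : ℝ) * ((k i.succ : ℝ) / N - m i.succ))
        = k i.succ - N * m i.succ := by
      rw [← mul_assoc, Real.mul_self_sqrt hN0.le]
      field_simp
    simp only [deviation, PiLp.sub_apply, mul_sub √(N : ℝ) (L z _), h1]
    ring
  rw [this]

theorem IsStandardChart.eq_of_mem_cell (hLR : IsStandardChart p β m L R) (hm : ∑ r, m r = 1)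
    {N : ℕ} (hN : N ≠ 0) {k l : Fin (d + 1) → ℕ} (hk : ∑ r, k r = N) (hl : ∑ r, l r = N)
    {z : EuclideanSpace ℝ (Fin d)} (hzk : z - latticePoint m R N k ∈ cell L N)
    (hzl : z - latticePoint m R N l ∈ cell L N) : k = l := by
  rw [hLR.mem_cell_iff hm hN hk] at hzk
  rw [hLR.mem_cell_iff hm hN hl] at hzl
  have hs : ∀ i : Fin d, k i.succ = l i.succ := fun i => by
    have h1 := hzk i
    have h2 := hzl i
    rw [Set.mem_Ico] at h1 h2
    have h3 : (k i.succ : ℝ) < l i.succ + 1 := by linarith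
    have h4 : (l i.succ : ℝ) < k i.succ + 1 := by linarith
    have h5 : k i.succ < l i.succ + 1 := by exact_mod_cast h3
    have h6 : l i.succ < k i.succ + 1 := by exact_mod_cast h4
    omega
  funext r
  refine Fin.cases ?_ hs r
  rw [Fin.sum_univ_succ] at hk hl
  have : ∑ i : Fin d, k i.succ = ∑ i : Fin d, l i.succ := Finset.sum_congr rfl fun i _ => hs i
  omega

/-- Take integer parts for the last d counts and give the remainder to color 0. This is legitimate
when all unscaled coordinates are nonnegative, which holds in a ball of radius ε √N because m is
bounded away from 0. -/
theorem IsStandardChart.exists_mem_cell (hLR : IsStandardChart p β m L R) (hm : ∑ r, m r = 1)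
    (hpos : ∀ r, 0 < m r) :
    ∃ ε : ℝ, 0 < ε ∧ ∀ N : ℕ, N ≠ 0 → ∀ z : EuclideanSpace ℝ (Fin d), ‖z‖ ≤ ε * √(N : ℝ) →
      ∃ k : Fin (d + 1) → ℕ, ∑ r, k r = N ∧ z - latticePoint m R N k ∈ cell L N := by
  set a := Finset.univ.inf' Finset.univ_nonempty m with ha
  have ha0 : 0 < a := (Finset.lt_inf'_iff _).2 fun r _ => hpos r
  refine ⟨a / (‖L‖ + 1), by positivity, fun N hN z hz => ?_⟩
  have hN0 : (0 : ℝ) < N := by positivity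
  have hb : ∀ r, |√(N : ℝ) * L z r| ≤ N * m r := fun r => by
    rw [abs_mul, abs_of_nonneg (Real.sqrt_nonneg _)]
    have h1 : |L z r| ≤ a * √(N : ℝ) :=
      calc |L z r| ≤ ‖L z‖ := abs_apply_le_norm _ _
        _ ≤ ‖L‖ * ‖z‖ := L.le_opNorm z
        _ ≤ (‖L‖ + 1) * (a / (‖L‖ + 1) * √(N : ℝ)) := by gcongr; linarith
        _ = a * √(N : ℝ) := by field_simp
    have h2 : a ≤ m r := Finset.inf'_le m (Finset.mem_univ r)
    calc √(N : ℝ) * |L z r| ≤ √(N : ℝ) * (a * √(N : ℝ)) := by gcongr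
      _ = N * a := by rw [mul_left_comm, Real.mul_self_sqrt hN0.le, mul_comm]
      _ ≤ N * m r := by gcongr
  set x : Fin (d + 1) → ℝ := fun r => N * m r + √(N : ℝ) * L z r with hx
  have hx0 : ∀ r, 0 ≤ x r := fun r => by
    have := (abs_le.1 (hb r)).1
    simp only [hx]
    linarith
  have hxs : x 0 + ∑ i : Fin d, x i.succ = N := by
    rw [← Fin.sum_univ_succ]
    simp only [hx]
    rw [Finset.sum_add_distrib, ← Finset.mul_sum, ← Finset.mul_sum, hm, hLR.sum_eq_zero]
    simp
  have hfl : ∑ i : Fin d, ⌊x i.succ⌋₊ ≤ N := by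
    have h1 : ∑ i : Fin d, (⌊x i.succ⌋₊ : ℝ) ≤ ∑ i : Fin d, x i.succ :=
      Finset.sum_le_sum fun i _ => Nat.floor_le (hx0 _)
    have h2 : ((∑ i : Fin d, ⌊x i.succ⌋₊ : ℕ) : ℝ) ≤ N := by
      push_cast
      linarith [hx0 0]
    exact_mod_cast h2
  have hk : ∑ r, (Fin.cons (N - ∑ i : Fin d, ⌊x i.succ⌋₊) (fun i => ⌊x i.succ⌋₊) :
      Fin (d + 1) → ℕ) r = N := by
    simp [Fin.sum_univ_succ, Nat.sub_add_cancel hfl]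
  refine ⟨_, hk, (hLR.mem_cell_iff hm hN hk).2 fun i => ?_⟩
  simp only [Fin.cons_succ, Set.mem_Ico]
  have h1 := Nat.floor_le (hx0 i.succ)
  have h2 := Nat.lt_floor_add_one (x i.succ)
  simp only [hx] at h1 h2 ⊢
  constructor <;> linarith

end

section

variable {p d : ℕ} {β h : ℝ} {m : Fin (d + 1) → ℝ}
  {L : EuclideanSpace ℝ (Fin d) →L[ℝ] EuclideanSpace ℝ (Fin (d + 1))}
  {R : EuclideanSpace ℝ (Fin (d + 1)) →L[ℝ] EuclideanSpace ℝ (Fin d)}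

/-! ### Pointwise comparison of the weights with the Gaussian density -/

/-- Within a cell, the point z, the lattice point and the deviation have comparable sizes, so
estimates in y can be rewritten as estimates in z with one constant. -/
theorem IsStandardChart.norm_deviation_le (hLR : IsStandardChart p β m L R) (hm : ∑ r, m r = 1) :
    ∃ B : ℝ, 1 ≤ B ∧ ∀ (N : ℕ) (k : Fin (d + 1) → ℕ) (z : EuclideanSpace ℝ (Fin d)), N ≠ 0 →
      ∑ r, k r = N → z - latticePoint m R N k ∈ cell L N →
      ‖z - latticePoint m R N k‖ ≤ B / √(N : ℝ) ∧ ‖deviation m N k‖ ≤ B * (1 + ‖z‖) ∧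
        ‖latticePoint m R N k‖ ≤ B * (1 + ‖z‖) ∧ 1 + ‖z‖ ≤ B * (1 + ‖deviation m N k‖) := by
  set D := ‖R‖ * (2 * d) with hD
  have hD0 : 0 ≤ D := by positivity
  refine ⟨(1 + ‖L‖) * (1 + D) + 1 + D + ‖R‖, ?_, fun N k z hN hk hz => ?_⟩
  · nlinarith [norm_nonneg L, norm_nonneg R, mul_nonneg (norm_nonneg L) hD0]
  have hs1 : 1 ≤ √(N : ℝ) := by
    rw [Real.one_le_sqrt]; exact_mod_cast Nat.one_le_iff_ne_zero.2 hN
  have h1 := hLR.norm_le_of_mem_cell hN hz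
  have h2 : ‖z - latticePoint m R N k‖ ≤ D := h1.trans (div_le_self hD0 hs1)
  have h3 : ‖latticePoint m R N k‖ ≤ ‖z‖ + D := by
    have := norm_sub_norm_le (latticePoint m R N k) z
    rw [norm_sub_rev] at this
    linarith
  have h4 : ‖deviation m N k‖ ≤ ‖L‖ * ‖latticePoint m R N k‖ :=
    hLR.norm_le _ (sum_deviation hN hk hm)
  have h5 : ‖latticePoint m R N k‖ ≤ ‖R‖ * ‖deviation m N k‖ := R.le_opNorm _
  have h6 : ‖z‖ ≤ D + ‖latticePoint m R N k‖ := by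
    have := norm_sub_norm_le z (latticePoint m R N k)
    linarith
  have n1 := norm_nonneg L
  have n2 := norm_nonneg R
  have n3 := norm_nonneg z
  have n4 := norm_nonneg (deviation m N k)
  have m1 := mul_nonneg n1 hD0
  refine ⟨h1.trans ?_, h4.trans ?_, h3.trans ?_, ?_⟩
  · gcongr
    nlinarith
  · calc ‖L‖ * ‖latticePoint m R N k‖ ≤ ‖L‖ * (‖z‖ + D) := by gcongr
      _ ≤ ((1 + ‖L‖) * (1 + D)) * (1 + ‖z‖) := by
        nlinarith [mul_nonneg n1 n3, mul_nonneg hD0 n3, mul_nonneg m1 n3]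
      _ ≤ _ := by gcongr; linarith
  · calc ‖z‖ + D ≤ (1 + D) * (1 + ‖z‖) := by nlinarith [mul_nonneg hD0 n3]
      _ ≤ _ := mul_le_mul_of_nonneg_right (by nlinarith) (by positivity)
  · calc 1 + ‖z‖ ≤ (1 + D + ‖R‖) * (1 + ‖deviation m N k‖) := by
          nlinarith [mul_nonneg hD0 n4]
      _ ≤ _ := mul_le_mul_of_nonneg_right (by nlinarith) (by positivity)

theorem exp_neg_sq_le_of_le {B c x y : ℝ} (hB : 1 ≤ B) (hc : 0 ≤ c) (hx : 0 ≤ x)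
    (hxy : 1 + x ≤ B * (1 + y)) :
    Real.exp (-(c * y ^ 2)) ≤ Real.exp c * Real.exp (-(c / (2 * B ^ 2) * x ^ 2)) := by
  rw [← Real.exp_add, Real.exp_le_exp]
  have h1 : (1 + x) ^ 2 ≤ (B * (1 + y)) ^ 2 := pow_le_pow_left₀ (by linarith) hxy 2
  have h2 : x ^ 2 ≤ B ^ 2 * (2 + 2 * y ^ 2) := by
    have : (1 + y) ^ 2 ≤ 2 + 2 * y ^ 2 := by nlinarith [sq_nonneg (y - 1)]
    nlinarith [mul_le_mul_of_nonneg_left this (sq_nonneg B)]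
  have h3 : c / (2 * B ^ 2) * x ^ 2 ≤ c / (2 * B ^ 2) * (B ^ 2 * (2 + 2 * y ^ 2)) := by gcongr
  have h4 : c / (2 * B ^ 2) * (B ^ 2 * (2 + 2 * y ^ 2)) = c + c * y ^ 2 := by field_simp
  linarith

/-- Both exponents lie below M - c ‖z‖² and differ by O((1 + ‖z‖)³/√N). The mean value inequality
for exp gives the bound, half of the decay being spent on the cubic factor. -/
theorem exists_weight_sub_gaussian_le_near (hp : 2 ≤ p) (hm : IsUniqueMaximizer p β h m)
    (hpos : ∀ r, 0 < m r) (hLR : IsStandardChart p β m L R) :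
    ∃ C c ε : ℝ, 0 < C ∧ 0 < c ∧ 0 < ε ∧ ∀ (N : ℕ) (k : Fin (d + 1) → ℕ)
      (z : EuclideanSpace ℝ (Fin d)), N ≠ 0 → ∑ r, k r = N →
      z - latticePoint m R N k ∈ cell L N → (∀ r, |(k r : ℝ) / N - m r| ≤ ε) →
      |countWeight p (d + 1) β h N k / weightScale p β h m N - Real.exp (-‖z‖ ^ 2 / 2)|
        ≤ C / √(N : ℝ) * Real.exp (-(c * ‖z‖ ^ 2)) := by
  obtain ⟨B, hB, hBz⟩ := hLR.norm_deviation_le hm.1.2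
  obtain ⟨C₁, ε₁, hC₁, hε₁, H₁⟩ := exists_abs_log_countWeight_add_le (h := h) hp hm hpos hLR
  obtain ⟨C₂, c₂, ε₂, hc₂, hε₂, H₂⟩ := exists_log_countWeight_le_of_near (h := h) hp hm hpos hLR
  set c := min (c₂ / (2 * B ^ 2)) (1 / 2) with hc
  have hc0 : 0 < c := by positivity
  obtain ⟨C₃, hC₃, H₃⟩ := exists_pow_le_mul_exp 3 (half_pos hc0)
  set M := max (C₂ + c₂) 0 with hM
  refine ⟨(C₁ * (2 * B) ^ 3 + B ^ 2) * C₃ * Real.exp M, c / 2, min ε₁ ε₂, by positivity, by positivity,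
    lt_min hε₁ hε₂, fun N k z hN hk hz hd => ?_⟩
  have hN0 : (0 : ℝ) < N := by positivity
  have hs : 0 < √(N : ℝ) := by positivity
  obtain ⟨z1, z2, z3, z4⟩ := hBz N k z hN hk hz
  have b1 := H₁ N k hN hk fun r => (hd r).trans (min_le_left _ _)
  have b2 := H₂ N k hN hk fun r => (hd r).trans (min_le_right _ _)
  have hw : 0 < countWeight p (d + 1) β h N k / weightScale p β h m N :=
    div_pos countWeight_pos weightScale_pos
  set ℓ := Real.log (countWeight p (d + 1) β h N k / weightScale p β h m N) with hℓ
  rw [← Real.exp_log hw, ← hℓ]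
  change |ℓ + ‖latticePoint m R N k‖ ^ 2 / 2| ≤ _ at b1
  set y := deviation m N k with hy
  set zk := latticePoint m R N k with hzk
  have hz0 := norm_nonneg z
  have hzk0 := norm_nonneg zk
  have hx : 1 ≤ 1 + ‖z‖ := by linarith
  have u1 : ℓ ≤ M - c * ‖z‖ ^ 2 := by
    have h1 := exp_neg_sq_le_of_le hB hc₂.le hz0 z4
    rw [← Real.exp_add, Real.exp_le_exp] at h1
    have h2 : c * ‖z‖ ^ 2 ≤ c₂ / (2 * B ^ 2) * ‖z‖ ^ 2 := by gcongr; exact min_le_left _ _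
    have h3 : C₂ + c₂ ≤ M := le_max_left _ _
    linarith
  have u2 : -‖z‖ ^ 2 / 2 ≤ M - c * ‖z‖ ^ 2 := by
    have h2 : c * ‖z‖ ^ 2 ≤ 1 / 2 * ‖z‖ ^ 2 := by gcongr; exact min_le_right _ _
    have h3 : 0 ≤ M := le_max_right _ _
    linarith
  have u3 : |ℓ - -‖z‖ ^ 2 / 2| ≤ (C₁ * (2 * B) ^ 3 + B ^ 2) * (1 + ‖z‖) ^ 3 / √(N : ℝ) := by
    -- The first summand is the Stirling and Taylor error at the lattice point; the second is the
    -- cost of moving from the lattice point to z.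
    have e1 : ℓ - -‖z‖ ^ 2 / 2 = (ℓ + ‖zk‖ ^ 2 / 2) + (‖z‖ - ‖zk‖) * (‖z‖ + ‖zk‖) / 2 := by ring
    have a1 : |(‖z‖ - ‖zk‖) * (‖z‖ + ‖zk‖) / 2| ≤ B ^ 2 * (1 + ‖z‖) ^ 3 / √(N : ℝ) := by
      have h1 : |‖z‖ - ‖zk‖| ≤ B / √(N : ℝ) := (abs_norm_sub_norm_le _ _).trans z1
      have h2 : ‖z‖ + ‖zk‖ ≤ 2 * (B * (1 + ‖z‖)) := by nlinarith
      rw [abs_div, abs_mul, abs_two, abs_of_nonneg (add_nonneg hz0 hzk0)]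
      calc _ ≤ B / √(N : ℝ) * (2 * (B * (1 + ‖z‖))) / 2 := by gcongr
        _ = B ^ 2 * (1 + ‖z‖) / √(N : ℝ) := by ring
        _ ≤ _ := by gcongr; exact le_self_pow₀ hx (by norm_num)
    have a2 : C₁ * (1 + ‖y‖) ^ 3 / √(N : ℝ) ≤ C₁ * (2 * B) ^ 3 * (1 + ‖z‖) ^ 3 / √(N : ℝ) := by
      rw [mul_assoc C₁, ← mul_pow]
      gcongr
      nlinarith
    rw [e1]
    refine (abs_add_le _ _).trans ((add_le_add (b1.trans a2) a1).trans_eq ?_)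
    ring
  have e2 : Real.exp (M - c * ‖z‖ ^ 2)
      = Real.exp M * Real.exp (-(c / 2 * ‖z‖ ^ 2)) * Real.exp (-(c / 2 * ‖z‖ ^ 2)) := by
    rw [← Real.exp_add, ← Real.exp_add]; ring_nf
  have e3 : Real.exp (c / 2 * ‖z‖ ^ 2) * Real.exp (-(c / 2 * ‖z‖ ^ 2)) = 1 := by
    rw [← Real.exp_add, add_neg_cancel, Real.exp_zero]
  calc |Real.exp ℓ - Real.exp (-‖z‖ ^ 2 / 2)|
      ≤ |ℓ - -‖z‖ ^ 2 / 2| * Real.exp (M - c * ‖z‖ ^ 2) := abs_exp_sub_exp_le u1 u2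
    _ ≤ ((C₁ * (2 * B) ^ 3 + B ^ 2) * (C₃ * Real.exp (c / 2 * ‖z‖ ^ 2)) / √(N : ℝ))
        * (Real.exp M * Real.exp (-(c / 2 * ‖z‖ ^ 2)) * Real.exp (-(c / 2 * ‖z‖ ^ 2))) := by
        rw [e2]
        have := H₃ ‖z‖ hz0
        have hpc : 0 ≤ C₁ * (2 * B) ^ 3 + B ^ 2 := by positivity
        gcongr
        exact u3.trans (by gcongr)
    _ = (C₁ * (2 * B) ^ 3 + B ^ 2) * C₃ * Real.exp M / √(N : ℝ)
        * Real.exp (-(c / 2 * ‖z‖ ^ 2))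
        * (Real.exp (c / 2 * ‖z‖ ^ 2) * Real.exp (-(c / 2 * ‖z‖ ^ 2))) := by ring
    _ = _ := by rw [e3, mul_one]

/-- When 1 + x is at least of order s, a factor 1/s can be bought with half of the Gaussian
exponent. -/
theorem exists_gaussian_le_of_far (B ε : ℝ) (hB : 0 ≤ B) (hε : 0 < ε) :
    ∃ C : ℝ, 0 < C ∧ ∀ s x : ℝ, 0 < s → 0 ≤ x → ε * s ≤ B * (1 + x) →
      Real.exp (-x ^ 2 / 2) ≤ C / s * Real.exp (-(1 / 4 * x ^ 2)) := by
  obtain ⟨C, hC, H⟩ := exists_pow_le_mul_exp 1 (show (0 : ℝ) < 1 / 4 by norm_num)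
  refine ⟨(B + 1) * C / ε, by positivity, fun s x hs hx hsx => ?_⟩
  have h1 := H x hx
  rw [pow_one] at h1
  have h2 : Real.exp (-x ^ 2 / 2) = Real.exp (-(1 / 4 * x ^ 2)) * Real.exp (-(1 / 4 * x ^ 2)) := by
    rw [← Real.exp_add]; ring_nf
  have e3 : Real.exp (1 / 4 * x ^ 2) * Real.exp (-(1 / 4 * x ^ 2)) = 1 := by
    rw [← Real.exp_add, add_neg_cancel, Real.exp_zero]
  have h3 : ε * s ≤ (B + 1) * (C * Real.exp (1 / 4 * x ^ 2)) := by
    refine hsx.trans ?_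
    gcongr
    linarith
  rw [h2]
  gcongr
  rw [le_div_iff₀ hs, le_div_iff₀ hε]
  calc Real.exp (-(1 / 4 * x ^ 2)) * s * ε = (ε * s) * Real.exp (-(1 / 4 * x ^ 2)) := by ring
    _ ≤ ((B + 1) * (C * Real.exp (1 / 4 * x ^ 2))) * Real.exp (-(1 / 4 * x ^ 2)) :=
      mul_le_mul_of_nonneg_right h3 (Real.exp_pos _).le
    _ = (B + 1) * C * (Real.exp (1 / 4 * x ^ 2) * Real.exp (-(1 / 4 * x ^ 2))) := by ring
    _ = _ := by rw [e3, mul_one]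

/-- No cancellation is needed here: ‖y‖ ≥ ε √N, and the weight and the Gaussian are each small
enough on their own. -/
theorem exists_weight_sub_gaussian_le_far (hp : 2 ≤ p) (hm : IsUniqueMaximizer p β h m)
    (hpos : ∀ r, 0 < m r) (hLR : IsStandardChart p β m L R) {ε : ℝ} (hε : 0 < ε) :
    ∃ C c : ℝ, 0 < C ∧ 0 < c ∧ ∀ (N : ℕ) (k : Fin (d + 1) → ℕ)
      (z : EuclideanSpace ℝ (Fin d)), N ≠ 0 → ∑ r, k r = N →
      z - latticePoint m R N k ∈ cell L N → ¬ (∀ r, |(k r : ℝ) / N - m r| ≤ ε) →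
      |countWeight p (d + 1) β h N k / weightScale p β h m N - Real.exp (-‖z‖ ^ 2 / 2)|
        ≤ C / √(N : ℝ) * Real.exp (-(c * ‖z‖ ^ 2)) := by
  obtain ⟨B, hB, hBz⟩ := hLR.norm_deviation_le hm.1.2
  obtain ⟨c, hc, H⟩ := exists_countWeight_le (h := h) hp hm hpos hLR
  obtain ⟨C₁, hC₁, H₁⟩ := exists_gaussian_le_of_far B ε (by linarith) hε
  -- Of these powers of √N, d + 1 come from the crude weight bound and one more produces the rate
  -- 1/√N.
  obtain ⟨C₂, hC₂, H₂⟩ := exists_pow_le_mul_exp (d + 1 + 1) (half_pos hc)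
  set A := √(2 * Real.pi) ^ (d + 1) with hA
  refine ⟨C₁ + A * C₂ / ε ^ (d + 1 + 1) * Real.exp (c / 2), min (1 / 4) (c / 2 / (2 * B ^ 2)),
    by positivity, by positivity, fun N k z hN hk hz hd => ?_⟩
  have hN0 : (0 : ℝ) < N := by positivity
  have hs : 0 < √(N : ℝ) := by positivity
  obtain ⟨z1, z2, z3, z4⟩ := hBz N k z hN hk hz
  have hz0 := norm_nonneg z
  have hw : 0 < countWeight p (d + 1) β h N k / weightScale p β h m N :=
    div_pos countWeight_pos weightScale_pos
  have hfar : ε * √(N : ℝ) ≤ ‖deviation m N k‖ := by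
    push Not at hd
    obtain ⟨r, hr⟩ := hd
    rw [abs_sub_eq_abs_deviation_div hN, lt_div_iff₀ hs] at hr
    exact hr.le.trans (abs_apply_le_norm _ _)
  set y := deviation m N k with hy
  have g1 := H₁ √(N : ℝ) ‖z‖ hs hz0 (hfar.trans z2)
  have f1 : countWeight p (d + 1) β h N k / weightScale p β h m N
      ≤ A * √(N : ℝ) ^ (d + 1) * Real.exp (-(c * ‖y‖ ^ 2)) := by
    have h1 := H N k hN hk
    rw [← Real.exp_log hw]
    refine (Real.exp_le_exp.2 h1).trans_eq ?_
    rw [sub_eq_add_neg, Real.exp_add, hA, ← mul_pow, ← Real.sqrt_mul (by positivity)]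
    congr 1
    rw [← Real.exp_log (show 0 < √(2 * Real.pi * N) by positivity), ← Real.exp_nat_mul,
      Real.log_sqrt (by positivity)]
    congr 1
    ring
  have f2 : √(N : ℝ) ^ (d + 1) ≤
      C₂ / ε ^ (d + 1 + 1) * Real.exp (c / 2 * ‖y‖ ^ 2) / √(N : ℝ) := by
    rw [le_div_iff₀ hs, ← pow_succ, div_mul_eq_mul_div, le_div_iff₀ (by positivity), ← mul_pow]
    refine le_trans ?_ (H₂ ‖y‖ (norm_nonneg _))
    refine pow_le_pow_left₀ (by positivity) ?_ _
    rw [mul_comm]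
    linarith
  have e2 : Real.exp (-(c * ‖y‖ ^ 2))
      = Real.exp (-(c / 2 * ‖y‖ ^ 2)) * Real.exp (-(c / 2 * ‖y‖ ^ 2)) := by
    rw [← Real.exp_add]; ring_nf
  have e3 : Real.exp (c / 2 * ‖y‖ ^ 2) * Real.exp (-(c / 2 * ‖y‖ ^ 2)) = 1 := by
    rw [← Real.exp_add, add_neg_cancel, Real.exp_zero]
  have f3 : countWeight p (d + 1) β h N k / weightScale p β h m N
      ≤ A * C₂ / ε ^ (d + 1 + 1) / √(N : ℝ) * Real.exp (-(c / 2 * ‖y‖ ^ 2)) := by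
    refine f1.trans ?_
    calc _ ≤ A * (C₂ / ε ^ (d + 1 + 1) * Real.exp (c / 2 * ‖y‖ ^ 2) / √(N : ℝ))
          * Real.exp (-(c * ‖y‖ ^ 2)) := by gcongr
      _ = A * C₂ / ε ^ (d + 1 + 1) / √(N : ℝ) * Real.exp (-(c / 2 * ‖y‖ ^ 2))
          * (Real.exp (c / 2 * ‖y‖ ^ 2) * Real.exp (-(c / 2 * ‖y‖ ^ 2))) := by rw [e2]; ring
      _ = _ := by rw [e3, mul_one]
  have f4 := exp_neg_sq_le_of_le hB (half_pos hc).le hz0 z4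
  set c' := min (1 / 4) (c / 2 / (2 * B ^ 2)) with hc'
  have k1 : Real.exp (-(1 / 4 * ‖z‖ ^ 2)) ≤ Real.exp (-(c' * ‖z‖ ^ 2)) := by
    rw [Real.exp_le_exp, neg_le_neg_iff]
    gcongr
    exact min_le_left _ _
  have k2 : Real.exp (-(c / 2 / (2 * B ^ 2) * ‖z‖ ^ 2)) ≤ Real.exp (-(c' * ‖z‖ ^ 2)) := by
    rw [Real.exp_le_exp, neg_le_neg_iff]
    gcongr
    exact min_le_right _ _
  have j1 : Real.exp (-‖z‖ ^ 2 / 2) ≤ C₁ / √(N : ℝ) * Real.exp (-(c' * ‖z‖ ^ 2)) :=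
    g1.trans (by gcongr)
  have j2 : countWeight p (d + 1) β h N k / weightScale p β h m N
      ≤ A * C₂ / ε ^ (d + 1 + 1) / √(N : ℝ) * (Real.exp (c / 2) * Real.exp (-(c' * ‖z‖ ^ 2))) :=
    f3.trans (by gcongr; exact f4.trans (by gcongr))
  have e4 : (C₁ + A * C₂ / ε ^ (d + 1 + 1) * Real.exp (c / 2)) / √(N : ℝ)
      * Real.exp (-(c' * ‖z‖ ^ 2)) = C₁ / √(N : ℝ) * Real.exp (-(c' * ‖z‖ ^ 2))
      + A * C₂ / ε ^ (d + 1 + 1) / √(N : ℝ) * (Real.exp (c / 2) * Real.exp (-(c' * ‖z‖ ^ 2))) := by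
    ring
  rw [e4, abs_le]
  have := Real.exp_pos (-‖z‖ ^ 2 / 2)
  constructor <;> linarith

/-- The weights of the lattice points, spread over the cells of the lattice. -/
noncomputable def smearedWeight (p : ℕ) (β h : ℝ) (m : Fin (d + 1) → ℝ)
    (L : EuclideanSpace ℝ (Fin d) →L[ℝ] EuclideanSpace ℝ (Fin (d + 1)))
    (R : EuclideanSpace ℝ (Fin (d + 1)) →L[ℝ] EuclideanSpace ℝ (Fin d)) (N : ℕ)
    (z : EuclideanSpace ℝ (Fin d)) : ℝ :=
  ∑ k ∈ Finset.piAntidiag Finset.univ N, (cell L N).indicator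
    (fun _ => countWeight p (d + 1) β h N k / weightScale p β h m N) (z - latticePoint m R N k)

theorem mem_piAntidiag_univ {q N : ℕ} {k : Fin q → ℕ} :
    k ∈ Finset.piAntidiag Finset.univ N ↔ ∑ r, k r = N := by
  simp

theorem IsStandardChart.sum_indicator_cell (hLR : IsStandardChart p β m L R)
    (hm : ∑ r, m r = 1) {N : ℕ} (hN : N ≠ 0) (c : (Fin (d + 1) → ℕ) → ℝ) {k : Fin (d + 1) → ℕ}
    (hk : ∑ r, k r = N) {z : EuclideanSpace ℝ (Fin d)}
    (hz : z - latticePoint m R N k ∈ cell L N) :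
    ∑ l ∈ Finset.piAntidiag Finset.univ N,
      (cell L N).indicator (fun _ => c l) (z - latticePoint m R N l) = c k := by
  rw [Finset.sum_eq_single_of_mem k (mem_piAntidiag_univ.2 hk), Set.indicator_of_mem hz]
  intro l hl hlk
  refine Set.indicator_of_notMem (fun hzl => hlk ?_) _
  exact hLR.eq_of_mem_cell hm hN (mem_piAntidiag_univ.1 hl) hk hzl hz

/-- Local limit theorem: the smeared weights are close to the standard Gaussian profile. -/
theorem exists_smearedWeight_sub_gaussian_le (hp : 2 ≤ p) (hm : IsUniqueMaximizer p β h m)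
    (hpos : ∀ r, 0 < m r) (hLR : IsStandardChart p β m L R) :
    ∃ C c : ℝ, 0 < C ∧ 0 < c ∧ ∀ (N : ℕ) (z : EuclideanSpace ℝ (Fin d)), N ≠ 0 →
      |smearedWeight p β h m L R N z - Real.exp (-‖z‖ ^ 2 / 2)|
        ≤ C / √(N : ℝ) * Real.exp (-(c * ‖z‖ ^ 2)) := by
  obtain ⟨C₁, c₁, ε, hC₁, hc₁, hε, H₁⟩ :=
    exists_weight_sub_gaussian_le_near (h := h) hp hm hpos hLR
  obtain ⟨C₂, c₂, hC₂, hc₂, H₂⟩ := exists_weight_sub_gaussian_le_far (h := h) hp hm hpos hLR hε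
  obtain ⟨δ, hδ, Hδ⟩ := hLR.exists_mem_cell hm.1.2 hpos
  obtain ⟨C₃, hC₃, H₃⟩ := exists_gaussian_le_of_far 1 δ zero_le_one hδ
  have key : ∀ C' c' : ℝ, C' ≤ C₁ + C₂ + C₃ → min (min c₁ c₂) (1 / 4) ≤ c' → 0 < C' →
      ∀ (s x : ℝ), 0 ≤ s → C' / s * Real.exp (-(c' * x ^ 2)) ≤
        (C₁ + C₂ + C₃) / s * Real.exp (-(min (min c₁ c₂) (1 / 4) * x ^ 2)) := by
    intro C' c' hC' hc' h0 s x hs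
    gcongr
  refine ⟨C₁ + C₂ + C₃, min (min c₁ c₂) (1 / 4), by positivity, by positivity, fun N z hN => ?_⟩
  have hs : 0 < √(N : ℝ) := by positivity
  by_cases hex : ∃ k : Fin (d + 1) → ℕ, ∑ r, k r = N ∧ z - latticePoint m R N k ∈ cell L N
  · obtain ⟨k, hk, hz⟩ := hex
    rw [smearedWeight, hLR.sum_indicator_cell hm.1.2 hN _ hk hz]
    by_cases hd : ∀ r, |(k r : ℝ) / N - m r| ≤ ε
    · exact (H₁ N k z hN hk hz hd).trans (key _ _ (by linarith)
        ((min_le_left _ _).trans (min_le_left _ _)) hC₁ _ _ hs.le)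
    · exact (H₂ N k z hN hk hz hd).trans (key _ _ (by linarith)
        ((min_le_left _ _).trans (min_le_right _ _)) hC₂ _ _ hs.le)
  -- A point outside every cell is at distance of order √N from 0, and there the Gaussian profile
  -- itself is within the error.
  · have h0 : smearedWeight p β h m L R N z = 0 :=
      Finset.sum_eq_zero fun k hk => Set.indicator_of_notMem
        (fun hz => hex ⟨k, mem_piAntidiag_univ.1 hk, hz⟩) _
    have hfar : δ * √(N : ℝ) ≤ 1 * (1 + ‖z‖) := by
      by_contra! hcon
      exact hex (Hδ N hN z (by linarith))
    rw [h0, zero_sub, abs_neg, abs_of_pos (Real.exp_pos _)]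
    exact (H₃ _ _ hs (norm_nonneg z) hfar).trans (key _ _ (by linarith) (min_le_right _ _) hC₃ _ _
      hs.le)

end

/-! ### Configurations and their color counts -/

/-- The number of sites of each color. -/
def colorCount {q N : ℕ} (X : Fin N → Fin q) (r : Fin q) : ℕ :=
  (Finset.univ.filter fun i => X i = r).card

theorem sum_colorCount {q N : ℕ} (X : Fin N → Fin q) : ∑ r, colorCount X r = N := by
  have := Finset.card_eq_sum_card_fiberwise (f := X) (s := Finset.univ) (t := Finset.univ)
    (fun _ _ => Finset.mem_coe.2 (Finset.mem_univ _))
  simpa [colorCount] using this.symm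

theorem magnetization_eq {q N : ℕ} (X : Fin N → Fin q) (r : Fin q) :
    magnetization X r = (colorCount X r : ℝ) / N := by
  simp [magnetization, colorCount]

theorem W_eq_deviation {q N : ℕ} (m : Fin q → ℝ) (X : Fin N → Fin q) :
    W m X = deviation m N (colorCount X) := by
  simp [W, deviation, magnetization_eq]

open MvPolynomial in
-- The power (∑ X_r)^N is expanded once as a sum over configurations and once by the multinomial
-- theorem; the coefficients of the monomial with exponent k agree.
theorem card_colorCount_eq {q N : ℕ} {k : Fin q → ℕ} (hk : ∑ r, k r = N) :
    (Finset.univ.filter fun X : Fin N → Fin q => colorCount X = k).card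
      = Nat.multinomial Finset.univ k := by
  have h1 := Fintype.sum_pow (fun r : Fin q => (MvPolynomial.X r : MvPolynomial (Fin q) ℕ)) N
  rw [Finset.sum_pow_eq_sum_piAntidiag] at h1
  have h2 : ∀ l : Fin q → ℕ, ∏ r, (MvPolynomial.X r : MvPolynomial (Fin q) ℕ) ^ l r
      = monomial (Finsupp.equivFunOnFinite.symm l) 1 := fun l => by
    rw [monomial_eq, C_1, one_mul, Finsupp.prod_fintype _ _ (by simp)]
    simp
  have h3 : ∀ X : Fin N → Fin q, ∏ i, (MvPolynomial.X (X i) : MvPolynomial (Fin q) ℕ)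
      = monomial (Finsupp.equivFunOnFinite.symm (colorCount X)) 1 := fun X => by
    rw [← h2, ← Finset.prod_fiberwise_of_maps_to (g := X) (t := Finset.univ) (by simp)]
    refine Finset.prod_congr rfl fun r _ => ?_
    rw [Finset.prod_congr rfl fun i hi => by rw [(Finset.mem_filter.1 hi).2], Finset.prod_const]
    rfl
  simp_rw [h2, h3] at h1
  have h4 := congrArg (coeff (Finsupp.equivFunOnFinite.symm k)) h1
  simp only [coeff_sum, coeff_monomial, EmbeddingLike.apply_eq_iff_eq] at h4
  rw [Finset.card_filter, ← h4, Finset.sum_eq_single_of_mem k (mem_piAntidiag_univ.2 hk)]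
  · have : (Nat.multinomial Finset.univ k : MvPolynomial (Fin q) ℕ)
        = C (Nat.multinomial Finset.univ k) := by simp
    rw [this, coeff_C_mul]
    simp
  · intro l _ hl
    have : (Nat.multinomial Finset.univ l : MvPolynomial (Fin q) ℕ)
        = C (Nat.multinomial Finset.univ l) := by simp
    rw [this, coeff_C_mul, coeff_monomial, if_neg (by simpa using hl), mul_zero]

theorem sum_comp_colorCount {q N : ℕ} (Φ : (Fin q → ℕ) → ℝ) :
    ∑ X : Fin N → Fin q, Φ (colorCount X)
      = ∑ k ∈ Finset.piAntidiag Finset.univ N, Nat.multinomial Finset.univ k * Φ k := by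
  rw [← Finset.sum_fiberwise_of_maps_to (g := colorCount) (t := Finset.piAntidiag Finset.univ N)
    fun X _ => mem_piAntidiag_univ.2 (sum_colorCount X)]
  refine Finset.sum_congr rfl fun k hk => ?_
  rw [Finset.sum_congr rfl fun X hX => by rw [(Finset.mem_filter.1 hX).2], Finset.sum_const,
    card_colorCount_eq (mem_piAntidiag_univ.1 hk), nsmul_eq_mul]

section

variable {p q : ℕ} [NeZero q] {β h : ℝ} {m : Fin q → ℝ} {N : ℕ}

theorem energy_eq (X : Fin N → Fin q) :
    energy p q β h N X = β * N * ∑ r, ((colorCount X r : ℝ) / N) ^ p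
      + N * h * ((colorCount X 0 : ℝ) / N) := by
  simp [energy, magnetization_eq]

theorem gibbsMass_eq (X : Fin N → Fin q) : gibbsMass p q β h N X
    = Real.exp (energy p q β h N X) / ∑ Y : Fin N → Fin q, Real.exp (energy p q β h N Y) := by
  have : (0 : ℝ) < (q : ℝ) ^ N := by
    have := NeZero.pos q
    positivity
  rw [gibbsMass, partitionFunction]
  field_simp

theorem integral_gibbsMeasure (g : (Fin N → Fin q) → ℝ) :
    ∫ X, g X ∂(gibbsMeasure p q β h N) = ∑ X, gibbsMass p q β h N X * g X := by
  have hnn : ∀ X, 0 ≤ gibbsMass p q β h N X := fun X => by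
    rw [gibbsMass_eq]
    positivity
  rw [gibbsMeasure, integral_finsetSum_measure fun X _ =>
    Integrable.of_finite.smul_measure ENNReal.ofReal_ne_top]
  refine Finset.sum_congr rfl fun X _ => ?_
  rw [integral_smul_measure, integral_dirac, ENNReal.toReal_ofReal (hnn X), smul_eq_mul]

theorem sum_countWeight_mul (Φ : (Fin q → ℕ) → ℝ) :
    ∑ X : Fin N → Fin q, Real.exp (energy p q β h N X) * Φ (colorCount X)
      = ∑ k ∈ Finset.piAntidiag Finset.univ N, countWeight p q β h N k * Φ k := by
  simp_rw [energy_eq]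
  rw [sum_comp_colorCount fun k => Real.exp (β * N * ∑ r, ((k r : ℝ) / N) ^ p
      + N * h * ((k 0 : ℝ) / N)) * Φ k]
  simp [countWeight, mul_assoc]

theorem expectW_eq_sum_div (g : EuclideanSpace ℝ (Fin q) → ℝ) :
    expectW p q β h m N g
      = (∑ k ∈ Finset.piAntidiag Finset.univ N, countWeight p q β h N k * g (deviation m N k))
        / ∑ k ∈ Finset.piAntidiag Finset.univ N, countWeight p q β h N k := by
  have h1 := sum_countWeight_mul (p := p) (q := q) (β := β) (h := h) (N := N) fun _ => 1
  simp only [mul_one] at h1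
  rw [expectW, integral_gibbsMeasure, ← sum_countWeight_mul fun k => g (deviation m N k), ← h1,
    Finset.sum_div]
  refine Finset.sum_congr rfl fun X _ => ?_
  rw [gibbsMass_eq, W_eq_deviation]
  ring

end

/-! ### Spreading sums over lattice cells -/

section

variable {p d : ℕ} {β h : ℝ} {m : Fin (d + 1) → ℝ}
  {L : EuclideanSpace ℝ (Fin d) →L[ℝ] EuclideanSpace ℝ (Fin (d + 1))}
  {R : EuclideanSpace ℝ (Fin (d + 1)) →L[ℝ] EuclideanSpace ℝ (Fin d)}

/-- The function that is constant, with value `c k`, on the cell of each lattice point. -/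
noncomputable def spread (m : Fin (d + 1) → ℝ)
    (L : EuclideanSpace ℝ (Fin d) →L[ℝ] EuclideanSpace ℝ (Fin (d + 1)))
    (R : EuclideanSpace ℝ (Fin (d + 1)) →L[ℝ] EuclideanSpace ℝ (Fin d)) (N : ℕ)
    (c : (Fin (d + 1) → ℕ) → ℝ) (z : EuclideanSpace ℝ (Fin d)) : ℝ :=
  ∑ k ∈ Finset.piAntidiag Finset.univ N,
    (cell L N).indicator (fun _ => c k) (z - latticePoint m R N k)

theorem spread_eq_zero {N : ℕ} {c : (Fin (d + 1) → ℕ) → ℝ} {z : EuclideanSpace ℝ (Fin d)}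
    (hz : ¬ ∃ k : Fin (d + 1) → ℕ, ∑ r, k r = N ∧ z - latticePoint m R N k ∈ cell L N) :
    spread m L R N c z = 0 :=
  Finset.sum_eq_zero fun k hk => Set.indicator_of_notMem
    (fun hzk => hz ⟨k, mem_piAntidiag_univ.1 hk, hzk⟩) _

/-- The cells are disjoint, so at each point at most one term of a spread sum survives. -/
theorem IsStandardChart.spread_mul (hLR : IsStandardChart p β m L R) (hm : ∑ r, m r = 1)
    {N : ℕ} (hN : N ≠ 0) (a b : (Fin (d + 1) → ℕ) → ℝ) (z : EuclideanSpace ℝ (Fin d)) :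
    spread m L R N (fun k => a k * b k) z = spread m L R N a z * spread m L R N b z := by
  by_cases hex : ∃ k : Fin (d + 1) → ℕ, ∑ r, k r = N ∧ z - latticePoint m R N k ∈ cell L N
  · obtain ⟨k, hk, hz⟩ := hex
    simp only [spread, hLR.sum_indicator_cell hm hN _ hk hz]
  · simp only [spread_eq_zero hex, mul_zero]

theorem measurable_spread (N : ℕ) (c : (Fin (d + 1) → ℕ) → ℝ) :
    Measurable (spread m L R N c) := by
  unfold spread
  exact Finset.measurable_sum _ fun k _ =>
    (measurable_const.indicator (measurableSet_cell N)).comp (measurable_id.sub_const _)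

theorem IsStandardChart.integral_spread (hLR : IsStandardChart p β m L R) {N : ℕ} (hN : N ≠ 0)
    (c : (Fin (d + 1) → ℕ) → ℝ) : ∫ z, spread m L R N c z
      = volume.real (cell L N) * ∑ k ∈ Finset.piAntidiag Finset.univ N, c k := by
  unfold spread
  have hi : ∀ a : ℝ, Integrable ((cell L N).indicator fun _ => a) := fun a =>
    (integrable_indicator_iff (measurableSet_cell N)).2
      (integrableOn_const (hLR.volume_cell_lt_top hN).ne)
  rw [integral_finsetSum _ fun k _ => (hi (c k)).comp_sub_right _, Finset.mul_sum]
  refine Finset.sum_congr rfl fun k _ => ?_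
  rw [integral_sub_right_eq_self, integral_indicator_const _ (measurableSet_cell N), smul_eq_mul]

/-- The common cell volume and the weight scale cancel in the quotient, so no asymptotics of the
partition function are needed. -/
theorem IsStandardChart.expectW_eq_integral_div (hLR : IsStandardChart p β m L R)
    (hm : ∑ r, m r = 1) {N : ℕ} (hN : N ≠ 0) (f : EuclideanSpace ℝ (Fin d) → ℝ) :
    expectW p (d + 1) β h m N (fun x => f (R x))
      = (∫ z, spread m L R N (fun k => f (latticePoint m R N k)) z * smearedWeight p β h m L R N z)
        / ∫ z, smearedWeight p β h m L R N z := by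
  have hv : volume.real (cell L N) ≠ 0 :=
    (ENNReal.toReal_pos (hLR.volume_cell_pos hN).ne' (hLR.volume_cell_lt_top hN).ne).ne'
  have hw : weightScale p β h m N ≠ 0 := weightScale_pos.ne'
  have e1 : smearedWeight p β h m L R N
      = spread m L R N fun k => countWeight p (d + 1) β h N k / weightScale p β h m N := rfl
  simp_rw [e1, ← hLR.spread_mul hm hN]
  rw [hLR.integral_spread hN, hLR.integral_spread hN, mul_div_mul_left _ _ hv, ← Finset.sum_div,
    expectW_eq_sum_div]
  simp_rw [mul_div_assoc', ← Finset.sum_div]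
  rw [div_div_div_cancel_right₀ hw]
  congr 1
  exact Finset.sum_congr rfl fun k _ => mul_comm _ _

end

/-! ### Gaussian integrals -/

section

variable {E : Type*} [NormedAddCommGroup E]

/-- The unnormalized standard Gaussian density. -/
noncomputable def gaussianProfile (z : E) : ℝ := Real.exp (-‖z‖ ^ 2 / 2)

theorem gaussianProfile_pos (z : E) : 0 < gaussianProfile z := Real.exp_pos _

theorem gaussianProfile_eq (z : E) : gaussianProfile z = Real.exp (-(1 / 2 * ‖z‖ ^ 2)) := by
  rw [gaussianProfile]; ring_nf

end

section

variable {E : Type*} [NormedAddCommGroup E] [InnerProductSpace ℝ E] [FiniteDimensional ℝ E]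
  [MeasurableSpace E] [BorelSpace E]

theorem integrable_exp_neg_mul_sq_norm {c : ℝ} (hc : 0 < c) :
    Integrable fun z : E => Real.exp (-(c * ‖z‖ ^ 2)) := by
  have := (GaussianFourier.integrable_cexp_neg_mul_sq_norm_add (V := E) (b := c)
    (by simpa using hc) 0 0).re
  refine this.congr (Filter.Eventually.of_forall fun z => ?_)
  have e : (-(c : ℂ) * (‖z‖ : ℂ) ^ 2 + 0 * ((inner ℝ (0 : E) z : ℝ) : ℂ))
      = ((-(c * ‖z‖ ^ 2) : ℝ) : ℂ) := by push_cast; ring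
  simp only [e]
  rw [← Complex.ofReal_exp]
  rfl

theorem integrable_pow_mul_exp_neg_mul_sq_norm (n : ℕ) {c : ℝ} (hc : 0 < c) :
    Integrable fun z : E => (1 + ‖z‖) ^ n * Real.exp (-(c * ‖z‖ ^ 2)) := by
  obtain ⟨C, hC, H⟩ := exists_pow_le_mul_exp n (half_pos hc)
  refine ((integrable_exp_neg_mul_sq_norm (E := E) (half_pos hc)).const_mul C).mono'
    (by fun_prop) (Filter.Eventually.of_forall fun z => ?_)
  have e : Real.exp (-(c * ‖z‖ ^ 2))
      = Real.exp (-(c / 2 * ‖z‖ ^ 2)) * Real.exp (-(c / 2 * ‖z‖ ^ 2)) := by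
    rw [← Real.exp_add]; ring_nf
  have e3 : Real.exp (c / 2 * ‖z‖ ^ 2) * Real.exp (-(c / 2 * ‖z‖ ^ 2)) = 1 := by
    rw [← Real.exp_add, add_neg_cancel, Real.exp_zero]
  rw [Real.norm_of_nonneg (by positivity)]
  calc _ ≤ C * Real.exp (c / 2 * ‖z‖ ^ 2) * Real.exp (-(c * ‖z‖ ^ 2)) := by
        gcongr
        exact H _ (norm_nonneg z)
    _ = C * (Real.exp (c / 2 * ‖z‖ ^ 2) * Real.exp (-(c / 2 * ‖z‖ ^ 2)))
        * Real.exp (-(c / 2 * ‖z‖ ^ 2)) := by rw [e]; ring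
    _ = _ := by rw [e3, mul_one]

theorem integrable_pow_mul_gaussianProfile (n : ℕ) :
    Integrable fun z : E => (1 + ‖z‖) ^ n * gaussianProfile z := by
  simp_rw [gaussianProfile_eq]
  exact integrable_pow_mul_exp_neg_mul_sq_norm n (by norm_num)

theorem integrable_gaussianProfile : Integrable (gaussianProfile (E := E)) := by
  simpa using integrable_pow_mul_gaussianProfile (E := E) 0

theorem integral_gaussianProfile_pos : 0 < ∫ z : E, gaussianProfile z := by
  rw [integral_pos_iff_support_of_nonneg (fun z => (gaussianProfile_pos z).le)
    integrable_gaussianProfile]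
  have : Function.support (gaussianProfile (E := E)) = Set.univ := by
    ext z; simp [gaussianProfile]
  rw [this]
  exact isOpen_univ.measure_pos volume Set.univ_nonempty

/-- The two finite measures have the same characteristic function. The normalization is left as an
integral and never evaluated. -/
theorem stdGaussian_eq_withDensity : stdGaussian E = volume.withDensity
    fun z => ENNReal.ofReal (gaussianProfile z / ∫ x : E, gaussianProfile x) := by
  have hI := integral_gaussianProfile_pos (E := E)
  have hnn : ∀ z : E, 0 ≤ gaussianProfile z / ∫ x : E, gaussianProfile x := fun z =>
    div_nonneg (gaussianProfile_pos z).le hI.le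
  have hmeas : Measurable fun z : E =>
      ENNReal.ofReal (gaussianProfile z / ∫ x : E, gaussianProfile x) := by
    unfold gaussianProfile
    fun_prop
  have : IsFiniteMeasure (volume.withDensity
      fun z : E => ENNReal.ofReal (gaussianProfile z / ∫ x : E, gaussianProfile x)) :=
    isFiniteMeasure_withDensity_ofReal (integrable_gaussianProfile.div_const _).2
  refine Measure.ext_of_charFun (funext fun t => ?_)
  rw [charFun_stdGaussian, charFun_apply, integral_withDensity_eq_integral_toReal_smul hmeas
    (Filter.Eventually.of_forall fun _ => ENNReal.ofReal_lt_top)]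
  have hb : (0 : ℝ) < ((1 / 2 : ℝ) : ℂ).re := by norm_num
  have h1 := GaussianFourier.integral_cexp_neg_mul_sq_norm_add (V := E) hb Complex.I t
  have h2 := GaussianFourier.integral_cexp_neg_mul_sq_norm (V := E) hb
  have e2 : ∫ z : E, Complex.exp (-((1 / 2 : ℝ) : ℂ) * (‖z‖ : ℂ) ^ 2)
      = ((∫ z : E, gaussianProfile z : ℝ) : ℂ) := by
    rw [← integral_complex_ofReal]
    refine integral_congr_ae (Filter.Eventually.of_forall fun z => ?_)
    simp only [gaussianProfile_eq]
    push_cast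
    ring_nf
  rw [e2] at h2
  rw [← h2] at h1
  have e1 : ∀ z : E, (ENNReal.ofReal (gaussianProfile z / ∫ x : E, gaussianProfile x)).toReal •
      Complex.exp ((inner ℝ z t : ℝ) * Complex.I)
      = ((∫ x : E, gaussianProfile x : ℝ) : ℂ)⁻¹ * Complex.exp (-((1 / 2 : ℝ) : ℂ) * (‖z‖ : ℂ) ^ 2
        + Complex.I * (inner ℝ t z : ℝ)) := by
    intro z
    rw [ENNReal.toReal_ofReal (hnn z), Complex.real_smul, Complex.exp_add, gaussianProfile_eq,
      real_inner_comm]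
    push_cast
    ring_nf
  simp_rw [e1]
  rw [integral_const_mul, h1, ← mul_assoc, inv_mul_cancel₀ (by exact_mod_cast hI.ne'), one_mul]
  congr 1
  rw [Complex.I_sq]
  push_cast
  ring

theorem integral_stdGaussian_eq (f : E → ℝ) : ∫ z, f z ∂(stdGaussian E)
    = (∫ z, f z * gaussianProfile z) / ∫ z : E, gaussianProfile z := by
  have hI := integral_gaussianProfile_pos (E := E)
  have hmeas : Measurable fun z : E =>
      ENNReal.ofReal (gaussianProfile z / ∫ x : E, gaussianProfile x) := by
    unfold gaussianProfile
    fun_prop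
  rw [stdGaussian_eq_withDensity, integral_withDensity_eq_integral_toReal_smul hmeas
    (Filter.Eventually.of_forall fun _ => ENNReal.ofReal_lt_top), ← integral_div]
  refine integral_congr_ae (Filter.Eventually.of_forall fun z => ?_)
  have hnn : 0 ≤ gaussianProfile z / ∫ x : E, gaussianProfile x :=
    div_nonneg (gaussianProfile_pos z).le hI.le
  simp only [ENNReal.toReal_ofReal hnn, smul_eq_mul]
  ring

theorem integrable_mul_gaussianProfile_iff {f : E → ℝ} :
    Integrable f (stdGaussian E) ↔ Integrable fun z => f z * gaussianProfile z := by
  have hI := integral_gaussianProfile_pos (E := E)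
  have hmeas : Measurable fun z : E =>
      ENNReal.ofReal (gaussianProfile z / ∫ x : E, gaussianProfile x) := by
    unfold gaussianProfile
    fun_prop
  rw [stdGaussian_eq_withDensity, integrable_withDensity_iff_integrable_smul' hmeas
    (Filter.Eventually.of_forall fun _ => ENNReal.ofReal_lt_top),
    ← integrable_const_mul_iff (f := fun z => f z * gaussianProfile z)
      (c := (∫ x : E, gaussianProfile x)⁻¹) (by simp [hI.ne'])]
  refine integrable_congr (Filter.Eventually.of_forall fun z => ?_)
  have hnn : 0 ≤ gaussianProfile z / ∫ x : E, gaussianProfile x :=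
    div_nonneg (gaussianProfile_pos z).le hI.le
  simp only [ENNReal.toReal_ofReal hnn, smul_eq_mul]
  ring

theorem integrable_stdGaussian_of_growth {f : E → ℝ} (hf : Measurable f) {K : ℝ} {n : ℕ}
    (hK : ∀ z, |f z| ≤ K * (1 + ‖z‖) ^ n) : Integrable f (stdGaussian E) := by
  rw [integrable_mul_gaussianProfile_iff]
  refine ((integrable_pow_mul_gaussianProfile (E := E) n).const_mul K).mono' ?_
    (Filter.Eventually.of_forall fun z => ?_)
  · unfold gaussianProfile
    fun_prop
  · rw [norm_mul, Real.norm_eq_abs, Real.norm_of_nonneg (gaussianProfile_pos z).le,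
      ← mul_assoc]
    exact mul_le_mul_of_nonneg_right (hK z) (gaussianProfile_pos z).le

/-! ### Comparing a density with the Gaussian density -/

/-- If an unnormalized density `F` is within `η exp (-c |z|²)` of the Gaussian profile, the averages
of functions of quadratic growth differ by `O(η)`. -/
theorem exists_abs_average_sub_le {c : ℝ} (hc : 0 < c) :
    ∃ C η₀ : ℝ, 0 < C ∧ 0 < η₀ ∧ ∀ (F f : E → ℝ) (η K : ℝ), Measurable F → Measurable f →
      η ≤ η₀ → (∀ z, |F z - gaussianProfile z| ≤ η * Real.exp (-(c * ‖z‖ ^ 2))) →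
      (∀ z, |f z| ≤ K * (1 + ‖z‖) ^ 2) →
      |(∫ z, f z * F z) / (∫ z, F z) - ∫ z, f z ∂(stdGaussian E)| ≤ C * K * η := by
  set Z := ∫ z : E, gaussianProfile z with hZ
  have hZ0 : 0 < Z := integral_gaussianProfile_pos
  set I₀ := ∫ z : E, Real.exp (-(c * ‖z‖ ^ 2)) with hI₀
  set I₂ := ∫ z : E, (1 + ‖z‖) ^ 2 * Real.exp (-(c * ‖z‖ ^ 2)) with hI₂
  set A := ∫ z : E, (1 + ‖z‖) ^ 2 ∂(stdGaussian E) with hA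
  have hI₀0 : 0 ≤ I₀ := integral_nonneg fun z => (Real.exp_pos _).le
  have hI₂0 : 0 ≤ I₂ := integral_nonneg fun z => by positivity
  have hA0 : 0 ≤ A := integral_nonneg fun z => by positivity
  have hi₀ := integrable_exp_neg_mul_sq_norm (E := E) hc
  have hi₂ := integrable_pow_mul_exp_neg_mul_sq_norm (E := E) 2 hc
  -- The threshold on η forces ∫ F ≥ Z/2, so the quotient is under control.
  refine ⟨2 * (I₂ + A * I₀) / Z + 1, Z / (2 * (I₀ + 1)), by positivity, by positivity,
    fun F f η K hF hf hη hFG hfK => ?_⟩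
  have hη0 : 0 ≤ η := by
    have := (abs_nonneg _).trans (hFG 0)
    exact nonneg_of_mul_nonneg_left this (Real.exp_pos _)
  have hK0 : 0 ≤ K := by
    have := (abs_nonneg _).trans (hfK 0)
    simpa using this
  have hGm : Measurable (gaussianProfile (E := E)) := by
    unfold gaussianProfile
    fun_prop
  set a := ∫ z, f z ∂(stdGaussian E) with ha
  have ha' : a * Z = ∫ z, f z * gaussianProfile z := by
    rw [ha, integral_stdGaussian_eq, div_mul_cancel₀ _ hZ0.ne']
  have haK : |a| ≤ K * A := by
    rw [ha, hA, ← integral_const_mul, ← Real.norm_eq_abs]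
    refine norm_integral_le_of_norm_le ?_ (Filter.Eventually.of_forall hfK)
    exact (integrable_stdGaussian_of_growth (K := 1) (n := 2) (by fun_prop) fun z => by
      rw [one_mul, abs_of_nonneg (by positivity)]).const_mul K
  have b1 : ∀ z, ‖F z - gaussianProfile z‖ ≤ η * Real.exp (-(c * ‖z‖ ^ 2)) := hFG
  have b2 : ∀ z, ‖f z * (F z - gaussianProfile z)‖
      ≤ K * η * ((1 + ‖z‖) ^ 2 * Real.exp (-(c * ‖z‖ ^ 2))) := fun z => by
    rw [norm_mul]
    calc _ ≤ (K * (1 + ‖z‖) ^ 2) * (η * Real.exp (-(c * ‖z‖ ^ 2))) := by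
          gcongr
          · exact hfK z
          · exact b1 z
      _ = _ := by ring
  have j1 : Integrable fun z => F z - gaussianProfile z :=
    (hi₀.const_mul η).mono' (by fun_prop) (Filter.Eventually.of_forall b1)
  have j2 : Integrable fun z => f z * (F z - gaussianProfile z) :=
    (hi₂.const_mul (K * η)).mono' (by fun_prop) (Filter.Eventually.of_forall b2)
  have j3 : Integrable fun z => f z * gaussianProfile z :=
    integrable_mul_gaussianProfile_iff.1 (integrable_stdGaussian_of_growth hf hfK)
  have e1 : ∫ z, F z = (∫ z, (F z - gaussianProfile z)) + Z := by
    rw [hZ, ← integral_add j1 integrable_gaussianProfile]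
    simp
  have e2 : ∫ z, f z * F z = (∫ z, f z * (F z - gaussianProfile z)) + a * Z := by
    rw [ha', ← integral_add j2 j3]
    refine integral_congr_ae (Filter.Eventually.of_forall fun z => ?_)
    simp only
    ring
  have n1 : |∫ z, (F z - gaussianProfile z)| ≤ η * I₀ := by
    rw [hI₀, ← integral_const_mul]
    exact norm_integral_le_of_norm_le (hi₀.const_mul η) (Filter.Eventually.of_forall b1)
  have n2 : |∫ z, f z * (F z - gaussianProfile z)| ≤ K * η * I₂ := by
    rw [hI₂, ← integral_const_mul]
    exact norm_integral_le_of_norm_le (hi₂.const_mul (K * η)) (Filter.Eventually.of_forall b2)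
  have hFpos : Z / 2 ≤ ∫ z, F z := by
    have h1 : η * I₀ ≤ Z / 2 := by
      calc η * I₀ ≤ Z / (2 * (I₀ + 1)) * (I₀ + 1) := by gcongr; linarith
        _ = Z / 2 := by field_simp
    have := (abs_le.1 n1).1
    linarith
  have hFpos' : 0 < ∫ z, F z := by linarith
  -- Subtracting the Gaussian mean a leaves only integrals against F minus the profile in the
  -- numerator.
  have e3 : (∫ z, f z * F z) / (∫ z, F z) - a
      = ((∫ z, f z * (F z - gaussianProfile z)) - a * ∫ z, (F z - gaussianProfile z))
        / ∫ z, F z := by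
    rw [div_sub' hFpos'.ne', e2]
    congr 1
    rw [e1]
    ring
  have n3 : |(∫ z, f z * (F z - gaussianProfile z)) - a * ∫ z, (F z - gaussianProfile z)|
      ≤ K * η * (I₂ + A * I₀) := by
    refine (abs_sub _ _).trans ?_
    rw [abs_mul]
    calc _ ≤ K * η * I₂ + K * A * (η * I₀) := by gcongr
      _ = _ := by ring
  rw [e3, abs_div, abs_of_pos hFpos', div_le_iff₀ hFpos']
  refine n3.trans ?_
  calc K * η * (I₂ + A * I₀) = 2 * (I₂ + A * I₀) / Z * K * η * (Z / 2) := by field_simp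
    _ ≤ (2 * (I₂ + A * I₀) / Z + 1) * K * η * ∫ z, F z := by
      gcongr
      linarith

end

section

variable {p d : ℕ} {β h : ℝ} {m : Fin (d + 1) → ℝ}
  {L : EuclideanSpace ℝ (Fin d) →L[ℝ] EuclideanSpace ℝ (Fin (d + 1))}
  {R : EuclideanSpace ℝ (Fin (d + 1)) →L[ℝ] EuclideanSpace ℝ (Fin d)}

/-! ### Gaussian approximation in standard coordinates -/

/-- Averages of functions of quadratic growth under the Curie-Weiss Potts measure, in standard
coordinates, agree with Gaussian averages up to `O(N^{-1/2})` and the oscillation of the function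
at the scale `N^{-1/2}`. -/
theorem exists_abs_expectW_sub_gaussian_le (hp : 2 ≤ p) (hm : IsUniqueMaximizer p β h m)
    (hpos : ∀ r, 0 < m r) (hLR : IsStandardChart p β m L R) :
    ∃ (B C : ℝ) (N₀ : ℕ), 0 < B ∧ 0 < C ∧ ∀ N : ℕ, N ≠ 0 → N₀ ≤ N →
      ∀ (f ω : EuclideanSpace ℝ (Fin d) → ℝ) (K : ℝ), Measurable f →
      (∀ z, |f z| ≤ K * (1 + ‖z‖) ^ 2) →
      Integrable ω (stdGaussian (EuclideanSpace ℝ (Fin d))) → (∀ z, 0 ≤ ω z) →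
      (∀ z z', ‖z' - z‖ ≤ B / √(N : ℝ) → |f z' - f z| ≤ ω z) →
      |expectW p (d + 1) β h m N (fun x => f (R x))
        - ∫ z, f z ∂(stdGaussian (EuclideanSpace ℝ (Fin d)))|
        ≤ ∫ z, ω z ∂(stdGaussian (EuclideanSpace ℝ (Fin d))) + C * K / √(N : ℝ) := by
  obtain ⟨B, hB, hBz⟩ := hLR.norm_deviation_le hm.1.2
  obtain ⟨C₁, c, hC₁, hc, H₁⟩ := exists_smearedWeight_sub_gaussian_le (h := h) hp hm hpos hLR
  obtain ⟨C₂, η₀, hC₂, hη₀, H₂⟩ :=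
    exists_abs_average_sub_le (E := EuclideanSpace ℝ (Fin d)) hc
  obtain ⟨δ, hδ, Hδ⟩ := hLR.exists_mem_cell hm.1.2 hpos
  obtain ⟨C₃, hC₃, H₃⟩ := exists_gaussian_le_of_far 1 δ zero_le_one hδ
  set Z := ∫ z : EuclideanSpace ℝ (Fin d), gaussianProfile z with hZ
  have hZ0 : 0 < Z := integral_gaussianProfile_pos
  set I := ∫ z : EuclideanSpace ℝ (Fin d), (1 + ‖z‖) ^ 2 * Real.exp (-(1 / 4 * ‖z‖ ^ 2)) with hI
  have hI0 : 0 ≤ I := integral_nonneg fun z => by positivity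
  have hi := integrable_pow_mul_exp_neg_mul_sq_norm (E := EuclideanSpace ℝ (Fin d)) 2
    (show (0 : ℝ) < 1 / 4 by norm_num)
  refine ⟨B, C₂ * (2 * B) ^ 2 * C₁ + C₃ * I / Z, ⌈(C₁ / η₀) ^ 2⌉₊, by linarith, by positivity,
    fun N hN hN₀ f ω K hf hfK hω hω0 hosc => ?_⟩
  have hN0 : (0 : ℝ) < N := by positivity
  have hs : 0 < √(N : ℝ) := by positivity
  have hK0 : 0 ≤ K := by
    have := (abs_nonneg _).trans (hfK 0)
    simpa using this
  set f' := spread m L R N fun k => f (latticePoint m R N k) with hf'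
  have hf'm : Measurable f' := measurable_spread N _
  have hFm : Measurable (smearedWeight p β h m L R N) := measurable_spread N _
  have hη : C₁ / √(N : ℝ) ≤ η₀ := by
    rw [div_le_iff₀ hs, ← div_le_iff₀' hη₀]
    refine Real.le_sqrt_of_sq_le ?_
    exact (Nat.le_ceil _).trans (by exact_mod_cast hN₀)
  -- Either f' evaluates f at a lattice point within B/√N of z, where ω controls the change, or z is
  -- so far out that the Gaussian profile is already O(1/√N).
  have hcase : ∀ z : EuclideanSpace ℝ (Fin d),
      (∃ z', ‖z' - z‖ ≤ B / √(N : ℝ) ∧ ‖z'‖ ≤ B * (1 + ‖z‖) ∧ f' z = f z') ∨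
      (f' z = 0 ∧ gaussianProfile z ≤ C₃ / √(N : ℝ) * Real.exp (-(1 / 4 * ‖z‖ ^ 2))) := by
    intro z
    by_cases hex : ∃ k : Fin (d + 1) → ℕ, ∑ r, k r = N ∧ z - latticePoint m R N k ∈ cell L N
    · obtain ⟨k, hk, hz⟩ := hex
      obtain ⟨z1, -, z3, -⟩ := hBz N k z hN hk hz
      refine Or.inl ⟨latticePoint m R N k, by rwa [norm_sub_rev], z3, ?_⟩
      exact hLR.sum_indicator_cell hm.1.2 hN _ hk hz
    · refine Or.inr ⟨spread_eq_zero hex, H₃ _ _ hs (norm_nonneg z) ?_⟩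
      by_contra! hcon
      exact hex (Hδ N hN z (by linarith))
  have hf'K : ∀ z, |f' z| ≤ K * (2 * B) ^ 2 * (1 + ‖z‖) ^ 2 := by
    intro z
    have hz0 := norm_nonneg z
    rcases hcase z with ⟨z', -, h2, h3⟩ | ⟨h1, -⟩
    · rw [h3, mul_assoc, ← mul_pow]
      refine (hfK z').trans ?_
      gcongr
      nlinarith
    · rw [h1, abs_zero]
      positivity
  -- The density comparison is applied to f', since the expectation is exactly the average of f'
  -- against the smeared weight; f' is compared with f afterwards.
  have a1 := H₂ (smearedWeight p β h m L R N) f' (C₁ / √(N : ℝ)) (K * (2 * B) ^ 2) hFm hf'm hη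
    (fun z => H₁ N z hN) hf'K
  rw [← hLR.expectW_eq_integral_div hm.1.2 hN f] at a1
  have j1 := integrable_stdGaussian_of_growth hf hfK
  have j2 := integrable_stdGaussian_of_growth hf'm hf'K
  have a2 : |∫ z, f' z ∂(stdGaussian (EuclideanSpace ℝ (Fin d)))
      - ∫ z, f z ∂(stdGaussian (EuclideanSpace ℝ (Fin d)))|
      ≤ ∫ z, ω z ∂(stdGaussian (EuclideanSpace ℝ (Fin d))) + C₃ * I / Z * K / √(N : ℝ) := by
    rw [← integral_sub j2 j1, integral_stdGaussian_eq, integral_stdGaussian_eq ω, abs_div,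
      abs_of_pos integral_gaussianProfile_pos, ← hZ]
    have hb : ∀ z, ‖(f' z - f z) * gaussianProfile z‖ ≤ ω z * gaussianProfile z
        + K * (C₃ / √(N : ℝ)) * ((1 + ‖z‖) ^ 2 * Real.exp (-(1 / 4 * ‖z‖ ^ 2))) := by
      intro z
      have hg := gaussianProfile_pos z
      rw [norm_mul, Real.norm_of_nonneg hg.le, Real.norm_eq_abs]
      rcases hcase z with ⟨z', h1, -, h3⟩ | ⟨h1, h2⟩
      · rw [h3]
        have := mul_le_mul_of_nonneg_right (hosc z z' h1) hg.le
        have h4 : 0 ≤ K * (C₃ / √(N : ℝ)) * ((1 + ‖z‖) ^ 2 * Real.exp (-(1 / 4 * ‖z‖ ^ 2))) := by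
          positivity
        linarith
      · rw [h1, zero_sub, abs_neg]
        have h3 : |f z| * gaussianProfile z ≤ (K * (1 + ‖z‖) ^ 2) *
            (C₃ / √(N : ℝ) * Real.exp (-(1 / 4 * ‖z‖ ^ 2))) := by
          gcongr
          exact hfK z
        have h4 := mul_nonneg (hω0 z) hg.le
        linarith
    have hint := integrable_mul_gaussianProfile_iff.1 hω
    have := norm_integral_le_of_norm_le (hint.add (hi.const_mul (K * (C₃ / √(N : ℝ)))))
      (Filter.Eventually.of_forall hb)
    rw [Real.norm_eq_abs] at this
    simp only [Pi.add_apply] at this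
    rw [integral_add hint (hi.const_mul _), integral_const_mul, ← hI] at this
    refine (div_le_div_of_nonneg_right this hZ0.le).trans_eq ?_
    rw [add_div]
    ring
  have e : (C₂ * (2 * B) ^ 2 * C₁ + C₃ * I / Z) * K / √(N : ℝ)
      = C₂ * (K * (2 * B) ^ 2) * (C₁ / √(N : ℝ)) + C₃ * I / Z * K / √(N : ℝ) := by ring
  rw [e]
  have := abs_sub_le (expectW p (d + 1) β h m N fun x => f (R x))
    (∫ z, f' z ∂(stdGaussian (EuclideanSpace ℝ (Fin d))))
    (∫ z, f z ∂(stdGaussian (EuclideanSpace ℝ (Fin d))))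
  linarith

end

/-! ### Gaussian measures with covariance close to the identity -/

theorem norm_toEuclideanCLM_sqrt_sq {ι : Type*} [Fintype ι] [DecidableEq ι] {S : Matrix ι ι ℝ}
    (hS : S.PosSemidef) (y : EuclideanSpace ℝ ι) :
    ‖Matrix.toEuclideanCLM (𝕜 := ℝ) (CFC.sqrt S) y‖ ^ 2 = y.ofLp ⬝ᵥ S.mulVec y.ofLp := by
  have hsa : IsSelfAdjoint (Matrix.toEuclideanCLM (𝕜 := ℝ) (CFC.sqrt S)) :=
    (CFC.sqrt_nonneg S).isSelfAdjoint.map _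
  rw [← real_inner_self_eq_norm_sq, ← ContinuousLinearMap.adjoint_inner_right, hsa.adjoint_eq,
    ← ContinuousLinearMap.comp_apply, ← ContinuousLinearMap.mul_def, ← map_mul,
    CFC.sqrt_mul_sqrt_self _ hS.nonneg, Matrix.inner_toEuclideanCLM]

theorem abs_dotProduct_mulVec_sub_le {ι : Type*} [Fintype ι] [DecidableEq ι] {S : Matrix ι ι ℝ}
    {ε : ℝ} (hS : ∀ i j, |S i j - (1 : Matrix ι ι ℝ) i j| ≤ ε) (y : EuclideanSpace ℝ ι) :
    |y.ofLp ⬝ᵥ S.mulVec y.ofLp - ‖y‖ ^ 2| ≤ Fintype.card ι ^ 2 * ε * ‖y‖ ^ 2 := by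
  have h1 : y.ofLp ⬝ᵥ S.mulVec y.ofLp - ‖y‖ ^ 2
      = ∑ i, ∑ j, y i * ((S i j - (1 : Matrix ι ι ℝ) i j) * y j) := by
    have : ‖y‖ ^ 2 = y.ofLp ⬝ᵥ (1 : Matrix ι ι ℝ).mulVec y.ofLp := by
      rw [Matrix.one_mulVec, EuclideanSpace.real_norm_sq_eq]
      simp [dotProduct, sq]
    rw [this, ← dotProduct_sub, ← Matrix.sub_mulVec]
    simp only [dotProduct, Matrix.mulVec, Finset.mul_sum, Matrix.sub_apply]
  rw [h1]
  refine (Finset.abs_sum_le_sum_abs _ _).trans ((Finset.sum_le_sum fun i _ =>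
    (Finset.abs_sum_le_sum_abs _ _).trans (Finset.sum_le_sum fun j _ => ?_)).trans_eq
    (b := ∑ i : ι, ∑ j : ι, ‖y‖ * (ε * ‖y‖)) ?_)
  · rw [abs_mul, abs_mul]
    have h2 := abs_apply_le_norm y i
    have h3 := abs_apply_le_norm y j
    have h4 := hS i j
    have h5 : 0 ≤ ε := (abs_nonneg _).trans h4
    gcongr
  · simp
    ring

/-- For S near the identity, A = √S is invertible and the law of A z has density proportional to the
Gaussian profile at A⁻¹ z, which is within O(ε) exp(-‖z‖²/8) of the profile itself. Comparing
densities rather than values of f avoids any regularity of f. -/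
theorem exists_abs_expectGaussian_sub_le (d : ℕ) :
    ∃ C ε₀ : ℝ, 0 < C ∧ 0 < ε₀ ∧ ∀ (S : Matrix (Fin d) (Fin d) ℝ) (ε K : ℝ)
      (f : EuclideanSpace ℝ (Fin d) → ℝ), S.PosSemidef → 0 ≤ ε → ε ≤ ε₀ →
      (∀ i j, |S i j - (1 : Matrix (Fin d) (Fin d) ℝ) i j| ≤ ε) → Measurable f →
      (∀ z, |f z| ≤ K * (1 + ‖z‖) ^ 2) →
      |expectGaussian S f - ∫ z, f z ∂(stdGaussian (EuclideanSpace ℝ (Fin d)))| ≤ C * K * ε := by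
  obtain ⟨C₁, η₀, hC₁, hη₀, H₁⟩ := exists_abs_average_sub_le
    (E := EuclideanSpace ℝ (Fin d)) (show (0 : ℝ) < 1 / 8 by norm_num)
  obtain ⟨C₂, hC₂, H₂⟩ := exists_pow_le_mul_exp 2 (show (0 : ℝ) < 1 / 8 by norm_num)
  refine ⟨C₁ * ((d ^ 2 + 1) * C₂), min (1 / (2 * (d ^ 2 + 1))) (η₀ / ((d ^ 2 + 1) * C₂)),
    by positivity, by positivity, fun S ε K f hS hε hεε hSε hf hfK => ?_⟩
  set A := Matrix.toEuclideanCLM (𝕜 := ℝ) (CFC.sqrt S) with hA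
  set ε₁ := (d ^ 2 + 1) * ε with hε₁
  have hε₁0 : 0 ≤ ε₁ := by positivity
  have hε₁2 : ε₁ ≤ 1 / 2 := by
    have := hεε.trans (min_le_left _ _)
    rw [le_div_iff₀ (by positivity)] at this
    rw [hε₁]
    linarith
  have hη : ε₁ * C₂ ≤ η₀ := by
    have := hεε.trans (min_le_right _ _)
    rw [le_div_iff₀ (by positivity)] at this
    rw [hε₁]
    linarith
  have hAy : ∀ y, |‖A y‖ ^ 2 - ‖y‖ ^ 2| ≤ ε₁ * ‖y‖ ^ 2 := fun y => by
    rw [hA, norm_toEuclideanCLM_sqrt_sq hS]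
    refine (abs_dotProduct_mulVec_sub_le hSε y).trans ?_
    rw [Fintype.card_fin, hε₁]
    gcongr
    linarith
  have hinj : Function.Injective (A : EuclideanSpace ℝ (Fin d) →ₗ[ℝ] EuclideanSpace ℝ (Fin d)) := by
    rw [← LinearMap.ker_eq_bot, LinearMap.ker_eq_bot']
    intro y hy
    have h1 := hAy y
    have h2 : A y = 0 := hy
    rw [h2, norm_zero, zero_pow two_ne_zero, zero_sub, abs_neg, abs_of_nonneg (by positivity)] at h1
    have h3 : ‖y‖ ^ 2 ≤ 1 / 2 * ‖y‖ ^ 2 := h1.trans (by gcongr)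
    have h4 : ‖y‖ ^ 2 = 0 := by nlinarith [sq_nonneg ‖y‖]
    simpa using h4
  let e := (LinearEquiv.ofInjectiveEndo _ hinj).toContinuousLinearEquiv
  have heA : ∀ y, e y = A y := fun y => rfl
  have hdet : LinearMap.det (A : EuclideanSpace ℝ (Fin d) →ₗ[ℝ] EuclideanSpace ℝ (Fin d)) ≠ 0 :=
    (LinearEquiv.isUnit_det' (LinearEquiv.ofInjectiveEndo _ hinj)).ne_zero
  let F : EuclideanSpace ℝ (Fin d) → ℝ := fun z => gaussianProfile (e.symm z)
  have hFm : Measurable F := by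
    have h1 : Measurable (gaussianProfile (E := EuclideanSpace ℝ (Fin d))) := by
      unfold gaussianProfile
      fun_prop
    exact h1.comp e.symm.continuous.measurable
  have hF : ∀ z, |F z - gaussianProfile z| ≤ (ε₁ * C₂) * Real.exp (-(1 / 8 * ‖z‖ ^ 2)) := by
    intro z
    have h1 := hAy (e.symm z)
    rw [← heA, e.apply_symm_apply, abs_le] at h1
    set w := e.symm z with hw
    -- Since ε₁ ≤ 1/2, the squared norms of w and z = A w are comparable, and both exponents lie
    -- below -‖z‖²/4.
    have h2 : ε₁ * ‖w‖ ^ 2 ≤ 1 / 2 * ‖w‖ ^ 2 := by gcongr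
    have h3 := abs_exp_sub_exp_le (a := -‖w‖ ^ 2 / 2) (b := -‖z‖ ^ 2 / 2) (M := -(1 / 4 * ‖z‖ ^ 2))
      (by nlinarith) (by nlinarith [sq_nonneg ‖z‖])
    have h4 : |-‖w‖ ^ 2 / 2 - -‖z‖ ^ 2 / 2| ≤ ε₁ * (1 + ‖z‖) ^ 2 := by
      have h5 : ‖w‖ ^ 2 ≤ 2 * ‖z‖ ^ 2 := by linarith
      have h6 : ‖z‖ ^ 2 ≤ (1 + ‖z‖) ^ 2 := by nlinarith [norm_nonneg z]
      have h7 : ε₁ * ‖w‖ ^ 2 ≤ ε₁ * (2 * (1 + ‖z‖) ^ 2) := by gcongr; linarith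
      rw [abs_le]
      constructor <;> linarith
    have e1 : Real.exp (-(1 / 4 * ‖z‖ ^ 2))
        = Real.exp (-(1 / 8 * ‖z‖ ^ 2)) * Real.exp (-(1 / 8 * ‖z‖ ^ 2)) := by
      rw [← Real.exp_add]; ring_nf
    have e2 : Real.exp (1 / 8 * ‖z‖ ^ 2) * Real.exp (-(1 / 8 * ‖z‖ ^ 2)) = 1 := by
      rw [← Real.exp_add, add_neg_cancel, Real.exp_zero]
    refine h3.trans ?_
    calc _ ≤ ε₁ * (C₂ * Real.exp (1 / 8 * ‖z‖ ^ 2)) * Real.exp (-(1 / 4 * ‖z‖ ^ 2)) := by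
          gcongr
          exact h4.trans (by gcongr; exact H₂ _ (norm_nonneg z))
      _ = ε₁ * C₂ * Real.exp (-(1 / 8 * ‖z‖ ^ 2))
          * (Real.exp (1 / 8 * ‖z‖ ^ 2) * Real.exp (-(1 / 8 * ‖z‖ ^ 2))) := by rw [e1]; ring
      _ = _ := by rw [e2, mul_one]
  set c := (ENNReal.ofReal |(LinearMap.det
    (A : EuclideanSpace ℝ (Fin d) →ₗ[ℝ] EuclideanSpace ℝ (Fin d)))⁻¹|).toReal with hc
  have hc0 : c ≠ 0 := by
    rw [hc, ENNReal.toReal_ofReal (abs_nonneg _)]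
    exact abs_ne_zero.2 (inv_ne_zero hdet)
  have hcv : ∀ g : EuclideanSpace ℝ (Fin d) → ℝ, ∫ z, g (A z) = c * ∫ z, g z := by
    intro g
    have h1 := Measure.map_linearMap_addHaar_eq_smul_addHaar
      (volume : Measure (EuclideanSpace ℝ (Fin d))) hdet
    have h2 := e.toHomeomorph.measurableEmbedding.integral_map (μ := volume) g
    have h3 : Measure.map e.toHomeomorph volume = Measure.map
      (A : EuclideanSpace ℝ (Fin d) →ₗ[ℝ] EuclideanSpace ℝ (Fin d)) volume := rfl
    rw [h3, h1, integral_smul_measure] at h2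
    exact h2.symm
  -- The Jacobian factor c appears in numerator and denominator and cancels.
  have e3 : expectGaussian S f = (∫ z, f z * F z) / ∫ z, F z := by
    have h1 := hcv fun z => f z * F z
    have h2 := hcv F
    have h3 : ∀ z, F (A z) = gaussianProfile z := fun z => by
      simp only [F, ← heA, e.symm_apply_apply]
    simp only [h3] at h1 h2
    rw [expectGaussian, integral_stdGaussian_eq, h1, h2, mul_div_mul_left _ _ hc0]
  rw [e3]
  refine (H₁ F f (ε₁ * C₂) K hFm hf hη hF hfK).trans_eq ?_
  rw [hε₁]
  ring

/-! ### Covariance matrices -/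

theorem dotProduct_covariance_mulVec {Ω ι : Type*} [MeasurableSpace Ω] [DiscreteMeasurableSpace Ω]
    [Finite Ω] [Fintype ι] {μ : Measure Ω} [IsProbabilityMeasure μ] (Y : ι → Ω → ℝ) (x : ι → ℝ) :
    x ⬝ᵥ (Matrix.of fun i j => cov[Y i, Y j; μ]).mulVec x = Var[fun ω => ∑ i, x i * Y i ω; μ] := by
  rw [← covariance_self (measurable_of_finite _).aemeasurable,
    covariance_fun_sum_fun_sum (fun _ => MemLp.of_discrete) fun _ => MemLp.of_discrete]
  simp only [dotProduct, Matrix.mulVec, Matrix.of_apply, Finset.mul_sum]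
  refine Finset.sum_congr rfl fun i _ => Finset.sum_congr rfl fun j _ => ?_
  rw [covariance_const_mul_left, covariance_const_mul_right]
  ring

theorem posSemidef_covariance {Ω ι : Type*} [MeasurableSpace Ω] [DiscreteMeasurableSpace Ω]
    [Finite Ω] [Fintype ι] {μ : Measure Ω} [IsProbabilityMeasure μ] (Y : ι → Ω → ℝ) :
    (Matrix.of fun i j => cov[Y i, Y j; μ]).PosSemidef := by
  refine Matrix.PosSemidef.of_dotProduct_mulVec_nonneg ?_ fun x => ?_
  · ext i j
    simp [Matrix.conjTranspose_apply, covariance_comm]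
  · rw [star_trivial, dotProduct_covariance_mulVec]
    exact variance_nonneg _ _

theorem charFun_map_continuousLinearMap {E F : Type*} [NormedAddCommGroup E]
    [InnerProductSpace ℝ E] [CompleteSpace E] [MeasurableSpace E] [BorelSpace E]
    [NormedAddCommGroup F] [InnerProductSpace ℝ F] [CompleteSpace F] [MeasurableSpace F]
    [BorelSpace F] [SecondCountableTopology F] (μ : Measure E) (A : E →L[ℝ] F) (t : F) :
    charFun (μ.map A) t = charFun μ (ContinuousLinearMap.adjoint A t) := by
  rw [charFun_apply, charFun_apply, integral_map A.continuous.aemeasurable (by fun_prop)]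
  simp_rw [ContinuousLinearMap.adjoint_inner_right]

theorem expectGaussian_eq_integral {q : ℕ} (S : Matrix (Fin q) (Fin q) ℝ)
    {g : EuclideanSpace ℝ (Fin q) → ℝ} (hg : Measurable g) :
    expectGaussian S g = ∫ x, g x ∂(multivariateGaussian 0 S) := by
  rw [expectGaussian, multivariateGaussian, integral_map (by fun_prop) hg.aestronglyMeasurable]
  simp

/-- Gaussian averages with covariance `S` are Gaussian averages with covariance `T`, transported
by a linear map `A` for which `S = A T Aᵀ`. -/
theorem expectGaussian_eq_of_quadratic_eq {q d : ℕ} {S : Matrix (Fin q) (Fin q) ℝ}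
    {T : Matrix (Fin d) (Fin d) ℝ} (hS : S.PosSemidef) (hT : T.PosSemidef)
    (A : EuclideanSpace ℝ (Fin d) →L[ℝ] EuclideanSpace ℝ (Fin q))
    (hST : ∀ x : EuclideanSpace ℝ (Fin q), x.ofLp ⬝ᵥ S.mulVec x.ofLp
      = (ContinuousLinearMap.adjoint A x).ofLp ⬝ᵥ
        T.mulVec (ContinuousLinearMap.adjoint A x).ofLp)
    {g : EuclideanSpace ℝ (Fin q) → ℝ} (hg : Measurable g) :
    expectGaussian S g = expectGaussian T fun z => g (A z) := by
  have hmap : multivariateGaussian 0 S = (multivariateGaussian 0 T).map A := by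
    have : IsFiniteMeasure ((multivariateGaussian 0 T).map A) := inferInstance
    refine Measure.ext_of_charFun (funext fun x => ?_)
    rw [charFun_map_continuousLinearMap, charFun_multivariateGaussian hS,
      charFun_multivariateGaussian hT, hST]
    simp
  rw [expectGaussian_eq_integral S hg,
    expectGaussian_eq_integral T (g := fun z => g (A z)) (hg.comp A.continuous.measurable), hmap,
    integral_map A.continuous.aemeasurable hg.aestronglyMeasurable]

section

variable {p d : ℕ} {β h : ℝ} {m : Fin (d + 1) → ℝ}
  {L : EuclideanSpace ℝ (Fin d) →L[ℝ] EuclideanSpace ℝ (Fin (d + 1))}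
  {R : EuclideanSpace ℝ (Fin (d + 1)) →L[ℝ] EuclideanSpace ℝ (Fin d)}

/-- The covariance matrix of `W_N` in standard coordinates. -/
noncomputable def chartCovMatrix (p : ℕ) (β h : ℝ) (m : Fin (d + 1) → ℝ)
    (R : EuclideanSpace ℝ (Fin (d + 1)) →L[ℝ] EuclideanSpace ℝ (Fin d)) (N : ℕ) :
    Matrix (Fin d) (Fin d) ℝ :=
  Matrix.of fun i j =>
    cov[fun X => R (W m X) i, fun X => R (W m X) j; gibbsMeasure p (d + 1) β h N]

theorem IsStandardChart.map_W (hLR : IsStandardChart p β m L R) (hm : ∑ r, m r = 1) {N : ℕ}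
    (hN : N ≠ 0) (X : Fin N → Fin (d + 1)) : L (R (W m X)) = W m X := by
  rw [W_eq_deviation]
  exact hLR.map_latticePoint hm hN (sum_colorCount X)

/-- Since L (R W) = W, the variance of ⟨x, W⟩ equals that of ⟨L* x, R W⟩, so Σ is the chart
covariance transported by L. This replaces the singular matrix Σ by one that is close to the
identity. -/
theorem IsStandardChart.expectGaussian_covMatrix (hLR : IsStandardChart p β m L R)
    (hm : ∑ r, m r = 1) {N : ℕ} (hN : N ≠ 0) {g : EuclideanSpace ℝ (Fin (d + 1)) → ℝ}
    (hg : Measurable g) : expectGaussian (covMatrix p (d + 1) β h m N) g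
      = expectGaussian (chartCovMatrix p β h m R N) fun z => g (L z) := by
  refine expectGaussian_eq_of_quadratic_eq
    (posSemidef_covariance fun r (X : Fin N → Fin (d + 1)) => W m X r)
    (posSemidef_covariance fun i (X : Fin N → Fin (d + 1)) => R (W m X) i) L (fun x => ?_) hg
  have h1 := dotProduct_covariance_mulVec (μ := gibbsMeasure p (d + 1) β h N)
    (fun r (X : Fin N → Fin (d + 1)) => W m X r) x.ofLp
  have h2 := dotProduct_covariance_mulVec (μ := gibbsMeasure p (d + 1) β h N)
    (fun i (X : Fin N → Fin (d + 1)) => R (W m X) i) (ContinuousLinearMap.adjoint L x).ofLp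
  refine h1.trans (Eq.trans ?_ h2.symm)
  congr 1
  funext X
  have e1 : ∑ r, x r * W m X r = inner ℝ x (W m X) := by
    simp [PiLp.inner_apply, mul_comm]
  have e2 : ∑ i, ContinuousLinearMap.adjoint L x i * R (W m X) i
      = inner ℝ (ContinuousLinearMap.adjoint L x) (R (W m X)) := by
    simp [PiLp.inner_apply, mul_comm]
  rw [e1, e2, ContinuousLinearMap.adjoint_inner_left, hLR.map_W hm hN]

theorem integral_mul_stdGaussian (i j : Fin d) :
    ∫ z, z i * z j ∂(stdGaussian (EuclideanSpace ℝ (Fin d))) = (1 : Matrix (Fin d) (Fin d) ℝ) i j ∧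
      ∫ z, z i ∂(stdGaussian (EuclideanSpace ℝ (Fin d))) = 0 := by
  have h0 : ∀ i, ∫ z, z i ∂(stdGaussian (EuclideanSpace ℝ (Fin d))) = 0 := fun i =>
    integral_strongDual_stdGaussian (EuclideanSpace.proj (𝕜 := ℝ) i)
  have hL : ∀ i : Fin d, MemLp (fun z : EuclideanSpace ℝ (Fin d) => z i) 2
      (stdGaussian (EuclideanSpace ℝ (Fin d))) := fun i =>
    IsGaussian.memLp_dual _ (EuclideanSpace.proj (𝕜 := ℝ) i) 2 (by norm_num)
  refine ⟨?_, h0 i⟩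
  have h1 := covariance_eval_multivariateGaussian (μ := 0) (Matrix.PosSemidef.one
    (n := Fin d) (R := ℝ)) i j
  rw [multivariateGaussian_zero_one, covariance_eq_sub (hL i) (hL j), h0 i, zero_mul, sub_zero]
    at h1
  exact h1

/-- The comparison theorem is applied to z_i z_j and to z_i; allowing quadratic growth there serves
this purpose. The product of the means is even O(1/N), but O(1/√N) suffices. -/
theorem exists_abs_chartCovMatrix_sub_le (hp : 2 ≤ p) (hm : IsUniqueMaximizer p β h m)
    (hpos : ∀ r, 0 < m r) (hLR : IsStandardChart p β m L R) :
    ∃ (C : ℝ) (N₀ : ℕ), 0 < C ∧ ∀ N : ℕ, N ≠ 0 → N₀ ≤ N → ∀ i j,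
      |chartCovMatrix p β h m R N i j - (1 : Matrix (Fin d) (Fin d) ℝ) i j| ≤ C / √(N : ℝ) := by
  obtain ⟨B, C, N₀, hB, hC, H⟩ := exists_abs_expectW_sub_gaussian_le (h := h) hp hm hpos hLR
  set J := ∫ z, (2 * ‖z‖ + B) ∂(stdGaussian (EuclideanSpace ℝ (Fin d))) with hJ
  have hJ0 : 0 ≤ J := integral_nonneg fun z => by positivity
  have hJi : Integrable (fun z => 2 * ‖z‖ + B) (stdGaussian (EuclideanSpace ℝ (Fin d))) :=
    integrable_stdGaussian_of_growth (K := 2 + B) (n := 1) (by fun_prop) fun z => by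
      rw [abs_of_nonneg (by positivity), pow_one]
      nlinarith [norm_nonneg z]
  refine ⟨(B * J + C) + (B + C) ^ 2, N₀, by positivity, fun N hN hN₀ i j => ?_⟩
  have hN0 : (0 : ℝ) < N := by positivity
  have hs : 0 < √(N : ℝ) := by positivity
  have hs1 : 1 ≤ √(N : ℝ) := by
    rw [Real.one_le_sqrt]; exact_mod_cast Nat.one_le_iff_ne_zero.2 hN
  have c1 := H N hN hN₀ (fun z => z i * z j) (fun z => B / √(N : ℝ) * (2 * ‖z‖ + B)) 1
    (by fun_prop) (fun z => by
      have h1 := abs_apply_le_norm z i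
      have h2 := abs_apply_le_norm z j
      rw [abs_mul, one_mul]
      calc _ ≤ ‖z‖ * ‖z‖ := by gcongr
        _ ≤ _ := by nlinarith [norm_nonneg z]) (hJi.const_mul _) (fun z => by positivity)
    (fun z z' hz => by
      have h1 := (abs_apply_le_norm (z' - z) i).trans hz
      have h2 := (abs_apply_le_norm (z' - z) j).trans hz
      have h3 := abs_apply_le_norm z i
      have h4 := abs_apply_le_norm z j
      rw [PiLp.sub_apply] at h1 h2
      have h5 : B / √(N : ℝ) ≤ B := div_le_self hB.le hs1
      have e : z' i * z' j - z i * z j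
        = (z' i - z i) * (z' j - z j) + (z' i - z i) * z j + z i * (z' j - z j) := by ring
      have k1 : |(z' i - z i) * (z' j - z j)| ≤ B / √(N : ℝ) * B := by
        rw [abs_mul]
        exact mul_le_mul h1 (h2.trans h5) (abs_nonneg _) (by positivity)
      have k2 : |(z' i - z i) * z j| ≤ B / √(N : ℝ) * ‖z‖ := by
        rw [abs_mul]
        exact mul_le_mul h1 h4 (abs_nonneg _) (by positivity)
      have k3 : |z i * (z' j - z j)| ≤ ‖z‖ * (B / √(N : ℝ)) := by
        rw [abs_mul]
        exact mul_le_mul h3 h2 (abs_nonneg _) (by positivity)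
      rw [e]
      refine (abs_add_three _ _ _).trans ?_
      linarith)
  have c2 : ∀ i : Fin d, |expectW p (d + 1) β h m N fun x => R x i| ≤ (B + C) / √(N : ℝ) := by
    intro i
    have := H N hN hN₀ (fun z => z i) (fun _ => B / √(N : ℝ)) 1 (by fun_prop) (fun z => by
      have h1 := abs_apply_le_norm z i
      nlinarith [norm_nonneg z]) (integrable_const _) (fun z => by positivity)
      (fun z z' hz => (abs_apply_le_norm (z' - z) i).trans hz)
    rw [(integral_mul_stdGaussian i i).2, sub_zero] at this
    refine this.trans_eq ?_
    simp
    ring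
  rw [(integral_mul_stdGaussian i j).1, integral_const_mul, ← hJ] at c1
  have e1 : chartCovMatrix p β h m R N i j = expectW p (d + 1) β h m N (fun x => R x i * R x j)
      - expectW p (d + 1) β h m N (fun x => R x i) * expectW p (d + 1) β h m N fun x => R x j := by
    rw [chartCovMatrix, Matrix.of_apply, covariance_eq_sub MemLp.of_discrete MemLp.of_discrete]
    rfl
  have c3 : |expectW p (d + 1) β h m N (fun x => R x i) * expectW p (d + 1) β h m N fun x => R x j|
      ≤ (B + C) ^ 2 / √(N : ℝ) := by
    rw [abs_mul]
    calc _ ≤ (B + C) / √(N : ℝ) * (B + C) :=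
          mul_le_mul (c2 i) ((c2 j).trans (div_le_self (by positivity) hs1)) (abs_nonneg _)
            (by positivity)
      _ = _ := by ring
  rw [e1, sub_right_comm]
  refine (abs_sub _ _).trans ((add_le_add c1 c3).trans_eq ?_)
  ring

/-- The Gaussian approximation of `W_N` with the exact covariance matrix. -/
theorem exists_abs_expectW_sub_expectGaussian_le (hp : 2 ≤ p) (hm : IsUniqueMaximizer p β h m)
    (hpos : ∀ r, 0 < m r) (hLR : IsStandardChart p β m L R) :
    ∃ (B C : ℝ) (N₀ : ℕ), 0 < B ∧ 0 < C ∧ ∀ N : ℕ, N ≠ 0 → N₀ ≤ N →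
      ∀ (g : EuclideanSpace ℝ (Fin (d + 1)) → ℝ) (ω : EuclideanSpace ℝ (Fin d) → ℝ) (K : ℝ),
      Measurable g → (∀ z, |g (L z)| ≤ K * (1 + ‖z‖) ^ 2) →
      Integrable ω (stdGaussian (EuclideanSpace ℝ (Fin d))) → (∀ z, 0 ≤ ω z) →
      (∀ z z', ‖z' - z‖ ≤ B / √(N : ℝ) → |g (L z') - g (L z)| ≤ ω z) →
      |expectW p (d + 1) β h m N g - expectGaussian (covMatrix p (d + 1) β h m N) g|
        ≤ ∫ z, ω z ∂(stdGaussian (EuclideanSpace ℝ (Fin d))) + C * K / √(N : ℝ) := by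
  obtain ⟨B, C₁, N₁, hB, hC₁, H₁⟩ := exists_abs_expectW_sub_gaussian_le (h := h) hp hm hpos hLR
  obtain ⟨C₂, N₂, hC₂, H₂⟩ := exists_abs_chartCovMatrix_sub_le (h := h) hp hm hpos hLR
  obtain ⟨C₃, ε₀, hC₃, hε₀, H₃⟩ := exists_abs_expectGaussian_sub_le d
  refine ⟨B, C₁ + C₃ * C₂, max (max N₁ N₂) ⌈(C₂ / ε₀) ^ 2⌉₊, hB, by positivity,
    fun N hN hN₀ g ω K hg hgK hω hω0 hosc => ?_⟩
  have hN0 : (0 : ℝ) < N := by positivity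
  have hs : 0 < √(N : ℝ) := by positivity
  have hε : C₂ / √(N : ℝ) ≤ ε₀ := by
    rw [div_le_iff₀ hs, ← div_le_iff₀' hε₀]
    refine Real.le_sqrt_of_sq_le ?_
    exact (Nat.le_ceil _).trans (by exact_mod_cast (le_max_right _ _).trans hN₀)
  have hgL : Measurable fun z => g (L z) := hg.comp L.continuous.measurable
  have a1 := H₁ N hN (((le_max_left _ _).trans (le_max_left _ _)).trans hN₀) (fun z => g (L z)) ω K
    hgL hgK hω hω0 hosc
  have a2 := H₃ (chartCovMatrix p β h m R N) (C₂ / √(N : ℝ)) K (fun z => g (L z))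
    (posSemidef_covariance fun i (X : Fin N → Fin (d + 1)) => R (W m X) i) (by positivity) hε
    (H₂ N hN (((le_max_right _ _).trans (le_max_left _ _)).trans hN₀)) hgL hgK
  -- `W_N` lies on the hyperplane, so g (L (R W)) is g (W).
  have e1 : expectW p (d + 1) β h m N (fun x => g (L (R x))) = expectW p (d + 1) β h m N g := by
    simp only [expectW, hLR.map_W hm.1.2 hN]
  rw [e1] at a1
  rw [hLR.expectGaussian_covMatrix hm.1.2 hN hg]
  rw [abs_sub_comm] at a2
  refine (abs_sub_le _ _ _).trans ((add_le_add a1 a2).trans_eq ?_)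
  ring

end

/-! ### Oscillation of Lipschitz functions and of test classes -/

theorem IsUniqueMaximizer.unique {p q : ℕ} [NeZero q] {β h : ℝ} {m m' : Fin q → ℝ}
    (hm : IsUniqueMaximizer p β h m) (hm' : IsUniqueMaximizer p β h m') : m = m' := by
  by_contra hne
  exact lt_asymm (hm.2 m' hm'.1 (Ne.symm hne)) (hm'.2 m hm.1 hne)

theorem IsThriceDiffBounded.exists_lipschitz {q : ℕ} {g : EuclideanSpace ℝ (Fin q) → ℝ}
    (hg : IsThriceDiffBounded g) : Measurable g ∧ ∃ K : ℝ, 0 ≤ K ∧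
      ∀ x y, |g y - g x| ≤ K * ‖y - x‖ := by
  obtain ⟨hd, K, hK⟩ := hg
  have hdiff : Differentiable ℝ g := by
    have := hd 0 (by norm_num)
    rw [iteratedFDeriv_zero_eq_comp] at this
    exact (LinearIsometryEquiv.comp_differentiable_iff _).1 this
  have hb : ∀ x, ‖fderiv ℝ g x‖ ≤ K := fun x => by
    rw [← norm_iteratedFDeriv_one]
    exact hK 1 le_rfl (by norm_num) x
  refine ⟨hdiff.continuous.measurable, K, (norm_nonneg _).trans (hb 0), fun x y => ?_⟩
  exact convex_univ.norm_image_sub_le_of_norm_fderiv_le (fun x _ => hdiff x) (fun x _ => hb x)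
    (Set.mem_univ x) (Set.mem_univ y)

/-- An isometry preserves ‖t‖, hence the characteristic functions agree. Realizing the d-dimensional
Gaussian as an image of the q-dimensional one makes property (iv), stated in ℝ^q, usable in the
chart. -/
theorem stdGaussian_map_adjoint {E F : Type*} [NormedAddCommGroup E] [InnerProductSpace ℝ E]
    [FiniteDimensional ℝ E] [MeasurableSpace E] [BorelSpace E] [NormedAddCommGroup F]
    [InnerProductSpace ℝ F] [FiniteDimensional ℝ F] [MeasurableSpace F] [BorelSpace F]
    (J : E →ₗᵢ[ℝ] F) : (stdGaussian F).map (ContinuousLinearMap.adjoint J.toContinuousLinearMap)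
      = stdGaussian E := by
  have : CompleteSpace E := FiniteDimensional.complete ℝ E
  have : CompleteSpace F := FiniteDimensional.complete ℝ F
  refine Measure.ext_of_charFun (funext fun t => ?_)
  rw [charFun_map_continuousLinearMap, ContinuousLinearMap.adjoint_adjoint, charFun_stdGaussian,
    charFun_stdGaussian]
  simp

/-- The isometric embedding that inserts a zero first coordinate. -/
noncomputable def consZero (d : ℕ) :
    EuclideanSpace ℝ (Fin d) →ₗᵢ[ℝ] EuclideanSpace ℝ (Fin (d + 1)) where
  toFun z := WithLp.toLp 2 (Fin.cons 0 z.ofLp : Fin (d + 1) → ℝ)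
  map_add' x y := by
    ext r
    refine Fin.cases ?_ (fun i => ?_) r <;> simp
  map_smul' c x := by
    ext r
    refine Fin.cases ?_ (fun i => ?_) r <;> simp
  norm_map' x := by
    change ‖WithLp.toLp 2 (Fin.cons 0 x.ofLp : Fin (d + 1) → ℝ)‖ = ‖x‖
    rw [EuclideanSpace.norm_eq, EuclideanSpace.norm_eq, Fin.sum_univ_succ]
    simp

section

variable {q : ℕ} {M : ℝ} {g : EuclideanSpace ℝ (Fin q) → ℝ}

theorem bddAbove_image_closedBall (hg : ∀ x, |g x| ≤ M) (δ : ℝ) (x : EuclideanSpace ℝ (Fin q)) :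
    BddAbove ((fun y => g (x + y)) '' Metric.closedBall 0 δ) :=
  ⟨M, by rintro _ ⟨y, -, rfl⟩; exact (abs_le.1 (hg _)).2⟩

theorem bddBelow_image_closedBall (hg : ∀ x, |g x| ≤ M) (δ : ℝ) (x : EuclideanSpace ℝ (Fin q)) :
    BddBelow ((fun y => g (x + y)) '' Metric.closedBall 0 δ) :=
  ⟨-M, by rintro _ ⟨y, -, rfl⟩; exact (abs_le.1 (hg _)).1⟩

theorem le_supBall (hg : ∀ x, |g x| ≤ M) {δ : ℝ} (x : EuclideanSpace ℝ (Fin q))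
    {y : EuclideanSpace ℝ (Fin q)} (hy : ‖y‖ ≤ δ) : g (x + y) ≤ supBall g δ x :=
  le_csSup (bddAbove_image_closedBall hg δ x) ⟨y, by simpa using hy, rfl⟩

theorem infBall_le (hg : ∀ x, |g x| ≤ M) {δ : ℝ} (x : EuclideanSpace ℝ (Fin q))
    {y : EuclideanSpace ℝ (Fin q)} (hy : ‖y‖ ≤ δ) : infBall g δ x ≤ g (x + y) :=
  csInf_le (bddBelow_image_closedBall hg δ x) ⟨y, by simpa using hy, rfl⟩

end

/-- The oscillation of a function of a test class, composed with a linear map into `ℝ^q`, has a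
Gaussian mean of the order of the scale. -/
theorem IsTestClass.exists_oscillation_bound {d : ℕ} {M c : ℝ}
    {𝒢 : Set (EuclideanSpace ℝ (Fin (d + 1)) → ℝ)} (h𝒢 : IsTestClass M c 𝒢)
    (L : EuclideanSpace ℝ (Fin d) →L[ℝ] EuclideanSpace ℝ (Fin (d + 1)))
    {g : EuclideanSpace ℝ (Fin (d + 1)) → ℝ} (hg : g ∈ 𝒢) {δ : ℝ} (hδ : 0 < δ) :
    ∃ ω : EuclideanSpace ℝ (Fin d) → ℝ,
      Integrable ω (stdGaussian (EuclideanSpace ℝ (Fin d))) ∧ (∀ z, 0 ≤ ω z) ∧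
      (∀ z z', ‖z' - z‖ ≤ δ → |g (L z') - g (L z)| ≤ ω z) ∧
      ∫ z, ω z ∂(stdGaussian (EuclideanSpace ℝ (Fin d))) ≤ c * δ := by
  set J := consZero d with hJ
  set T := ContinuousLinearMap.adjoint J.toContinuousLinearMap with hT
  have hTJ : ∀ z, T (J z) = z := fun z => by
    have h1 := (ContinuousLinearMap.norm_map_iff_adjoint_comp_self
      J.toContinuousLinearMap).1 fun x => J.norm_map x
    exact DFunLike.congr_fun h1 z
  -- L is not square. Composing it with the projection T gives a q × q matrix, so property (ii) with
  -- b = 0 puts g ∘ L ∘ T in the class.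
  set A := (Matrix.toEuclideanCLM (n := Fin (d + 1)) (𝕜 := ℝ)).symm (L ∘L T) with hA
  set f : EuclideanSpace ℝ (Fin (d + 1)) → ℝ := fun x => g (L (T x)) with hf
  have hf𝒢 : f ∈ 𝒢 := by
    have := h𝒢.affine g hg A 0
    rw [hA, StarAlgEquiv.apply_symm_apply] at this
    simpa using this
  have hfM := h𝒢.bounded f hf𝒢
  have hs := h𝒢.supBall_mem f hf𝒢 δ hδ
  have hi := h𝒢.infBall_mem f hf𝒢 δ hδ
  -- f depends on x only through T x, and so do its suprema and infima over balls. This identifies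
  -- the mean of ω in dimension d with the integral in property (iv).
  have hfJ : ∀ x y, f (J (T x) + y) = f (x + y) := fun x y => by
    simp only [hf, map_add, hTJ]
  have hle : ∀ z z', ‖z' - z‖ ≤ δ → f (J z + J (z' - z)) = g (L z') := fun z z' _ => by
    simp only [hf, ← map_add, hTJ, add_sub_cancel]
  have hm : Measurable fun z => supBall f δ (J z) - infBall f δ (J z) :=
    ((h𝒢.measurable _ hs).comp J.continuous.measurable).sub
      ((h𝒢.measurable _ hi).comp J.continuous.measurable)
  have hosc : ∀ z z', ‖z' - z‖ ≤ δ →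
      infBall f δ (J z) ≤ g (L z') ∧ g (L z') ≤ supBall f δ (J z) := fun z z' hz => by
    rw [← hle z z' hz]
    exact ⟨infBall_le hfM _ (by rwa [J.norm_map]), le_supBall hfM _ (by rwa [J.norm_map])⟩
  have hself : ∀ z : EuclideanSpace ℝ (Fin d), ‖z - z‖ ≤ δ := fun z => by simpa using hδ.le
  refine ⟨fun z => supBall f δ (J z) - infBall f δ (J z), ?_, fun z => ?_, fun z z' hz => ?_, ?_⟩
  · refine integrable_stdGaussian_of_growth (K := M + M) (n := 0) hm fun z => ?_
    rw [pow_zero, mul_one]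
    exact (abs_sub _ _).trans (add_le_add (h𝒢.bounded _ hs _) (h𝒢.bounded _ hi _))
  · have := hosc z z (hself z)
    linarith [this.1, this.2]
  · have h1 := hosc z z' hz
    have h2 := hosc z z (hself z)
    rw [abs_le]
    constructor <;> linarith [h1.1, h1.2, h2.1, h2.2]
  · refine le_trans (le_of_eq ?_) (h𝒢.oscillation f hf𝒢 δ hδ)
    rw [← stdGaussian_map_adjoint J, integral_map T.continuous.aemeasurable hm.aestronglyMeasurable]
    refine integral_congr_ae (Filter.Eventually.of_forall fun x => ?_)
    simp only [supBall, infBall, hfJ]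

theorem abs_expectW_sub_expectGaussian_le {p q : ℕ} [NeZero q] {β h : ℝ} {m : Fin q → ℝ} {N : ℕ}
    {M : ℝ} {g : EuclideanSpace ℝ (Fin q) → ℝ} (hg : ∀ x, |g x| ≤ M)
    (S : Matrix (Fin q) (Fin q) ℝ) : |expectW p q β h m N g - expectGaussian S g| ≤ M + M := by
  refine (abs_sub _ _).trans (add_le_add ?_ ?_)
  · have := norm_integral_le_of_norm_le_const (μ := gibbsMeasure p q β h N)
      (f := fun X => g (W m X)) (C := M)
      (Filter.Eventually.of_forall fun X => hg (W m X))
    simpa [expectW] using this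
  · have := norm_integral_le_of_norm_le_const (μ := stdGaussian (EuclideanSpace ℝ (Fin q)))
      (f := fun z => g (Matrix.toEuclideanCLM (𝕜 := ℝ) (CFC.sqrt S) z)) (C := M)
      (Filter.Eventually.of_forall fun z => hg (Matrix.toEuclideanCLM (𝕜 := ℝ) (CFC.sqrt S) z))
    simpa [expectGaussian] using this

end CurieWeissPotts

/-! ### Conclusion: the two rates of convergence -/

theorem theorem3p1 (p q : ℕ) [NeZero q] (hp : 2 ≤ p) (hq : 2 ≤ q) (β h : ℝ)
    (hreg : IsRegularPoint p q β h) (m : Fin q → ℝ) (hm : IsUniqueMaximizer p β h m) :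
    (∀ g : EuclideanSpace ℝ (Fin q) → ℝ, IsThriceDiffBounded g →
      ∃ C : ℝ, 0 < C ∧ ∀ N : ℕ, 1 ≤ N →
        |expectW p q β h m N g - expectGaussian (covMatrix p q β h m N) g|
          ≤ C * (N : ℝ) ^ (-(1 / 2) : ℝ)) ∧
    (∀ M c : ℝ, ∃ D : ℝ, 0 < D ∧
      ∀ 𝒢 : Set (EuclideanSpace ℝ (Fin q) → ℝ), IsTestClass M c 𝒢 →
        ∀ N : ℕ, 2 ≤ N → ∀ g ∈ 𝒢,
          |expectW p q β h m N g - expectGaussian (covMatrix p q β h m N) g|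
            ≤ D * Real.log N / √(N : ℝ)) := by
  obtain ⟨d, rfl⟩ : ∃ d, q = d + 1 := ⟨q - 1, by omega⟩
  obtain ⟨hβ, hh, m', hm', hneg⟩ := hreg
  obtain rfl := hm.unique hm'
  have hpos := hm.pos hβ.le hh (by omega)
  obtain ⟨L, R, hLR⟩ := exists_isStandardChart hneg
  obtain ⟨B, C, N₀, hB, hC, H⟩ :=
    exists_abs_expectW_sub_expectGaussian_le (h := h) hp hm hpos hLR
  refine ⟨fun g hg => ?_, fun M c => ?_⟩
  · obtain ⟨hgm, K, hK, hlip⟩ := hg.exists_lipschitz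
    have hgrow : ∀ z, |g (L z)| ≤ (|g 0| + K * ‖L‖) * (1 + ‖z‖) ^ 2 := fun z => by
      have h1 := hlip 0 (L z)
      rw [sub_zero] at h1
      have h2 : K * ‖L z‖ ≤ K * (‖L‖ * ‖z‖) := by gcongr; exact L.le_opNorm z
      have h3 : |g (L z)| ≤ |g (L z) - g 0| + |g 0| := by
        simpa using abs_add_le (g (L z) - g 0) (g 0)
      have h4 : 0 ≤ K * ‖L‖ := by positivity
      calc |g (L z)| ≤ |g 0| * 1 + K * ‖L‖ * ‖z‖ := by linarith
        _ ≤ |g 0| * (1 + ‖z‖) ^ 2 + K * ‖L‖ * (1 + ‖z‖) ^ 2 := by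
          gcongr <;> nlinarith [norm_nonneg z]
        _ = _ := by ring
    set diff : ℕ → ℝ := fun N => |expectW p (d + 1) β h m N g
      - expectGaussian (covMatrix p (d + 1) β h m N) g| with hdiff
    set C' := K * ‖L‖ * B + C * (|g 0| + K * ‖L‖) with hC'
    have hC'0 : 0 ≤ C' := by positivity
    have hS0 : 0 ≤ ∑ n ∈ Finset.range N₀, diff n * √(n : ℝ) :=
      Finset.sum_nonneg fun n _ => mul_nonneg (abs_nonneg _) (Real.sqrt_nonneg _)
    -- C' serves N ≥ N₀. The finite sum covers the smaller N and may depend on g, as the constant in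
    -- (1) does.
    refine ⟨C' + ∑ n ∈ Finset.range N₀, diff n * √(n : ℝ) + 1, by positivity, fun N hN => ?_⟩
    have hN' : N ≠ 0 := by omega
    have hN0 : (0 : ℝ) < N := by positivity
    have hs : 0 < √(N : ℝ) := by positivity
    rw [Real.rpow_neg hN0.le, ← Real.sqrt_eq_rpow, ← div_eq_mul_inv, le_div_iff₀ hs]
    change diff N * √(N : ℝ) ≤ _
    rcases le_or_gt N₀ N with hNN | hNN
    · have h1 := H N hN' hNN g (fun _ => K * (‖L‖ * (B / √(N : ℝ)))) _ hgm hgrow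
        (integrable_const _) (fun z => by positivity) fun z z' hz => by
          refine (hlip _ _).trans ?_
          rw [← map_sub]
          gcongr
          refine (L.le_opNorm _).trans ?_
          gcongr
      have h2 : diff N ≤ C' / √(N : ℝ) := by
        refine h1.trans_eq ?_
        rw [hC']
        simp
        ring
      rw [le_div_iff₀ hs] at h2
      linarith
    · have := Finset.single_le_sum (f := fun n : ℕ => diff n * √(n : ℝ))
        (fun n _ => mul_nonneg (abs_nonneg _) (Real.sqrt_nonneg _)) (Finset.mem_range.2 hNN)
      linarith
  · have hl2 : 0 < Real.log 2 := Real.log_pos one_lt_two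
    -- Here the constant must be uniform in g, so N < N₀ is handled by the trivial bound 2|M|. The
    -- absolute values allow for negative M or c, and the division by log 2 prepares for log N ≥ log
    -- 2.
    refine ⟨(|c| * B + C * |M| + (|M| + |M|) * √(N₀ : ℝ)) / Real.log 2 + 1, by positivity,
      fun 𝒢 h𝒢 N hN g hg => ?_⟩
    have hN' : N ≠ 0 := by omega
    have hN0 : (0 : ℝ) < N := by positivity
    have hs : 0 < √(N : ℝ) := by positivity
    have hlog : Real.log 2 ≤ Real.log N := Real.log_le_log two_pos (by exact_mod_cast hN)
    have hbd : ∀ x, |g x| ≤ |M| := fun x => (h𝒢.bounded g hg x).trans (le_abs_self M)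
    -- The rate without logarithm; the factor log N is inserted only at the end.
    have key : |expectW p (d + 1) β h m N g - expectGaussian (covMatrix p (d + 1) β h m N) g|
        ≤ (|c| * B + C * |M| + (|M| + |M|) * √(N₀ : ℝ)) / √(N : ℝ) := by
      rcases le_or_gt N₀ N with hNN | hNN
      · obtain ⟨ω, hω, hω0, hosc, hint⟩ :=
          h𝒢.exists_oscillation_bound L hg (δ := B / √(N : ℝ)) (by positivity)
        have h1 := H N hN' hNN g ω |M| (h𝒢.measurable g hg) (fun z => by
          refine (hbd _).trans (le_mul_of_one_le_right (abs_nonneg _) ?_)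
          exact one_le_pow₀ (by linarith [norm_nonneg z])) hω hω0 hosc
        have h2 : c * (B / √(N : ℝ)) ≤ |c| * (B / √(N : ℝ)) := by
          gcongr
          exact le_abs_self c
        have h3 : 0 ≤ (|M| + |M|) * √(N₀ : ℝ) / √(N : ℝ) := by positivity
        rw [add_div, add_div, mul_div_assoc |c|]
        linarith
      · rw [le_div_iff₀ hs]
        have h1 := abs_expectW_sub_expectGaussian_le (p := p) (β := β) (h := h) (m := m) (N := N)
          hbd (covMatrix p (d + 1) β h m N)
        have h2 : √(N : ℝ) ≤ √(N₀ : ℝ) := Real.sqrt_le_sqrt (by exact_mod_cast hNN.le)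
        have h3 : 0 ≤ |c| * B + C * |M| := by positivity
        have h4 := mul_le_mul h1 h2 hs.le (by positivity)
        linarith
    refine key.trans ?_
    gcongr
    set Q := |c| * B + C * |M| + (|M| + |M|) * √(N₀ : ℝ) with hQ
    have hQ0 : 0 ≤ Q := by positivity
    calc Q = Q / Real.log 2 * Real.log 2 := by field_simp
      _ ≤ (Q / Real.log 2 + 1) * Real.log N := by
        gcongr
        linarith
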